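/- **Notation.** Let $n\ge 1$ and $R\subseteq[n-1]$, where $[k]=\{1,\dots,k\}$. Write $R=\{q_1<\dots<q_r\}$, $q_0=0$, $q_{r+1}=n$. The *carrels* are the intervals $(q_{h-1},q_h]$, $1\le h\le r+1$. All tuples $\nu=(\nu_1,\dots,\nu_n)$ have entries in $[n]$. A tuple is *upper* if $\nu_i\ge i$ for all $i$; an *upper flag* is a weakly increasing upper tuple; a tuple is *$R$-increasing* if it is strictly increasing on each carrel. Let $U(n)$ and $UF(n)$ be the sets of upper tuples and of upper flags. *$R$-parabolic Catalan number.* An *$R$-permutation* is an $R$-increasing permutation $\pi$ of $[n]$. It is *$R$-312-avoiding* if there are no $h\in[r-1]$ and $a\le q_h<b\le q_{h+1}<c$ with $\pi_a>\pi_b<\pi_c$ and $\pi_a>\pi_c$. Let $C_n^R$ be the number of $R$-312-avoiding $R$-permutations. *Critical lists.* A *set of critical pairs* for a carrel $(q_{h-1},q_h]$ is a set of pairs $(x_u,y_{x_u})$, $1\le u\le f$, $f\ge 1$, with $q_{h-1}<x_f<\dots<x_1=q_h$, $x_u\le y_{x_u}\le n$, and $y_{x_{u-1}}-y_{x_u}>x_{u-1}-x_u$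 for $1<u\le f$. An *$R$-critical list* consists of one such set for each carrel; it is a *flag $R$-critical list* if for each $h\in[r]$ the critical entry $y_{q_h}$ is at most the critical entry at the leftmost critical index of the next carrel. The $R$-critical list of $\upsilon\in U(n)$ has as its critical indices in $(q_{h-1},q_h]$: first $x_1=q_h$, and then, as long as it exists, $x_u$ is the largest index with $q_{h-1}<x_u<x_{u-1}$ and $\upsilon_{x_{u-1}}-\upsilon_{x_u}>x_{u-1}-x_u$; its critical entries are the $\upsilon_{x_u}$. Let $UGC_R(n)$ be the set of $\upsilon\in U(n)$ whose $R$-critical list is a flag $R$-critical list (*gapless core $R$-tuples*). *Special tuples.* An *$R$-canopy tuple* is a $\kappa\in UGC_R(n)$ with $\kappa_i=n$ for every non-critical index $i$. An *$R$-floor flag* is a $\tau\in UF(n)$ such that every maximal constant run of $\tau$ of length at least 2 starts at an index in $R$. An *$R$-ceiling flag* is a $\xi\in UF(n)$ that is a concatenation of constant blocks whose right ends are exactly the critical indices of $\xi$. For $\upsilon,\upsilon'\in U(n)$, write $\upsilon\sim_R\upsilon'$ if the same $R$-increasing upper tuples $\epsilon$ satisfy $\epsilon\le\upsilon$ (entrywise)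 as satisfy $\epsilon\le\upsilon'$. *Tableaux.* Let $\lambda=(\lambda_1\ge\dots\ge\lambda_n\ge0)$ be a partition whose set of distinct column lengths less than $n$ is $R$. Let $\mathcal T_\lambda$ be the set of semistandard tableaux of shape $\lambda$ with values in $[n]$. For $\beta\in U(n)$ let $\mathcal S_\lambda(\beta)$ be the set of $T\in\mathcal T_\lambda$ whose values in row $i$ are at most $\beta_i$, for all $i$; write $\beta\approx_\lambda\beta'$ if $\mathcal S_\lambda(\beta)=\mathcal S_\lambda(\beta')$. For an $R$-permutation $\pi$, the key $Y_\lambda(\pi)$ is the tableau of shape $\lambda$ whose columns of length $q$ have the value set $\{\pi_1,\dots,\pi_q\}$, and $\mathcal D_\lambda(\pi)$ is the set of $T\in\mathcal T_\lambda$ whose (Lascoux–Schützenberger) right key is entrywise at most $Y_\lambda(\pi)$. Let $s_\lambda(\beta;x)$ and $d_\lambda(\pi;x)$ be the sums of $x^{\Theta(T)}=\prod_k x_k^{\#\{\text{values }k\text{ in }T\}}$ over $T\in\mathcal S_\lambda(\beta)$ and over $T\in\mathcal D_\lambda(\pi)$: *Demazure polynomials* $d_\lambda(\pi;x)$, *flag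 Schur polynomials* $s_\lambda(\phi;x)$ for $\phi\in UF(n)$, and *gapless core Schur polynomials* $s_\lambda(\eta;x)$ for $\eta\in UGC_R(n)$. *Gessel–Viennot inputs.* The pair $(\lambda,\beta)$, $\beta\in U(n)$, is *nonpermutable* if pairwise disjoint lattice paths (unit steps east and north) from $(n-w(i),1)$ to $(\lambda_i+n-i,\beta_i)$, $i\in[n]$, exist for no permutation $w\ne 1$ of $[n]$. Its Gessel–Viennot determinant is the $n\times n$ determinant with entries $h_{\lambda_i-i+j}(x_1,\dots,x_{\beta_i})$, the complete homogeneous symmetric polynomials. A *valid input* for a polynomial $p$ is a $\beta\in U(n)$ such that $(\lambda,\beta)$ is nonpermutable and $s_\lambda(\beta;x)=p$. It *attains maximum efficiency* if the total number of monomials among the entries of its determinant is smaller than for every other valid input for $p$. **Theorem.** Let $n\geq 1$, $R\subseteq[n-1]$, and let $\lambda$ be a partition as above. The number $C_n^R$ is equal to each of the following numbers: 1. the number of flag $R$-critical lists; 2. the number of $R$-canopy tuples; the number of $R$-floor flags; the number of $R$-ceiling flags; 3. the number of equivalence classes of $\sim_R$ in $UGC_R(n)$, of $\sim_R$ in $UF(n)$,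 of $\approx_\lambda$ in $UGC_R(n)$, and of $\approx_\lambda$ in $UF(n)$; 4. the number of distinct Demazure polynomials $d_\lambda(\pi;x)$ for $R$-312-avoiding $R$-permutations $\pi$; the number of distinct gapless core Schur polynomials $s_\lambda(\eta;x)$, $\eta\in UGC_R(n)$; the number of distinct flag Schur polynomials $s_\lambda(\phi;x)$, $\phi\in UF(n)$; 5. the number of distinct pairs of sets $(\mathcal S_\lambda(\beta),\mathcal D_\lambda(\pi))$ with $\beta\in U(n)$, $\pi$ an $R$-permutation and $\mathcal S_\lambda(\beta)=\mathcal D_\lambda(\pi)$; the number of distinct pairs of polynomials $(s_\lambda(\beta;x),d_\lambda(\pi;x))$ with $\beta\in U(n)$, $\pi$ an $R$-permutation and $s_\lambda(\beta;x)=d_\lambda(\pi;x)$; 6. the number of valid inputs $\beta\in U(n)$ for flag Schur polynomials $s_\lambda(\phi;x)$, $\phi\in UF(n)$, that attain maximum efficiency. -/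

import Mathlib

/-! Conventions.  The set `[n] = {1, ..., n}` is represented by `Fin n`, so indices and values are
shifted down by one: the entry `ν_i = v` of an `nn`-tuple is `ν (i - 1) = v - 1`.
Divider positions and column lengths (the elements of `R`) are not shifted.  Shapes are Young
diagrams with at most `n` rows; a box is `(row, column)`, both counted from `0`. -/

namespace ParabolicCatalan

open Finset

section Tuples

variable (n : ℕ) (R : Finset ℕ)

/-- For `R = {q_1 < ... < q_r}`, this is `q_h`, with `q_0 = 0` and `q_{r+1} = n`. -/
noncomputable def divider (h : ℕ) : ℕ :=
  if h = 0 then 0 else if h ≤ R.card then Nat.nth (fun q => q ∈ R) (h - 1) else n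

/-- `i` lies in the carrel `(q_h, q_{h+1}]` (as 1-based index), for `0 ≤ h ≤ r`. -/
def InCarrel (h : ℕ) (i : Fin n) : Prop :=
  divider n R h ≤ (i : ℕ) ∧ (i : ℕ) < divider n R (h + 1)

/-- The tuple is (strictly) increasing on each carrel. -/
def IsRIncreasing (ν : Fin n → Fin n) : Prop :=
  ∀ h : ℕ, ∀ i j : Fin n, InCarrel n R h i → InCarrel n R h j → i < j → ν i < ν j

/-- Upper tuples: `υ_i ≥ i`. -/
def upperTuples : Set (Fin n → Fin n) := {υ | ∀ i, i ≤ υ i}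

/-- Upper flags: weakly increasing upper tuples. -/
def upperFlags : Set (Fin n → Fin n) := {φ | φ ∈ upperTuples n ∧ Monotone φ}

/-- `R`-increasing upper tuples. -/
def upperIncreasing : Set (Fin n → Fin n) := {α | α ∈ upperTuples n ∧ IsRIncreasing n R α}

/-- `R`-permutations. -/
def rPermutations : Set (Equiv.Perm (Fin n)) := {π | IsRIncreasing n R π}

/-- `π` is `R`-312-containing: there are `h ∈ [r-1]` and `a ≤ q_h < b ≤ q_{h+1} < c` with
`π_a > π_b < π_c` and `π_a > π_c`. -/
def Contains312 (π : Equiv.Perm (Fin n)) : Prop :=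
  ∃ h : ℕ, 1 ≤ h ∧ h + 1 ≤ R.card ∧ ∃ a b c : Fin n,
    (a : ℕ) < divider n R h ∧
    divider n R h ≤ (b : ℕ) ∧ (b : ℕ) < divider n R (h + 1) ∧
    divider n R (h + 1) ≤ (c : ℕ) ∧
    π b < π a ∧ π b < π c ∧ π c < π a

/-- `R`-312-avoiding `R`-permutations. -/
def avoidingPermutations : Set (Equiv.Perm (Fin n)) :=
  {π | π ∈ rPermutations n R ∧ ¬ Contains312 n R π}

/-- The `R`-parabolic Catalan number. -/
noncomputable def parabolicCatalan : ℕ := (avoidingPermutations n R).ncard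

/-- The critical indices of `υ` in the carrel number `h`, found from the right: the right end of
the carrel is critical, and from a critical index `x` the next one to the left is the largest
`y < x` of the carrel with `υ_x - υ_y > x - y`, if there is one. -/
inductive IsCriticalIndex (υ : Fin n → Fin n) (h : ℕ) : Fin n → Prop
  | rightmost (x : Fin n) : InCarrel n R h x → (x : ℕ) + 1 = divider n R (h + 1) →
      IsCriticalIndex υ h x
  | next (x y : Fin n) : IsCriticalIndex υ h x → InCarrel n R h y → y < x →
      (υ y : ℕ) + (x : ℕ) < (υ x : ℕ) + (y : ℕ) →
      (∀ z : Fin n, y < z → z < x → ¬ (υ z : ℕ) + (x : ℕ) < (υ x : ℕ) + (z : ℕ)) →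
      IsCriticalIndex υ h y

/-- `x` is a critical index of `υ` (in one of the carrels). -/
def IsCritical (υ : Fin n → Fin n) (x : Fin n) : Prop :=
  ∃ h : Fin (R.card + 1), IsCriticalIndex n R υ h x

open Classical in
/-- The `R`-critical list of `υ`: for each carrel its set of critical pairs `(x, υ_x)`. -/
noncomputable def criticalList (υ : Fin n → Fin n) :
    Fin (R.card + 1) → Finset (Fin n × Fin n) :=
  fun h => univ.filter fun p => IsCriticalIndex n R υ h p.1 ∧ p.2 = υ p.1

/-- An `R`-critical list: for each of the `r + 1` carrels a finite set of pairs `(x, y_x)` such that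
`x` lies in the carrel, `x ≤ y_x`, distinct pairs have distinct indices `x`, the right end of
the carrel is one of the indices, and `y_{x'} - y_x > x' - x` for indices `x < x'`
(it is equivalent to require this for neighbouring indices only). -/
def IsCriticalList (C : Fin (R.card + 1) → Finset (Fin n × Fin n)) : Prop :=
  ∀ h : Fin (R.card + 1),
    (∀ p ∈ C h, InCarrel n R h p.1 ∧ p.1 ≤ p.2) ∧
    (∃ p ∈ C h, (p.1 : ℕ) + 1 = divider n R ((h : ℕ) + 1)) ∧
    (∀ p ∈ C h, ∀ p' ∈ C h, p.1 = p'.1 → p = p') ∧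
    (∀ p ∈ C h, ∀ p' ∈ C h, p.1 < p'.1 →
      (p.2 : ℕ) + (p'.1 : ℕ) < (p'.2 : ℕ) + (p.1 : ℕ))

/-- A flag `R`-critical list: the critical entry at the right end of a carrel is at most the
leftmost critical entry of the next carrel. -/
def IsFlagCriticalList (C : Fin (R.card + 1) → Finset (Fin n × Fin n)) : Prop :=
  IsCriticalList n R C ∧
  ∀ h h' : Fin (R.card + 1), (h' : ℕ) = (h : ℕ) + 1 →
    ∀ p ∈ C h, (p.1 : ℕ) + 1 = divider n R ((h : ℕ) + 1) →
    ∀ p' ∈ C h', (∀ p'' ∈ C h', p'.1 ≤ p''.1) → p.2 ≤ p'.2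

/-- The set of flag `R`-critical lists. -/
def flagCriticalLists : Set (Fin (R.card + 1) → Finset (Fin n × Fin n)) :=
  {C | IsFlagCriticalList n R C}

/-- Gapless core `R`-tuples: upper tuples whose `R`-critical list is a flag `R`-critical list. -/
def gaplessCoreTuples : Set (Fin n → Fin n) :=
  {η | η ∈ upperTuples n ∧ IsFlagCriticalList n R (criticalList n R η)}

/-- `R`-canopy tuples: gapless core tuples whose non-critical entries all equal the largest
element of `[n]`. -/
def canopyTuples : Set (Fin n → Fin n) :=
  {κ | κ ∈ gaplessCoreTuples n R ∧ ∀ i, ¬ IsCritical n R κ i → (κ i : ℕ) + 1 = n}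

/-- The interval `[a, b]` supports a plateau of `ν`: a maximal constant subsequence. -/
def IsPlateau (ν : Fin n → Fin n) (a b : Fin n) : Prop :=
  a ≤ b ∧ (∀ k, a ≤ k → k ≤ b → ν k = ν a) ∧
  (∀ k : Fin n, (k : ℕ) + 1 = (a : ℕ) → ν k ≠ ν a) ∧
  (∀ k : Fin n, (k : ℕ) = (b : ℕ) + 1 → ν k ≠ ν b)

/-- `R`-floor flags: upper flags in which each plateau of length at least two starts at (1-based)
index `q_h` for some `h ∈ [r]`, that is, at an element of `R`. -/
def floorFlags : Set (Fin n → Fin n) :=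
  {τ | τ ∈ upperFlags n ∧ ∀ a b, IsPlateau n τ a b → a < b → (a : ℕ) + 1 ∈ R}

/-- `R`-ceiling flags: upper flags that are concatenations of constant blocks, the right ends of
these blocks being the critical indices. -/
def ceilingFlags : Set (Fin n → Fin n) :=
  {ξ | ξ ∈ upperFlags n ∧ ∀ i x, i ≤ x → IsCritical n R ξ x →
    (∀ k, i ≤ k → k < x → ¬ IsCritical n R ξ k) → ξ i = ξ x}

/-- The set of `R`-increasing upper tuples that are entrywise at most `υ`. -/
def increasingBelow (υ : Fin n → Fin n) : Set (Fin n → Fin n) :=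
  {ε | ε ∈ upperIncreasing n R ∧ ε ≤ υ}

/-- The equivalence relation `∼_R` restricted to a set `A` of tuples. -/
def simEquiv (A : Set (Fin n → Fin n)) : Setoid A :=
  Setoid.ker fun υ : A => increasingBelow n R υ

end Tuples

section Tableaux

variable (n : ℕ) (lam : YoungDiagram)

/-- The set of distinct column lengths less than `n` of the shape. -/
def columnLengths : Finset ℕ := (lam.cells.image fun c => lam.colLen c.2).filter (· < n)

/-- The semistandard tableaux of the given shape with values in `[n]`. -/
def tableaux : Set (SemistandardYoungTableau lam) :=
  {T | ∀ i j, (i, j) ∈ lam → T i j < n}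

theorem tableaux_finite : (tableaux n lam).Finite := by
  classical
  have key : Function.Injective
      (fun (T : tableaux n lam) (c : lam.cells) =>
        (⟨T.1 c.1.1 c.1.2, T.2 _ _ c.2⟩ : Fin n)) := by
    intro T T' h
    apply Subtype.ext
    apply SemistandardYoungTableau.ext
    intro i j
    by_cases hc : (i, j) ∈ lam
    · have := congrFun h ⟨(i, j), hc⟩
      simpa using this
    · rw [T.1.zeros hc, T'.1.zeros hc]
  have : Finite (tableaux n lam) := Finite.of_injective _ key
  exact Set.toFinite _

/-- The row bound set `𝒮_λ(β)`: the values in row `i` are at most `β_i`.  (Only used for upper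
`β`, for which a prepended column `1, 2, ..., n` satisfies the bounds as well.) -/
def rowBoundSet (β : Fin n → Fin n) : Set (SemistandardYoungTableau lam) :=
  {T | T ∈ tableaux n lam ∧ ∀ (i : Fin n) (j : ℕ), ((i : ℕ), j) ∈ lam → T i j ≤ β i}

/-- The value in row `i` and column `j` of the key of `π`: column `j`, of length `q`, consists of
`π_1, ..., π_q` in increasing order. -/
noncomputable def keyEntry (π : Equiv.Perm (Fin n)) (i j : ℕ) : ℕ :=
  Nat.nth (fun v => ∃ a : Fin n, (a : ℕ) < lam.colLen j ∧ (π a : ℕ) = v) i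

variable {lam} in
/-- One step of a scan.  A state `(v, h)` holds the last value `v` of the earliest weakly increasing
subsequence found so far, and the number `h c` of boxes of each column `c` that are not
marked yet (these are the top ones).  At column `c`, if its lowest unmarked box exists and its
value is at least `v`, then this value extends the subsequence and the box gets marked. -/
def scanStep (T : SemistandardYoungTableau lam) (s : ℕ × (ℕ → ℕ)) (c : ℕ) : ℕ × (ℕ → ℕ) :=
  if 0 < s.2 c ∧ s.1 ≤ T (s.2 c - 1) c then
    (T (s.2 c - 1) c, Function.update s.2 c (s.2 c - 1))
  else s

variable {lam} in
/-- One scan through the columns `j, j + 1, ...` from left to right: it finds the earliest weakly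
increasing subsequence of the sequence of the lowest unmarked values of the columns.  The result is
its final value, together with the new numbers of unmarked boxes. -/
def scan (T : SemistandardYoungTableau lam) (j : ℕ) (h : ℕ → ℕ) : ℕ × (ℕ → ℕ) :=
  (List.range' j (lam.rowLen 0 - j)).foldl (scanStep T) (0, h)

variable {lam} in
/-- The numbers of unmarked boxes after `k` scans that start in column `j`. -/
def unmarked (T : SemistandardYoungTableau lam) (j k : ℕ) : ℕ → ℕ :=
  (fun h => (scan T j h).2)^[k] lam.colLen

variable {lam} in
/-- The value in row `i` and column `j` of the scanning tableau `S(T)`, which is the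
Lascoux-Schützenberger right key of `T`.  Column `j` is filled from bottom to top with the final
values of successive scans that start in column `j` of `T`. -/
def scanEntry (T : SemistandardYoungTableau lam) (i j : ℕ) : ℕ :=
  (scan T j (unmarked T j (lam.colLen j - 1 - i))).1

/-- The set `𝒟_λ(π)` of Demazure tableaux: the tableaux whose right key is entrywise at most the key
of `π`. -/
def demazureSet (π : Equiv.Perm (Fin n)) : Set (SemistandardYoungTableau lam) :=
  {T | T ∈ tableaux n lam ∧ ∀ i j, (i, j) ∈ lam → scanEntry T i j ≤ keyEntry n lam π i j}

/-- The equivalence relation `≈_λ` restricted to a set `A` of tuples: equality of row bound sets. -/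
def approxEquiv (A : Set (Fin n → Fin n)) : Setoid A :=
  Setoid.ker fun β : A => rowBoundSet n lam β

/-- The weight `x^Θ(T)` of a tableau, where `Θ(T)_k` is the number of values `k` in `T`. -/
noncomputable def weight (T : SemistandardYoungTableau lam) : MvPolynomial (Fin n) ℤ :=
  ∏ k : Fin n, MvPolynomial.X k ^ (lam.cells.filter fun c => T c.1 c.2 = k).card

open Classical in
/-- The sum of the weights of the tableaux with values in `[n]` that belong to `P`. -/
noncomputable def generatingPolynomial (P : Set (SemistandardYoungTableau lam)) :
    MvPolynomial (Fin n) ℤ :=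
  ∑ T ∈ (tableaux_finite n lam).toFinset.filter (· ∈ P), weight n lam T

/-- The row bound sum `s_λ(β; x)`; it is called a flag Schur polynomial if `β` is an upper flag and
a gapless core Schur polynomial if `β` is a gapless core tuple. -/
noncomputable def rowBoundSum (β : Fin n → Fin n) : MvPolynomial (Fin n) ℤ :=
  generatingPolynomial n lam (rowBoundSet n lam β)

/-- The Demazure polynomial `d_λ(π; x)`. -/
noncomputable def demazurePolynomial (π : Equiv.Perm (Fin n)) : MvPolynomial (Fin n) ℤ :=
  generatingPolynomial n lam (demazureSet n lam π)

/-- `L` is the list of vertices of a lattice path from `P` to `Q` with unit steps east and north. -/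
def IsLatticePath (P Q : ℕ × ℕ) (L : List (ℕ × ℕ)) : Prop :=
  L.IsChain (fun p q => q = (p.1 + 1, p.2) ∨ q = (p.1, p.2 + 1)) ∧
  L.head? = some P ∧ L.getLast? = some Q

/-- The source `(n - i, 1)` of the `i`-th path (its height is shifted like the values in `[n]`). -/
def pathSource (i : Fin n) : ℕ × ℕ := (n - 1 - (i : ℕ), 0)

/-- The terminal `(λ_i + n - i, β_i)` of the `i`-th path. -/
def pathTerminal (β : Fin n → Fin n) (i : Fin n) : ℕ × ℕ :=
  (lam.rowLen i + (n - 1 - (i : ℕ)), (β i : ℕ))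

/-- `(λ, β)` is nonpermutable: an `n`-tuple of pairwise disjoint lattice paths that lead from the
sources in some order to the terminals exists only for the identity order. -/
def IsNonpermutable (β : Fin n → Fin n) : Prop :=
  ∀ (w : Equiv.Perm (Fin n)) (L : Fin n → List (ℕ × ℕ)),
    (∀ i, IsLatticePath (pathSource n (w i)) (pathTerminal n lam β i) (L i)) →
    (∀ i j, i ≠ j → List.Disjoint (L i) (L j)) → w = 1

/-- The matrix of the Gessel-Viennot determinant for `(λ, β)`: the entry at `(i, j)` is the complete
homogeneous symmetric polynomial of degree `λ_i - i + j` in `x_1, ..., x_{β_i}`, the generating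
function of the lattice paths from the `j`-th source to the `i`-th terminal when a horizontal step at
height `k` has weight `x_k`.  It is zero for negative degree. -/
noncomputable def gesselViennotMatrix (β : Fin n → Fin n) :
    Matrix (Fin n) (Fin n) (MvPolynomial (Fin n) ℤ) :=
  Matrix.of fun i j =>
    if (i : ℕ) ≤ lam.rowLen i + (j : ℕ) then
      MvPolynomial.rename (Fin.castLE (Nat.succ_le_of_lt (β i).isLt))
        (MvPolynomial.hsymm (Fin ((β i : ℕ) + 1)) ℤ (lam.rowLen i + (j : ℕ) - (i : ℕ)))
    else 0

/-- The total number of monomials among the entries of the Gessel-Viennot determinant. -/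
noncomputable def monomialCount (β : Fin n → Fin n) : ℕ :=
  ∑ i, ∑ j, (gesselViennotMatrix n lam β i j).support.card

/-- The upper tuples `β` to which the Gessel-Viennot method applies and for which it produces the
polynomial `p`: the pair `(λ, β)` is nonpermutable, which is the hypothesis under which the
generating function of the tuples of disjoint paths equals the determinant, and this generating
function, the row bound sum, is `p`. -/
def validInputs (p : MvPolynomial (Fin n) ℤ) : Set (Fin n → Fin n) :=
  {β | β ∈ upperTuples n ∧ IsNonpermutable n lam β ∧ rowBoundSum n lam β = p}

/-- The valid inputs for flag Schur polynomials on the shape that attain maximum efficiency: the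
determinant has fewer monomials among its entries than the one for any other valid input that
produces the same polynomial. -/
def maximallyEfficientInputs : Set (Fin n → Fin n) :=
  {β | ∃ φ ∈ upperFlags n, β ∈ validInputs n lam (rowBoundSum n lam φ) ∧
    ∀ β' ∈ validInputs n lam (rowBoundSum n lam φ), β' ≠ β →
      monomialCount n lam β < monomialCount n lam β'}

end Tableaux

end ParabolicCatalan

open ParabolicCatalan

/-! Below an upper tuple `β` there is, for every length `q ≤ n`, an entrywise largest strictly
increasing column; its entry in row `i` is `i + min (β_k - k)` over `i ≤ k < q` (`colMax`).
Everything rests on these columns for the divider lengths `q_h`; `SameColumns` says that two tuples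
share them. The part of the column of length `q_{h+1}` lying in the carrel `(q_h, q_{h+1}]` gives
the entries of the core, the largest `R`-increasing tuple below `β`, and the core determines all the
columns (`sameColumns_of_core`). Critical indices are the strict right-to-left minima of `β_i - i`
in a carrel, and critical pairs record the suffix minima. Hence `∼_R`, equality of critical lists
and equality of cores all amount to `SameColumns` (`increasingBelow_eq_iff`, `criticalList_eq_iff`).

For a gapless core tuple the flag condition makes the column sets nested, without gaps between an
added value and the old maximum (`colMax_chain`). A chain of sets of the sizes `q_h` is an
`R`-permutation, and absence of gaps is `R`-312-avoidance. So gapless core tuples modulo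
`SameColumns` correspond to avoiding permutations (`exists_matches_of_gaplessCore`,
`exists_gaplessCore_of_avoiding`). `ncard_image_eq_parabolicCatalan` turns this into a count for any
family of representatives and any invariant equivalent to `SameColumns` on it. Canopy tuples, floor
flags, ceiling flags and `R`-increasing gapless core tuples are four such families, each with one
member per class.

A tableau obeys the row bounds `β` iff each of its columns lies below the largest column, so for
matching `β` and `π` the set `𝒮_λ(β)` consists of the tableaux entrywise below the key of `π`. A
right key dominates its tableau, hence `𝒟_λ(π)` is contained in that set, with equality exactly for
avoiding `π` (`demazureSet_eq_belowKey`, `demazureSet_ne_belowKey`). Right keys are analysed by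
exchanging the loops of the scanning method: all scans advance together, column by column, and one
column acts by `bump`. A key is the only tableau with its content (`eq_keyTableau_of_content`).
Therefore Demazure polynomials determine their `R`-permutations, and a coincidence of polynomials
`s_λ(β; x) = d_λ(π; x)` is already one of tableau sets.

For efficiency, enlarging an upper tuple strictly increases the monomial count, and a core lies
below every upper tuple with the same row bound sum. Cores of upper flags are nonpermutable because
the terminals within a carrel block any crossing, so they are the efficient inputs
(`maximallyEfficientInputs_eq`). -/

namespace ParabolicCatalan

/-! ### Divider positions and carrels -/

section Dividers

variable {n : ℕ} {R : Finset ℕ}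

theorem divider_zero : divider n R 0 = 0 := by simp [divider]

theorem divider_of_card_lt {h : ℕ} (hh : R.card < h) : divider n R h = n := by
  unfold divider
  rw [if_neg (by omega), if_neg (by omega)]

theorem divider_succ_of_lt {h : ℕ} (hh : h < R.card) :
    divider n R (h + 1) = Nat.nth (fun q => q ∈ R) h := by
  unfold divider
  rw [if_neg (by omega), if_pos (by omega)]
  rfl

theorem setOf_mem_finset_finite (R : Finset ℕ) : (Set.ofPred fun q => q ∈ R).Finite :=
  R.finite_toSet

theorem card_setOf_mem_finset (R : Finset ℕ) : (setOf_mem_finset_finite R).toFinset.card = R.card := by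
  congr 1
  ext x
  simp

theorem divider_mem {h : ℕ} (h1 : 1 ≤ h) (h2 : h ≤ R.card) : divider n R h ∈ R := by
  obtain ⟨k, rfl⟩ : ∃ k, h = k + 1 := ⟨h - 1, by omega⟩
  rw [divider_succ_of_lt (by omega)]
  exact Nat.nth_mem_of_lt_card (p := fun q => q ∈ R) (setOf_mem_finset_finite R)
    (by rw [card_setOf_mem_finset]; omega)

theorem exists_divider_eq {q : ℕ} (hq : q ∈ R) :
    ∃ h, 1 ≤ h ∧ h ≤ R.card ∧ divider n R h = q := by
  obtain ⟨k, hk, rfl⟩ :=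
    Nat.exists_lt_card_finite_nth_eq (p := fun q => q ∈ R) (setOf_mem_finset_finite R) hq
  rw [card_setOf_mem_finset] at hk
  exact ⟨k + 1, by omega, by omega, divider_succ_of_lt hk⟩

theorem divider_lt_succ (hn : 1 ≤ n) (hR : R ⊆ Finset.Icc 1 (n - 1)) {h : ℕ} (hh : h ≤ R.card) :
    divider n R h < divider n R (h + 1) := by
  rcases Nat.eq_zero_or_pos h with rfl | h0
  · rw [divider_zero]
    rcases Nat.eq_zero_or_pos R.card with h1 | h1
    · rw [divider_of_card_lt (by omega)]; omega
    · have := hR (divider_mem (n := n) (R := R) (h := 1) le_rfl h1)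
      rw [Finset.mem_Icc] at this
      simp only [zero_add]; omega
  · rcases hh.lt_or_eq with h1 | h1
    · obtain ⟨k, rfl⟩ : ∃ k, h = k + 1 := ⟨h - 1, by omega⟩
      rw [divider_succ_of_lt (by omega), divider_succ_of_lt h1]
      exact Nat.nth_lt_nth_of_lt_card (p := fun q => q ∈ R) (setOf_mem_finset_finite R) (by omega)
        (by rw [card_setOf_mem_finset]; omega)
    · have := hR (divider_mem (n := n) (R := R) h0 hh)
      rw [Finset.mem_Icc] at this
      rw [divider_of_card_lt (h := h + 1) (by omega)]
      omega

theorem divider_mono (hn : 1 ≤ n) (hR : R ⊆ Finset.Icc 1 (n - 1)) : Monotone (divider n R) := by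
  refine monotone_nat_of_le_succ fun h => ?_
  by_cases hh : h ≤ R.card
  · exact (divider_lt_succ hn hR hh).le
  · rw [divider_of_card_lt (h := h) (by omega), divider_of_card_lt (h := h + 1) (by omega)]

theorem divider_le (hn : 1 ≤ n) (hR : R ⊆ Finset.Icc 1 (n - 1)) (h : ℕ) : divider n R h ≤ n := by
  have := divider_mono hn hR (show h ≤ h + (R.card + 1) by omega)
  rwa [divider_of_card_lt (h := h + (R.card + 1)) (by omega)] at this

theorem exists_carrel {k : ℕ} (hk : k < n) :
    ∃ h ≤ R.card, divider n R h ≤ k ∧ k < divider n R (h + 1) := by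
  by_contra! hcon
  have key : ∀ h, h ≤ R.card + 1 → divider n R h ≤ k := by
    intro h
    induction h with
    | zero => intro _; rw [divider_zero]; omega
    | succ h ih => intro hh; exact hcon h (by omega) (ih (by omega))
  have := key (R.card + 1) le_rfl
  rw [divider_of_card_lt (by omega)] at this
  omega

theorem exists_inCarrel (i : Fin n) : ∃ h ≤ R.card, InCarrel n R h i :=
  exists_carrel i.2

theorem InCarrel.le_card {h : ℕ} {i : Fin n} (hi : InCarrel n R h i) : h ≤ R.card := by
  by_contra hh
  have := hi.1
  rw [divider_of_card_lt (by omega)] at this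
  have := i.2
  omega

theorem carrel_le_of_lt (hn : 1 ≤ n) (hR : R ⊆ Finset.Icc 1 (n - 1)) {h h' k : ℕ}
    (h1 : divider n R h ≤ k) (h2 : k < divider n R h') : h < h' := by
  by_contra hlt
  have := divider_mono hn hR (not_lt.1 hlt)
  omega

theorem InCarrel.unique (hn : 1 ≤ n) (hR : R ⊆ Finset.Icc 1 (n - 1)) {h h' : ℕ} {i : Fin n}
    (hi : InCarrel n R h i) (hi' : InCarrel n R h' i) : h = h' := by
  have h1 := carrel_le_of_lt hn hR hi.1 hi'.2
  have h2 := carrel_le_of_lt hn hR hi'.1 hi.2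
  omega

end Dividers

/-! ### The largest strictly increasing column below a tuple -/

section ColumnMaximum

/-- The extension of a tuple to all natural numbers by the identity. -/
def extend {n : ℕ} (β : Fin n → Fin n) (k : ℕ) : ℕ := if h : k < n then (β ⟨k, h⟩ : ℕ) else k

theorem extend_of_lt {n : ℕ} (β : Fin n → Fin n) {k : ℕ} (hk : k < n) :
    extend β k = β ⟨k, hk⟩ := by simp [extend, hk]

@[simp]
theorem extend_coe {n : ℕ} (β : Fin n → Fin n) (i : Fin n) : extend β i = β i := by
  simp [extend]

theorem le_extend {n : ℕ} {β : Fin n → Fin n} (hβ : β ∈ upperTuples n) (k : ℕ) : k ≤ extend β k := by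
  unfold extend
  split_ifs with h
  · exact hβ ⟨k, h⟩
  · exact le_rfl

theorem extend_lt {n : ℕ} (β : Fin n → Fin n) {k : ℕ} (hk : k < n) : extend β k < n := by
  rw [extend_of_lt β hk]; exact (β _).2

/-- The entry in row `i` of the largest strictly increasing column of length `q` whose entries are
bounded by `b`. -/
noncomputable def colMax (b : ℕ → ℕ) (q i : ℕ) : ℕ :=
  sInf {x | ∃ k, i ≤ k ∧ k < q ∧ x + k = b k + i}

variable {b : ℕ → ℕ}

theorem exists_colMax (b : ℕ → ℕ) {q i : ℕ} (hi : i < q) :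
    ∃ k, i ≤ k ∧ k < q ∧ colMax b q i + k = b k + i :=
  Nat.sInf_mem (s := {x | ∃ k, i ≤ k ∧ k < q ∧ x + k = b k + i}) ⟨b i, i, le_rfl, hi, rfl⟩

/-- Minimality, in additive form. The bound `k ≤ b k` is what makes `b k + i - k` a genuine
difference, hence a member of the set whose infimum is taken. -/
theorem colMax_add_le (hb : ∀ k, k ≤ b k) {q i k : ℕ} (hi : i ≤ k) (hk : k < q) :
    colMax b q i + k ≤ b k + i := by
  have h : colMax b q i ≤ b k + i - k :=
    Nat.sInf_le ⟨k, hi, hk, by have := hb k; omega⟩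
  have := hb k
  omega

theorem colMax_le (hb : ∀ k, k ≤ b k) {q i : ℕ} (hi : i < q) : colMax b q i ≤ b i := by
  have := colMax_add_le hb le_rfl hi
  omega

/-- The minimum for row `j` ranges over a subset of the indices used for row `i`. -/
theorem colMax_add_sub_le (hb : ∀ k, k ≤ b k) {q i j : ℕ} (hij : i ≤ j) (hj : j < q) :
    colMax b q i + j ≤ colMax b q j + i := by
  obtain ⟨k, h1, h2, h3⟩ := exists_colMax b hj
  have := colMax_add_le hb (hij.trans h1) h2
  omega

theorem colMax_strictMono (hb : ∀ k, k ≤ b k) {q i j : ℕ} (hij : i < j) (hj : j < q) :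
    colMax b q i < colMax b q j := by
  have := colMax_add_sub_le hb hij.le hj
  omega

theorem self_le_colMax (hb : ∀ k, k ≤ b k) {q i : ℕ} (hi : i < q) : i ≤ colMax b q i := by
  obtain ⟨k, h1, h2, h3⟩ := exists_colMax b hi
  have := hb k
  omega

theorem colMax_anti (hb : ∀ k, k ≤ b k) {q q' i : ℕ} (hi : i < q) (hq : q ≤ q') :
    colMax b q' i ≤ colMax b q i := by
  obtain ⟨k, h1, h2, h3⟩ := exists_colMax b hi
  have := colMax_add_le hb h1 (h2.trans_le hq)
  omega

theorem colMax_last {q i : ℕ} (hi : i + 1 = q) : colMax b q i = b i := by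
  obtain ⟨k, h1, h2, h3⟩ := exists_colMax b (show i < q by omega)
  obtain rfl : k = i := by omega
  omega

theorem strict_add_sub_le {c : ℕ → ℕ} {q : ℕ} (hc : ∀ i, i + 1 < q → c i < c (i + 1)) {i j : ℕ}
    (hij : i ≤ j) (hj : j < q) : c i + j ≤ c j + i := by
  induction j, hij using Nat.le_induction with
  | base => exact le_rfl
  | succ j hij ih =>
    have := ih (by omega)
    have := hc j hj
    omega

theorem le_colMax {c : ℕ → ℕ} {q : ℕ}
    (hc : ∀ i, i + 1 < q → c i < c (i + 1)) (hcb : ∀ i, i < q → c i ≤ b i) {i : ℕ} (hi : i < q) :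
    c i ≤ colMax b q i := by
  obtain ⟨k, h1, h2, h3⟩ := exists_colMax b hi
  have := strict_add_sub_le hc h1 h2
  have := hcb k h2
  omega

/-- The last bound is less than `n`, so a strictly increasing column of full length has no freedom.
Columns of length `n` carry no information. -/
theorem colMax_top {n : ℕ} {β : Fin n → Fin n} (hβ : β ∈ upperTuples n) {i : ℕ} (hi : i < n) :
    colMax (extend β) n i = i := by
  have h1 := self_le_colMax (le_extend hβ) hi
  have h2 := colMax_add_le (le_extend hβ) (show i ≤ n - 1 by omega) (show n - 1 < n by omega)
  have h3 := extend_lt β (show n - 1 < n by omega)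
  omega

theorem colMax_lt {n : ℕ} {β : Fin n → Fin n} (hβ : β ∈ upperTuples n) {q i : ℕ} (hq : q ≤ n)
    (hi : i < q) : colMax (extend β) q i < n :=
  (colMax_le (le_extend hβ) hi).trans_lt (extend_lt β (by omega))

/-- Strictness gives steps of at least one from `j` on, while the bound at `y` allows steps of at
most one on average. The column therefore climbs by exactly one up to row `y`. -/
theorem colMax_eq_of_attained (hb : ∀ k, k ≤ b k) {q j y : ℕ} (hy : y < q)
    (h : colMax b q j + y = b y + j) {k : ℕ} (hjk : j ≤ k) (hky : k ≤ y) :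
    colMax b q k + j = colMax b q j + k := by
  have h1 := colMax_add_le hb hky hy
  have h2 := colMax_add_sub_le hb hjk (hky.trans_lt hy)
  omega

/-- Below the index where the minimum is attained, the entries form an interval. -/
theorem exists_colMax_eq_of_attained (hb : ∀ k, k ≤ b k) {q j y w : ℕ} (hy : y < q)
    (h : colMax b q j + y = b y + j) (hw : colMax b q j ≤ w) (hw' : w ≤ b y) :
    ∃ k, j ≤ k ∧ k ≤ y ∧ colMax b q k = w := by
  refine ⟨j + (w - colMax b q j), by omega, by omega, ?_⟩
  have := colMax_eq_of_attained hb hy h (k := j + (w - colMax b q j)) (by omega) (by omega)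
  omega

/-- Taking the last minimiser of `b z - z` provides the strict inequality to its right that
characterises critical indices. -/
theorem exists_last_argmin (b : ℕ → ℕ) {a e : ℕ} (hae : a < e) :
    ∃ y, a ≤ y ∧ y < e ∧ (∀ z, a ≤ z → z < e → b y + z ≤ b z + y) ∧
      ∀ z, y < z → z < e → b y + z < b z + y := by
  obtain ⟨d, rfl⟩ : ∃ d, e = a + d + 1 := ⟨e - a - 1, by omega⟩
  clear hae
  induction d generalizing a with
  | zero =>
    refine ⟨a, le_rfl, by omega, fun z h1 h2 => ?_, fun z h1 h2 => by omega⟩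
    obtain rfl : z = a := by omega
    exact le_rfl
  | succ d ih =>
    obtain ⟨y, h1, h2, h3, h4⟩ := ih (a := a + 1)
    by_cases hlt : b a + y < b y + a
    · refine ⟨a, le_rfl, by omega, fun z hz hz' => ?_, fun z hz hz' => ?_⟩
      · rcases hz.eq_or_lt with rfl | hz
        · exact le_rfl
        · have := h3 z hz (by omega); omega
      · have := h3 z hz (by omega); omega
    · refine ⟨y, by omega, by omega, fun z hz hz' => ?_, fun z hz hz' => h4 z hz (by omega)⟩
      rcases hz.eq_or_lt with rfl | hz
      · omega
      · exact h3 z hz (by omega)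

end ColumnMaximum

/-! ### Critical indices and gapless core tuples -/

section Critical

variable {n : ℕ} {R : Finset ℕ}

/-- The critical indices are the strict right-to-left minima of `υ_i - i` in the carrels. -/
theorem isCriticalIndex_iff {υ : Fin n → Fin n} {h : ℕ}
    (hd : divider n R (h + 1) ≤ n) (x : Fin n) :
    IsCriticalIndex n R υ h x ↔ InCarrel n R h x ∧
      ∀ z, InCarrel n R h z → x < z → (υ x : ℕ) + z < (υ z : ℕ) + x := by
  constructor
  · intro hx
    induction hx with
    | rightmost x hx hx' =>
      refine ⟨hx, fun z hz hxz => ?_⟩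
      have := hz.2
      rw [Fin.lt_def] at hxz
      omega
    | next x y _ hy hyx hlt hbetween ih =>
      refine ⟨hy, fun z hz hyz => ?_⟩
      rcases lt_trichotomy z x with h1 | rfl | h1
      · have := hbetween z hyz h1
        omega
      · omega
      · have := ih.2 z hz h1
        omega
  · rintro ⟨hx, hmin⟩
    obtain ⟨d, hd'⟩ : ∃ d, divider n R (h + 1) - (x : ℕ) ≤ d := ⟨_, le_rfl⟩
    induction d generalizing x with
    | zero => have := hx.2; omega
    | succ d ih =>
      by_cases hlast : (x : ℕ) + 1 = divider n R (h + 1)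
      · exact .rightmost x hx hlast
      · have hx2 := hx.2
        obtain ⟨y, h1, h2, h3, h4⟩ := exists_last_argmin (extend υ)
          (show (x : ℕ) + 1 < divider n R (h + 1) by omega)
        have hyn : y < n := by omega
        have hyc : InCarrel n R h ⟨y, hyn⟩ := ⟨by have := hx.1; simp only; omega, h2⟩
        refine .next ⟨y, hyn⟩ x (ih ⟨y, hyn⟩ hyc (fun z hz hyz => ?_) ?_) hx ?_ ?_ ?_
        · have := h4 z hyz hz.2
          rw [extend_coe, extend_of_lt υ hyn] at this
          exact this
        · simp only; omega
        · rw [Fin.lt_def]; simp only; omega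
        · exact hmin ⟨y, hyn⟩ hyc (by rw [Fin.lt_def]; simp only; omega)
        · intro z hz1 hz2
          have := h3 z hz1 (by rw [Fin.lt_def] at hz2; simp only at hz2; omega)
          rw [extend_coe, extend_of_lt υ hyn] at this
          simp only
          omega

/-- The last minimiser of `υ_z - z` from `i` to the end of the carrel is a strict right-to-left
minimum. Suffix minima, and with them the core, can thus be read off from critical pairs. -/
theorem exists_critical_ge (hn : 1 ≤ n) (hR : R ⊆ Finset.Icc 1 (n - 1)) {υ : Fin n → Fin n}
    {h : ℕ} {i : Fin n} (hi : InCarrel n R h i) :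
    ∃ x, i ≤ x ∧ IsCriticalIndex n R υ h x ∧
      ∀ z, i ≤ z → InCarrel n R h z → (υ x : ℕ) + z ≤ (υ z : ℕ) + x := by
  have hd := divider_le hn hR (h + 1)
  obtain ⟨y, h1, h2, h3, h4⟩ := exists_last_argmin (extend υ) hi.2
  have hyn : y < n := by omega
  refine ⟨⟨y, hyn⟩, h1, (isCriticalIndex_iff hd _).2 ⟨⟨hi.1.trans h1, h2⟩, fun z hz hyz => ?_⟩,
    fun z hz hzc => ?_⟩
  · have := h4 z hyz hz.2
    rwa [extend_coe, extend_of_lt υ hyn] at this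
  · have := h3 z hz hzc.2
    rwa [extend_coe, extend_of_lt υ hyn] at this

theorem IsCriticalIndex.inCarrel {υ : Fin n → Fin n} {h : ℕ} {x : Fin n}
    (hx : IsCriticalIndex n R υ h x) : InCarrel n R h x := by
  cases hx with
  | rightmost _ h _ => exact h
  | next _ _ _ h _ _ _ => exact h

theorem mem_criticalList {υ : Fin n → Fin n} {h : Fin (R.card + 1)} {p : Fin n × Fin n} :
    p ∈ criticalList n R υ h ↔ IsCriticalIndex n R υ h p.1 ∧ p.2 = υ p.1 := by
  simp [criticalList]

theorem isCriticalList_criticalList (hn : 1 ≤ n) (hR : R ⊆ Finset.Icc 1 (n - 1))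
    {υ : Fin n → Fin n} (hυ : υ ∈ upperTuples n) : IsCriticalList n R (criticalList n R υ) := by
  intro h
  have hd := divider_le hn hR (h + 1 : ℕ)
  refine ⟨fun p hp => ?_, ?_, fun p hp p' hp' he => ?_, fun p hp p' hp' hlt => ?_⟩
  · rw [mem_criticalList] at hp
    exact ⟨hp.1.inCarrel, hp.2 ▸ hυ p.1⟩
  · have := divider_lt_succ hn hR (show (h : ℕ) ≤ R.card by omega)
    refine ⟨(⟨divider n R (h + 1) - 1, by omega⟩, υ ⟨divider n R (h + 1) - 1, by omega⟩),
      ?_, by simp only; omega⟩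
    rw [mem_criticalList]
    refine ⟨.rightmost _ ⟨by simp only; omega, by simp only; omega⟩ (by simp only; omega), rfl⟩
  · rw [mem_criticalList] at hp hp'
    exact Prod.ext he (by rw [hp.2, hp'.2, he])
  · rw [mem_criticalList] at hp hp'
    rw [hp.2, hp'.2]
    exact ((isCriticalIndex_iff hd _).1 hp.1).2 _ hp'.1.inCarrel hlt

/-- Critical entries increase inside a carrel, so a comparison with the leftmost one is a comparison
with all of them. This form dispenses with finding the leftmost one. -/
theorem mem_gaplessCoreTuples_iff (hn : 1 ≤ n) (hR : R ⊆ Finset.Icc 1 (n - 1))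
    {η : Fin n → Fin n} : η ∈ gaplessCoreTuples n R ↔ η ∈ upperTuples n ∧
      ∀ h, h + 1 ≤ R.card → ∀ x y : Fin n, (x : ℕ) + 1 = divider n R (h + 1) →
        IsCriticalIndex n R η (h + 1) y → η x ≤ η y := by
  refine and_congr_right fun hη => ⟨fun H h hh x y hx hy => ?_, fun H =>
    ⟨isCriticalList_criticalList hn hR hη, fun h h' hh' p hp hpr p' hp' hleft => ?_⟩⟩
  · have hd := divider_le hn hR (h + 1 + 1)
    classical
    obtain ⟨w, hw, hwmin⟩ := Finset.exists_min_image
      (Finset.univ.filter fun w => IsCriticalIndex n R η (h + 1) w) id ⟨y, by simpa using hy⟩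
    simp only [Finset.mem_filter, Finset.mem_univ, true_and, id] at hw hwmin
    have hlt := divider_lt_succ hn hR (show h ≤ R.card by omega)
    have h1 : η x ≤ η w := by
      refine H.2 ⟨h, by omega⟩ ⟨h + 1, by omega⟩ rfl (x, η x) ?_ hx (w, η w) ?_ ?_
      · exact mem_criticalList.2 ⟨.rightmost _ ⟨by simp only; omega, by simp only; omega⟩ hx, rfl⟩
      · exact mem_criticalList.2 ⟨hw, rfl⟩
      · intro p'' hp''
        exact hwmin _ (mem_criticalList.1 hp'').1
    rcases (hwmin y hy).eq_or_lt with rfl | hwy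
    · exact h1
    · have := ((isCriticalIndex_iff hd _).1 hw).2 y hy.inCarrel hwy
      rw [Fin.lt_def] at hwy
      rw [Fin.le_def] at h1 ⊢
      omega
  · rw [mem_criticalList] at hp hp'
    rw [hp.2, hp'.2]
    exact H h (by have := h'.2; omega) p.1 p'.1 hpr (hh' ▸ hp'.1)

theorem upperFlags_subset_gaplessCoreTuples (hn : 1 ≤ n) (hR : R ⊆ Finset.Icc 1 (n - 1)) :
    upperFlags n ⊆ gaplessCoreTuples n R := by
  intro φ hφ
  rw [mem_gaplessCoreTuples_iff hn hR]
  refine ⟨hφ.1, fun h hh x y hx hy => hφ.2 ?_⟩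
  have := hy.inCarrel.1
  rw [Fin.le_def]
  omega

end Critical

/-! ### The core, and the data equivalent to it -/

section Core

variable {n : ℕ} {R : Finset ℕ}

/-- The largest columns below two tuples agree for all lengths that are divider positions. -/
def SameColumns (n : ℕ) (R : Finset ℕ) (a b : Fin n → Fin n) : Prop :=
  ∀ h i, i < divider n R h →
    colMax (extend a) (divider n R h) i = colMax (extend b) (divider n R h) i

/-- The `R`-core of a tuple: the largest `R`-increasing tuple below it. -/
def IsCore (n : ℕ) (R : Finset ℕ) (β γ : Fin n → Fin n) : Prop :=
  ∀ h (i : Fin n), InCarrel n R h i → (γ i : ℕ) = colMax (extend β) (divider n R (h + 1)) i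

theorem exists_isCore (hn : 1 ≤ n) (hR : R ⊆ Finset.Icc 1 (n - 1)) {β : Fin n → Fin n}
    (hβ : β ∈ upperTuples n) : ∃ γ, IsCore n R β γ := by
  choose c hc hc' using exists_inCarrel (n := n) (R := R)
  refine ⟨fun i => ⟨colMax (extend β) (divider n R (c i + 1)) i,
    colMax_lt hβ (divider_le hn hR _) (hc' i).2⟩, fun h i hi => ?_⟩
  rw [hi.unique hn hR (hc' i)]

theorem IsCore.le {β γ : Fin n → Fin n} (hβ : β ∈ upperTuples n) (hγ : IsCore n R β γ) : γ ≤ β := by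
  intro i
  obtain ⟨h, -, hi⟩ := exists_inCarrel (R := R) i
  have := colMax_le (le_extend hβ) hi.2
  rw [← hγ h i hi, extend_coe] at this
  exact this

theorem IsCore.mem_upperTuples {β γ : Fin n → Fin n} (hβ : β ∈ upperTuples n)
    (hγ : IsCore n R β γ) : γ ∈ upperTuples n := by
  intro i
  obtain ⟨h, -, hi⟩ := exists_inCarrel (R := R) i
  rw [Fin.le_def, hγ h i hi]
  exact self_le_colMax (le_extend hβ) hi.2

theorem IsCore.isRIncreasing {β γ : Fin n → Fin n} (hβ : β ∈ upperTuples n)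
    (hγ : IsCore n R β γ) : IsRIncreasing n R γ := by
  intro h i j hi hj hij
  rw [Fin.lt_def, hγ h i hi, hγ h j hj]
  exact colMax_strictMono (le_extend hβ) hij hj.2

theorem le_extend_step {ε : Fin n → Fin n} (hε : IsRIncreasing n R ε) (hn : 1 ≤ n)
    (hR : R ⊆ Finset.Icc 1 (n - 1)) {h i j : ℕ} (hi : divider n R h ≤ i) (hij : i ≤ j)
    (hj : j < divider n R (h + 1)) : extend ε i + j ≤ extend ε j + i := by
  have hd := divider_le hn hR (h + 1)
  induction j, hij using Nat.le_induction with
  | base => exact le_rfl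
  | succ j hij ih =>
    have h1 := ih (by omega)
    have h2 := hε h ⟨j, by omega⟩ ⟨j + 1, by omega⟩ ⟨by simp only; omega, by simp only; omega⟩
      ⟨by simp only; omega, by simp only; omega⟩ (by simp [Fin.lt_def])
    rw [Fin.lt_def, ← extend_of_lt ε (show j < n by omega),
      ← extend_of_lt ε (show j + 1 < n by omega)] at h2
    omega

theorem IsCore.le_of_isRIncreasing (hn : 1 ≤ n) (hR : R ⊆ Finset.Icc 1 (n - 1))
    {β γ ε : Fin n → Fin n} (hγ : IsCore n R β γ)
    (hε : IsRIncreasing n R ε) (hle : ε ≤ β) : ε ≤ γ := by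
  intro i
  obtain ⟨h, -, hi⟩ := exists_inCarrel (R := R) i
  rw [Fin.le_def, hγ h i hi]
  obtain ⟨k, h1, h2, h3⟩ := exists_colMax (extend β) hi.2
  have h4 := le_extend_step hε hn hR hi.1 h1 h2
  have hk : k < n := by have := divider_le hn hR (h + 1); omega
  have h5 := hle ⟨k, hk⟩
  rw [Fin.le_def, ← extend_of_lt β hk, ← extend_of_lt ε hk] at h5
  rw [extend_coe] at h4
  omega

theorem IsCore.eq_of_isRIncreasing (hn : 1 ≤ n) (hR : R ⊆ Finset.Icc 1 (n - 1))
    {β γ : Fin n → Fin n} (hβ : β ∈ upperTuples n) (hγ : IsCore n R β γ)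
    (hβ' : IsRIncreasing n R β) : γ = β :=
  le_antisymm (hγ.le hβ) (hγ.le_of_isRIncreasing hn hR hβ' le_rfl)

theorem IsCore.unique {β γ γ' : Fin n → Fin n} (hγ : IsCore n R β γ) (hγ' : IsCore n R β γ') :
    γ = γ' := by
  funext i
  obtain ⟨h, -, hi⟩ := exists_inCarrel (R := R) i
  exact Fin.ext ((hγ h i hi).trans (hγ' h i hi).symm)

theorem SameColumns.symm {a b : Fin n → Fin n} (H : SameColumns n R a b) : SameColumns n R b a :=
  fun h i hi => (H h i hi).symm

theorem SameColumns.isCore {a b γ : Fin n → Fin n} (H : SameColumns n R a b)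
    (hγ : IsCore n R a γ) : IsCore n R b γ :=
  fun h i hi => (hγ h i hi).trans (H (h + 1) i hi.2)

/-- The minimum for `b` is attained at some `k` in a carrel that ends at or before `q_h`. There the
suffix minima of `a` and `b` from `k` agree, and the index attaining the one for `a` is admissible
for the column of `a` as well. -/
theorem colMax_le_of_core (hn : 1 ≤ n) (hR : R ⊆ Finset.Icc 1 (n - 1)) {a b : Fin n → Fin n}
    (ha : a ∈ upperTuples n) (hb : b ∈ upperTuples n)
    (H : ∀ h (i : Fin n), InCarrel n R h i →
      colMax (extend a) (divider n R (h + 1)) i = colMax (extend b) (divider n R (h + 1)) i)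
    {h i : ℕ} (hi : i < divider n R h) :
    colMax (extend a) (divider n R h) i ≤ colMax (extend b) (divider n R h) i := by
  obtain ⟨k, h1, h2, h3⟩ := exists_colMax (extend b) hi
  have hk : k < n := h2.trans_le (divider_le hn hR h)
  obtain ⟨h', -, hc⟩ := exists_inCarrel (R := R) ⟨k, hk⟩
  have hh' := carrel_le_of_lt hn hR hc.1 h2
  have hle := divider_mono hn hR (show h' + 1 ≤ h by omega)
  obtain ⟨k2, h4, h5, h6⟩ := exists_colMax (extend b) hc.2
  have h7 := colMax_add_le (le_extend hb) (h1.trans h4) (h5.trans_le hle)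
  have h8 := H h' ⟨k, hk⟩ hc
  obtain ⟨k3, h9, h10, h11⟩ := exists_colMax (extend a) hc.2
  have h12 := colMax_add_le (le_extend ha) (h1.trans h9) (h10.trans_le hle)
  simp only at *
  have h13 := colMax_le (le_extend hb) hc.2
  simp only at h13
  omega

theorem sameColumns_of_core (hn : 1 ≤ n) (hR : R ⊆ Finset.Icc 1 (n - 1)) {a b γ : Fin n → Fin n}
    (ha : a ∈ upperTuples n) (hb : b ∈ upperTuples n) (h1 : IsCore n R a γ)
    (h2 : IsCore n R b γ) : SameColumns n R a b := fun _ _ hi =>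
  le_antisymm
    (colMax_le_of_core hn hR ha hb (fun h i hi => (h1 h i hi).symm.trans (h2 h i hi)) hi)
    (colMax_le_of_core hn hR hb ha (fun h i hi => (h2 h i hi).symm.trans (h1 h i hi)) hi)

theorem IsCore.sameColumns (hn : 1 ≤ n) (hR : R ⊆ Finset.Icc 1 (n - 1)) {a γ : Fin n → Fin n}
    (ha : a ∈ upperTuples n) (hγ : IsCore n R a γ) : SameColumns n R a γ := by
  have hγu := hγ.mem_upperTuples ha
  obtain ⟨δ, hδ⟩ := exists_isCore hn hR hγu
  have := hδ.eq_of_isRIncreasing hn hR hγu (hγ.isRIncreasing ha)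
  exact sameColumns_of_core hn hR ha hγu hγ (this ▸ hδ)

/-- The core is the maximum of the set of `R`-increasing upper tuples below a tuple, so it
determines this set and is determined by it. -/
theorem increasingBelow_eq_iff (hn : 1 ≤ n) (hR : R ⊆ Finset.Icc 1 (n - 1)) {a b : Fin n → Fin n}
    (ha : a ∈ upperTuples n) (hb : b ∈ upperTuples n) :
    increasingBelow n R a = increasingBelow n R b ↔ SameColumns n R a b := by
  obtain ⟨γ, hγ⟩ := exists_isCore hn hR ha
  obtain ⟨δ, hδ⟩ := exists_isCore hn hR hb
  constructor
  · intro H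
    have h1 : γ ∈ increasingBelow n R b :=
      H ▸ ⟨⟨hγ.mem_upperTuples ha, hγ.isRIncreasing ha⟩, hγ.le ha⟩
    have h2 : δ ∈ increasingBelow n R a :=
      H ▸ ⟨⟨hδ.mem_upperTuples hb, hδ.isRIncreasing hb⟩, hδ.le hb⟩
    obtain rfl : γ = δ := le_antisymm (hδ.le_of_isRIncreasing hn hR h1.1.2 h1.2)
      (hγ.le_of_isRIncreasing hn hR h2.1.2 h2.2)
    exact sameColumns_of_core hn hR ha hb hγ hδ
  · intro H
    obtain rfl := hδ.unique (H.isCore hγ)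
    ext ε
    refine and_congr_right fun hε => ⟨fun h => ?_, fun h => ?_⟩
    · exact (hγ.le_of_isRIncreasing hn hR hε.2 h).trans (hδ.le hb)
    · exact (hδ.le_of_isRIncreasing hn hR hε.2 h).trans (hγ.le ha)

/-- In a carrel, `γ_i - i` is the suffix minimum of `β_k - k`. A sequence drops strictly below all
later terms exactly where its sequence of suffix minima does. -/
theorem IsCore.isCriticalIndex_iff (hn : 1 ≤ n) (hR : R ⊆ Finset.Icc 1 (n - 1))
    {β γ : Fin n → Fin n} (hβ : β ∈ upperTuples n) (hγ : IsCore n R β γ) {h : ℕ} {x : Fin n} :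
    IsCriticalIndex n R β h x ↔ InCarrel n R h x ∧
      ∀ z, InCarrel n R h z → x < z → (γ x : ℕ) + z < (γ z : ℕ) + x := by
  have hd := divider_le hn hR (h + 1)
  rw [ParabolicCatalan.isCriticalIndex_iff hd]
  refine and_congr_right fun hx => ⟨fun H z hz hxz => ?_, fun H z hz hxz => ?_⟩
  · obtain ⟨k, h1, h2, h3⟩ := exists_colMax (extend β) hz.2
    have hk : k < n := by omega
    have h4 := H ⟨k, hk⟩ ⟨hz.1.trans h1, h2⟩ (hxz.trans_le h1)
    have h5 := hγ.le hβ x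
    rw [← hγ h z hz, extend_of_lt β hk] at h3
    rw [Fin.le_def] at h5
    rw [Fin.lt_def] at hxz
    simp only at h4
    omega
  · obtain ⟨k, h1, h2, h3⟩ := exists_colMax (extend β) hx.2
    have hk : k < n := by omega
    rw [← hγ h x hx] at h3
    have h5 := hγ.le hβ z
    have h6 := H z hz hxz
    rcases h1.eq_or_lt with h1 | h1
    · rw [← h1, extend_coe] at h3
      rw [Fin.le_def] at h5
      omega
    · have h7 := H ⟨k, hk⟩ ⟨hx.1.trans h1.le, h2⟩ h1
      have h8 := hγ.le hβ ⟨k, hk⟩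
      rw [Fin.le_def, ← extend_of_lt β hk] at h8
      simp only at h7
      omega

/-- At a critical index the suffix minimum is attained at that index itself. -/
theorem IsCore.eq_of_critical (hn : 1 ≤ n) (hR : R ⊆ Finset.Icc 1 (n - 1))
    {β γ : Fin n → Fin n} (hβ : β ∈ upperTuples n) (hγ : IsCore n R β γ) {h : ℕ} {x : Fin n}
    (hx : IsCriticalIndex n R β h x) : γ x = β x := by
  have hd := divider_le hn hR (h + 1)
  obtain ⟨hc, H⟩ := (ParabolicCatalan.isCriticalIndex_iff hd _).1 hx
  obtain ⟨k, h1, h2, h3⟩ := exists_colMax (extend β) hc.2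
  have hk : k < n := by omega
  rw [← hγ h x hc] at h3
  have h5 := hγ.le hβ x
  rw [Fin.le_def] at h5
  apply Fin.ext
  rcases h1.eq_or_lt with h1 | h1
  · rw [← h1, extend_coe] at h3
    omega
  · have := H ⟨k, hk⟩ ⟨hc.1.trans h1.le, h2⟩ h1
    rw [extend_of_lt β hk] at h3
    simp only at this
    omega

/-- Each suffix minimum is attained at a critical index, so the list fixes the core. Conversely,
critical indices and critical entries depend on the core alone. -/
theorem criticalList_eq_iff (hn : 1 ≤ n) (hR : R ⊆ Finset.Icc 1 (n - 1)) {a b : Fin n → Fin n}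
    (ha : a ∈ upperTuples n) (hb : b ∈ upperTuples n) :
    criticalList n R a = criticalList n R b ↔ SameColumns n R a b := by
  obtain ⟨γ, hγ⟩ := exists_isCore hn hR ha
  constructor
  · intro H
    have key : ∀ a b : Fin n → Fin n, a ∈ upperTuples n → b ∈ upperTuples n →
        criticalList n R a = criticalList n R b → ∀ h (i : Fin n), InCarrel n R h i →
        colMax (extend b) (divider n R (h + 1)) i ≤ colMax (extend a) (divider n R (h + 1)) i := by
      intro a b ha hb H h i hi
      obtain ⟨x, h1, h2, h3⟩ := exists_critical_ge hn hR (υ := a) hi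
      have hh := hi.le_card
      have h4 : (x, a x) ∈ criticalList n R a ⟨h, by omega⟩ := mem_criticalList.2 ⟨h2, rfl⟩
      rw [H, mem_criticalList] at h4
      obtain ⟨k, h5, h6, h7⟩ := exists_colMax (extend a) hi.2
      have hk : k < n := by have := divider_le hn hR (h + 1); omega
      have h8 := h3 ⟨k, hk⟩ h5 ⟨hi.1.trans h5, h6⟩
      have h9 := colMax_add_le (le_extend hb) (show (i : ℕ) ≤ x from h1) h2.inCarrel.2
      rw [extend_coe, ← h4.2] at h9
      rw [extend_of_lt a hk] at h7
      simp only at *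
      omega
    refine sameColumns_of_core hn hR ha hb hγ fun h i hi => ?_
    rw [hγ h i hi]
    exact le_antisymm (key b a hb ha H.symm h i hi) (key a b ha hb H h i hi)
  · intro H
    have hγ' := H.isCore hγ
    funext h
    ext p
    rw [mem_criticalList, mem_criticalList, hγ.isCriticalIndex_iff hn hR ha,
      ← hγ'.isCriticalIndex_iff hn hR hb]
    refine and_congr_right fun hp => ?_
    have hp' := (hγ.isCriticalIndex_iff hn hR ha).2 ((hγ'.isCriticalIndex_iff hn hR hb).1 hp)
    rw [← hγ.eq_of_critical hn hR ha hp', ← hγ'.eq_of_critical hn hR hb hp]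

theorem SameColumns.isCriticalIndex_iff (hn : 1 ≤ n) (hR : R ⊆ Finset.Icc 1 (n - 1))
    {a b : Fin n → Fin n} (ha : a ∈ upperTuples n) (hb : b ∈ upperTuples n)
    (H : SameColumns n R a b) {h : ℕ} {x : Fin n} :
    IsCriticalIndex n R a h x ↔ IsCriticalIndex n R b h x := by
  obtain ⟨γ, hγ⟩ := exists_isCore hn hR ha
  rw [hγ.isCriticalIndex_iff hn hR ha, (H.isCore hγ).isCriticalIndex_iff hn hR hb]

theorem SameColumns.eq_of_critical (hn : 1 ≤ n) (hR : R ⊆ Finset.Icc 1 (n - 1))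
    {a b : Fin n → Fin n} (ha : a ∈ upperTuples n) (hb : b ∈ upperTuples n)
    (H : SameColumns n R a b) {h : ℕ} {x : Fin n} (hx : IsCriticalIndex n R a h x) :
    a x = b x := by
  obtain ⟨γ, hγ⟩ := exists_isCore hn hR ha
  rw [← hγ.eq_of_critical hn hR ha hx, ← (H.isCore hγ).eq_of_critical hn hR hb
    ((H.isCriticalIndex_iff hn hR ha hb).1 hx)]

theorem SameColumns.mem_gaplessCoreTuples (hn : 1 ≤ n) (hR : R ⊆ Finset.Icc 1 (n - 1))
    {a b : Fin n → Fin n} (ha : a ∈ gaplessCoreTuples n R) (hb : b ∈ upperTuples n)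
    (H : SameColumns n R a b) : b ∈ gaplessCoreTuples n R := by
  have := (criticalList_eq_iff hn hR ha.1 hb).2 H
  exact ⟨hb, this ▸ ha.2⟩

end Core

/-! ### Strictly increasing sequences compared by counting -/

section Sorting

theorem card_filter_lt_of_strictMono {f : ℕ → ℕ} {q i : ℕ}
    (hf : ∀ i j, i < j → j < q → f i < f j) (hi : i < q) :
    ((Finset.range q).filter fun k => f k ≤ f i).card = i + 1 := by
  have : ((Finset.range q).filter fun k => f k ≤ f i) = Finset.range (i + 1) := by
    ext k
    simp only [Finset.mem_filter, Finset.mem_range]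
    constructor
    · rintro ⟨h1, h2⟩
      by_contra h3
      have := hf i k (by omega) h1
      omega
    · intro h
      refine ⟨by omega, ?_⟩
      rcases (show k ≤ i by omega).eq_or_lt with rfl | h1
      · exact le_rfl
      · exact (hf k i h1 hi).le
  rw [this, Finset.card_range]

/-- Comparison of the entries of two strictly increasing sequences by counting. -/
theorem le_of_card_filter_le {f g : ℕ → ℕ} {q q' i : ℕ} (hf : ∀ i j, i < j → j < q → f i < f j)
    (hg : ∀ i j, i < j → j < q' → g i < g j) (hi' : i < q')
    (H : ((Finset.range q').filter fun k => g k ≤ g i).card ≤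
      ((Finset.range q).filter fun k => f k ≤ g i).card) : f i ≤ g i := by
  rw [card_filter_lt_of_strictMono hg hi'] at H
  by_contra hlt
  have : ((Finset.range q).filter fun k => f k ≤ g i) ⊆ Finset.range i := by
    intro k
    simp only [Finset.mem_filter, Finset.mem_range]
    rintro ⟨h1, h2⟩
    by_contra h3
    rcases (show i ≤ k by omega).eq_or_lt with rfl | h4
    · omega
    · have := hf i k h4 h1
      omega
  have := Finset.card_le_card this
  rw [Finset.card_range] at this
  omega

theorem eq_of_strictMono_of_exists {f g : ℕ → ℕ} {q : ℕ} (hf : ∀ i j, i < j → j < q → f i < f j)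
    (hg : ∀ i j, i < j → j < q → g i < g j) (H : ∀ i, i < q → ∃ j, j < q ∧ g j = f i) {i : ℕ}
    (hi : i < q) : f i = g i := by
  have injf : Set.InjOn f (Finset.range q) := by
    intro x hx y hy hxy
    simp only [Finset.coe_range, Set.mem_Iio] at hx hy
    rcases lt_trichotomy x y with h | h | h
    · have := hf x y h hy; omega
    · exact h
    · have := hf y x h hx; omega
  have injg : Set.InjOn g (Finset.range q) := by
    intro x hx y hy hxy
    simp only [Finset.coe_range, Set.mem_Iio] at hx hy
    rcases lt_trichotomy x y with h | h | h
    · have := hg x y h hy; omega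
    · exact h
    · have := hg y x h hx; omega
  have himg : (Finset.range q).image f = (Finset.range q).image g := by
    apply Finset.eq_of_subset_of_card_le
    · intro x hx
      simp only [Finset.mem_image, Finset.mem_range] at hx ⊢
      obtain ⟨i, hi, rfl⟩ := hx
      exact H i hi
    · rw [Finset.card_image_of_injOn injf, Finset.card_image_of_injOn injg]
  have hcard : ∀ v, ((Finset.range q).filter fun k => f k ≤ v).card =
      ((Finset.range q).filter fun k => g k ≤ v).card := by
    intro v
    have e1 : (((Finset.range q).filter fun k => f k ≤ v).image f) =
        ((Finset.range q).image f).filter (· ≤ v) := by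
      rw [Finset.filter_image]
    have e2 : (((Finset.range q).filter fun k => g k ≤ v).image g) =
        ((Finset.range q).image g).filter (· ≤ v) := by
      rw [Finset.filter_image]
    rw [← Finset.card_image_of_injOn (injf.mono (Finset.filter_subset _ _)), e1, himg, ← e2,
      Finset.card_image_of_injOn (injg.mono (Finset.filter_subset _ _))]
  exact le_antisymm (le_of_card_filter_le hf hg hi (hcard _).ge)
    (le_of_card_filter_le hg hf hi (hcard _).le)

end Sorting

/-! ### Sorted prefixes of a permutation -/

section Keys

variable {n : ℕ}

/-- The `i`-th smallest element of the set of the first `q` values of a permutation. -/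
noncomputable def sortedPrefix (π : Equiv.Perm (Fin n)) (q i : ℕ) : ℕ :=
  Nat.nth (fun v => ∃ a : Fin n, (a : ℕ) < q ∧ (π a : ℕ) = v) i

theorem prefix_finite (π : Equiv.Perm (Fin n)) (q : ℕ) :
    (Set.ofPred fun v => ∃ a : Fin n, (a : ℕ) < q ∧ (π a : ℕ) = v).Finite :=
  (Finset.finite_toSet (Finset.range n)).subset fun v hv => by
    obtain ⟨a, -, rfl⟩ := hv
    simp

theorem card_filter_coe_lt {q : ℕ} (hq : q ≤ n) :
    ((Finset.univ : Finset (Fin n)).filter fun a : Fin n => (a : ℕ) < q).card = q := by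
  rw [← Finset.card_map Fin.valEmbedding]
  have : ((Finset.univ : Finset (Fin n)).filter fun a : Fin n => (a : ℕ) < q).map Fin.valEmbedding =
      Finset.range q := by
    ext v
    simp only [Finset.mem_map, Finset.mem_filter, Finset.mem_univ, true_and, Finset.mem_range,
      Fin.valEmbedding_apply]
    exact ⟨fun ⟨a, h, e⟩ => e ▸ h, fun h => ⟨⟨v, by omega⟩, h, rfl⟩⟩
  rw [this, Finset.card_range]

theorem card_prefix (π : Equiv.Perm (Fin n)) {q : ℕ} (hq : q ≤ n) :
    (prefix_finite π q).toFinset.card = q := by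
  have : (prefix_finite π q).toFinset =
      ((Finset.univ : Finset (Fin n)).filter fun a : Fin n => (a : ℕ) < q).image fun a => (π a : ℕ) := by
    ext v
    simp
  rw [this, Finset.card_image_of_injective _ fun a b hab => π.injective (Fin.ext hab),
    card_filter_coe_lt hq]

variable (π : Equiv.Perm (Fin n)) {q : ℕ}

theorem exists_eq_sortedPrefix (hq : q ≤ n) {i : ℕ} (hi : i < q) :
    ∃ a : Fin n, (a : ℕ) < q ∧ (π a : ℕ) = sortedPrefix π q i :=
  Nat.nth_mem_of_lt_card (prefix_finite π q) (by rwa [card_prefix π hq])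

theorem sortedPrefix_strictMono (hq : q ≤ n) {i j : ℕ} (hij : i < j) (hj : j < q) :
    sortedPrefix π q i < sortedPrefix π q j :=
  Nat.nth_lt_nth_of_lt_card (prefix_finite π q) hij (by rwa [card_prefix π hq])

theorem exists_sortedPrefix_eq (hq : q ≤ n) {a : Fin n} (ha : (a : ℕ) < q) :
    ∃ i, i < q ∧ sortedPrefix π q i = π a := by
  obtain ⟨i, h1, h2⟩ := Nat.exists_lt_card_finite_nth_eq (prefix_finite π q) ⟨a, ha, rfl⟩
  exact ⟨i, by rwa [card_prefix π hq] at h1, h2⟩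

theorem sortedPrefix_lt (hq : q ≤ n) {i : ℕ} (hi : i < q) : sortedPrefix π q i < n := by
  obtain ⟨a, -, h⟩ := exists_eq_sortedPrefix π hq hi
  rw [← h]; exact (π a).2

theorem eq_sortedPrefix (hq : q ≤ n) {f : ℕ → ℕ} (hf : ∀ i j, i < j → j < q → f i < f j)
    (H : ∀ i, i < q → ∃ a : Fin n, (a : ℕ) < q ∧ (π a : ℕ) = f i) {i : ℕ} (hi : i < q) :
    f i = sortedPrefix π q i := by
  refine eq_of_strictMono_of_exists hf (fun i j => sortedPrefix_strictMono π hq) (fun i hi => ?_) hi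
  obtain ⟨a, h1, h2⟩ := H i hi
  rw [← h2]
  exact exists_sortedPrefix_eq π hq h1

/-- Sorting permutes the first `q` values. Inequalities between sorted prefixes can thereby be
proved by inclusions or injections between sets of positions. -/
theorem card_filter_sortedPrefix (hq : q ≤ n) (P : ℕ → Prop) [DecidablePred P] :
    ((Finset.range q).filter fun k => P (sortedPrefix π q k)).card =
      ((Finset.univ : Finset (Fin n)).filter fun a : Fin n => (a : ℕ) < q ∧ P (π a)).card := by
  symm
  choose! f hf hf' using fun (a : Fin n) (ha : (a : ℕ) < q) => exists_sortedPrefix_eq π hq ha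
  refine Finset.card_bij (fun a _ => f a) (fun a ha => ?_) (fun a ha b hb hab => ?_)
    (fun i hi => ?_)
  · simp only [Finset.mem_filter, Finset.mem_univ, true_and, Finset.mem_range] at ha ⊢
    exact ⟨hf a ha.1, (hf' a ha.1).symm ▸ ha.2⟩
  · simp only [Finset.mem_filter, Finset.mem_univ, true_and] at ha hb
    apply π.injective
    apply Fin.ext
    rw [← hf' a ha.1, ← hf' b hb.1, hab]
  · simp only [Finset.mem_filter, Finset.mem_range] at hi
    obtain ⟨a, h1, h2⟩ := exists_eq_sortedPrefix π hq hi.1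
    refine ⟨a, by simpa [h2] using ⟨h1, hi.2⟩, ?_⟩
    have h3 := hf' a h1
    rw [h2] at h3
    rcases lt_trichotomy (f a) i with h | h | h
    · have := sortedPrefix_strictMono π hq h hi.1; omega
    · exact h
    · have := sortedPrefix_strictMono π hq h (hf a h1); omega

/-- Comparison of sorted prefixes by counting. -/
theorem sortedPrefix_le_sortedPrefix {σ : Equiv.Perm (Fin n)} {q' : ℕ} (hq : q ≤ n) (hq' : q' ≤ n)
    (H : ∀ v, ((Finset.univ : Finset (Fin n)).filter fun a : Fin n => (a : ℕ) < q' ∧ (σ a : ℕ) ≤ v).card ≤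
      ((Finset.univ : Finset (Fin n)).filter fun a : Fin n => (a : ℕ) < q ∧ (π a : ℕ) ≤ v).card) {i : ℕ}
    (hi' : i < q') : sortedPrefix π q i ≤ sortedPrefix σ q' i := by
  refine le_of_card_filter_le (fun i j => sortedPrefix_strictMono π hq)
    (fun i j => sortedPrefix_strictMono σ hq') hi' ?_
  rw [card_filter_sortedPrefix σ hq' (· ≤ sortedPrefix σ q' i),
    card_filter_sortedPrefix π hq (· ≤ sortedPrefix σ q' i)]
  exact H _

theorem sortedPrefix_anti {q' : ℕ} (hq : q ≤ n) (hq' : q' ≤ q) {i : ℕ} (hi' : i < q') :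
    sortedPrefix π q i ≤ sortedPrefix π q' i := by
  refine sortedPrefix_le_sortedPrefix π hq (hq'.trans hq) (fun v => Finset.card_le_card ?_)
    hi'
  intro a
  simp only [Finset.mem_filter, Finset.mem_univ, true_and]
  exact fun h => ⟨h.1.trans_le hq', h.2⟩

end Keys

/-! ### Parabolic permutations as chains of sets -/

section Permutations

variable {n : ℕ} {R : Finset ℕ}

theorem mem_iff_lt_of_isLower {n : ℕ} (S : Finset (Fin n)) (hS : ∀ a b, a < b → b ∈ S → a ∈ S)
    (a : Fin n) : a ∈ S ↔ (a : ℕ) < S.card := by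
  constructor
  · intro ha
    have : Finset.Iic a ⊆ S := by
      intro b hb
      rcases (Finset.mem_Iic.1 hb).eq_or_lt with rfl | h
      · exact ha
      · exact hS b a h ha
    have := Finset.card_le_card this
    rw [Fin.card_Iic] at this
    omega
  · intro ha
    by_contra hna
    have : S ⊆ Finset.Iio a := by
      intro b hb
      rw [Finset.mem_Iio]
      rcases lt_trichotomy a b with h | rfl | h
      · exact absurd (hS a b h hb) hna
      · exact absurd hb hna
      · exact h
    have := Finset.card_le_card this
    rw [Fin.card_Iio] at this
    omega

/-- A chain of sets whose sizes are the divider positions is the chain of prefixes of an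
`R`-permutation. -/
theorem exists_rPermutation_of_chain (A : ℕ → Finset (Fin n))
    (hA : Monotone A) (hcard : ∀ h, (A h).card = divider n R h) :
    ∃ π ∈ rPermutations n R, ∀ h a, π a ∈ A h ↔ (a : ℕ) < divider n R h := by
  classical
  -- The level counts the indices `0, ..., r + 1` whose set does not contain `v`; values that enter
  -- the chain later have a higher level.
  let level : Fin n → ℕ := fun v => ((Finset.range (R.card + 2)).filter fun h => v ∉ A h).card
  have hlevel : ∀ h, h ≤ R.card + 1 → ∀ v w, v ∈ A h → w ∉ A h → level v < level w := by
    intro h hh v w hv hw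
    apply Finset.card_lt_card
    rw [Finset.ssubset_iff_of_subset]
    · exact ⟨h, by simp [hw]; omega, by simp [hv]⟩
    · intro h'
      simp only [Finset.mem_filter, Finset.mem_range]
      rintro ⟨h1, h2⟩
      refine ⟨h1, fun h3 => ?_⟩
      rcases le_total h h' with h4 | h4
      · exact h2 (hA h4 hv)
      · exact hw (hA h4 h3)
  -- Since `v < n`, this encodes the lexicographic order by level and then by value. Sorting by it
  -- produces the prefixes and the increase on carrels together.
  let g : Fin n → ℕ := fun v => level v * n + v
  have hg : ∀ v w, level v < level w → g v < g w := by
    intro v w h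
    have h1 : (level v + 1) * n ≤ level w * n := Nat.mul_le_mul_right n h
    have := v.2
    simp only [g]
    rw [add_mul] at h1
    omega
  have hmono := Tuple.monotone_sort g
  have hmem : ∀ h, h ≤ R.card + 1 → ∀ a, Tuple.sort g a ∈ A h ↔ (a : ℕ) < divider n R h := by
    intro h hh a
    have := mem_iff_lt_of_isLower
      ((A h).map (Tuple.sort g).symm.toEmbedding) (fun a b hab hb => ?_) a
    · rw [Finset.card_map, hcard] at this
      rw [← this]
      simp only [Finset.mem_map_equiv, Equiv.symm_symm]
    · simp only [Finset.mem_map_equiv, Equiv.symm_symm] at hb ⊢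
      by_contra ha
      have h1 := hg _ _ (hlevel h hh _ _ hb ha)
      have h2 := hmono hab.le
      simp only [Function.comp] at h2
      omega
  refine ⟨Tuple.sort g, fun h i j hi hj hij => ?_, fun h a => ?_⟩
  · have hlev : level (Tuple.sort g i) = level (Tuple.sort g j) := by
      simp only [level]
      congr 1
      apply Finset.filter_congr
      intro h' hh'
      rw [Finset.mem_range] at hh'
      rw [hmem h' (by omega), hmem h' (by omega)]
      have h1 := hi.1
      have h2 := hi.2
      have h3 := hj.1
      have h4 := hj.2
      have h5 : Monotone (divider n R) := fun x y hxy => by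
        rw [← hcard, ← hcard]; exact Finset.card_le_card (hA hxy)
      rcases le_or_gt h' h with h6 | h6
      · have := h5 h6; omega
      · have := h5 (show h + 1 ≤ h' from h6); omega
    have h2 := hmono hij.le
    replace h2 : level (Tuple.sort g i) * n + (Tuple.sort g i : ℕ) ≤
      level (Tuple.sort g j) * n + (Tuple.sort g j : ℕ) := h2
    rw [hlev] at h2
    refine lt_of_le_of_ne (by rw [Fin.le_def]; omega) fun h => ?_
    exact hij.ne ((Tuple.sort g).injective h)
  · by_cases hh : h ≤ R.card + 1
    · exact hmem h hh a
    · have h1 := hmem (R.card + 1) le_rfl a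
      rw [divider_of_card_lt (by omega)] at h1 ⊢
      have := hA (show R.card + 1 ≤ h by omega) (h1.2 a.2)
      exact ⟨fun _ => a.2, fun _ => this⟩

/-- `R`-permutations are determined by the sets of their first values. -/
theorem rPermutation_ext (hn : 1 ≤ n) (hR : R ⊆ Finset.Icc 1 (n - 1)) {π σ : Equiv.Perm (Fin n)}
    (hπ : π ∈ rPermutations n R) (hσ : σ ∈ rPermutations n R)
    (H : ∀ q ∈ R, ∀ i < q, sortedPrefix π q i = sortedPrefix σ q i) : π = σ := by
  have key : ∀ h (a : Fin n), (a : ℕ) < divider n R h →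
      (σ.symm (π a) : ℕ) < divider n R h := by
    intro h a ha
    rcases Nat.eq_zero_or_pos h with rfl | h0
    · rw [divider_zero] at ha; omega
    by_cases hh : h ≤ R.card
    · have hq := divider_mem (n := n) h0 hh
      have hqn := divider_le hn hR h
      obtain ⟨i, h1, h2⟩ := exists_sortedPrefix_eq π hqn ha
      rw [H _ hq i h1] at h2
      obtain ⟨b, h3, h4⟩ := exists_eq_sortedPrefix σ hqn h1
      have : σ b = π a := Fin.ext (h4.trans h2)
      rw [← this]
      simpa using h3
    · rw [divider_of_card_lt (by omega)]; exact Fin.is_lt _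
  -- An injection of a finite prefix into itself is onto, so the inverse also preserves the prefix.
  have key' : ∀ h (a : Fin n), (a : ℕ) < divider n R h →
      (π.symm (σ a) : ℕ) < divider n R h := by
    intro h a ha
    have hqn := divider_le hn hR h
    have := mem_iff_lt_of_isLower ((Finset.univ.filter fun a : Fin n => (a : ℕ) < divider n R h).map
      (π.trans σ.symm).toEmbedding) (fun a b hab hb => ?_) a
    · rw [Finset.card_map, card_filter_coe_lt hqn] at this
      have h2 := this.2 ha
      rw [Finset.mem_map_equiv] at h2
      simpa using h2
    · have hsub : (Finset.univ.filter fun a : Fin n => (a : ℕ) < divider n R h).map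
          (π.trans σ.symm).toEmbedding = Finset.univ.filter fun a : Fin n => (a : ℕ) < divider n R h := by
        apply Finset.eq_of_subset_of_card_le
        · intro x hx
          simp only [Finset.mem_map, Finset.mem_filter, Finset.mem_univ, true_and] at hx ⊢
          obtain ⟨y, hy, rfl⟩ := hx
          exact key h y hy
        · rw [Finset.card_map]
      rw [hsub] at hb ⊢
      simp only [Finset.mem_filter, Finset.mem_univ, true_and] at hb ⊢
      rw [Fin.lt_def] at hab
      omega
  have hcar : ∀ h (a : Fin n), InCarrel n R h a → InCarrel n R h (σ.symm (π a)) := by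
    intro h a ha
    refine ⟨?_, key _ _ ha.2⟩
    by_contra hlt
    have := key' h (σ.symm (π a)) (by omega)
    have h2 := ha.1
    simp at this
    omega
  -- Between different carrels the order is kept because carrels are preserved; inside a carrel,
  -- because both permutations increase there. An increasing permutation is the identity.
  have hmono : StrictMono (π.trans σ.symm) := by
    intro a b hab
    obtain ⟨h, -, ha⟩ := exists_inCarrel (R := R) a
    obtain ⟨h', -, hb⟩ := exists_inCarrel (R := R) b
    have ha' := hcar h a ha
    have hb' := hcar h' b hb
    simp only [Equiv.trans_apply]
    have hle : h ≤ h' := by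
      have := carrel_le_of_lt hn hR ha.1 (lt_trans hab hb.2)
      omega
    rcases hle.eq_or_lt with rfl | hlt
    · have h1 := hπ h a b ha hb hab
      by_contra h2
      rcases (not_lt.1 h2).eq_or_lt with h3 | h3
      · have := σ.symm.injective h3
        exact h1.ne this.symm
      · have := hσ h _ _ hb' ha' h3
        simp only [Equiv.apply_symm_apply] at this
        exact absurd h1 this.asymm
    · rw [Fin.lt_def]
      have := divider_mono hn hR (show h + 1 ≤ h' from hlt)
      have := ha'.2
      have := hb'.1
      omega
  have hid : ∀ a, σ.symm (π a) = a := by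
    intro a
    have h1 : Set.range (π.trans σ.symm) = Set.range (id : Fin n → Fin n) := by
      rw [(π.trans σ.symm).surjective.range_eq, Set.range_id]
    have := (StrictMono.range_inj hmono strictMono_id).1 h1
    exact congrFun this a
  ext a
  have := hid a
  rw [Equiv.symm_apply_eq] at this
  rw [this]

end Permutations

/-! ### From gapless core tuples to avoiding permutations -/

section Matching

variable {n : ℕ} {R : Finset ℕ}

/-- The prefix sets of the permutation are the largest columns below the tuple. -/
def Matches (n : ℕ) (R : Finset ℕ) (β : Fin n → Fin n) (π : Equiv.Perm (Fin n)) : Prop :=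
  ∀ h i, i < divider n R h → colMax (extend β) (divider n R h) i = sortedPrefix π (divider n R h) i

theorem Matches.sameColumns_iff (hn : 1 ≤ n) (hR : R ⊆ Finset.Icc 1 (n - 1)) {a b : Fin n → Fin n}
    {π σ : Equiv.Perm (Fin n)} (ha : Matches n R a π) (hb : Matches n R b σ)
    (hπ : π ∈ rPermutations n R) (hσ : σ ∈ rPermutations n R) : SameColumns n R a b ↔ π = σ := by
  constructor
  · intro H
    refine rPermutation_ext hn hR hπ hσ fun q hq i hi => ?_
    obtain ⟨h, -, -, rfl⟩ := exists_divider_eq (n := n) hq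
    rw [← ha h i hi, ← hb h i hi, H h i hi]
  · rintro rfl h i hi
    rw [ha h i hi, hb h i hi]

/-- The last minimiser of `β_z - z` over the whole carrel is its leftmost critical index. The flag
condition bounds the entry at the preceding divider by the entry found there. -/
theorem carrel_attained (hn : 1 ≤ n) (hR : R ⊆ Finset.Icc 1 (n - 1)) {β : Fin n → Fin n}
    (hβ : β ∈ gaplessCoreTuples n R) {h : ℕ} (hh : h ≤ R.card) :
    ∃ y, divider n R h ≤ y ∧ y < divider n R (h + 1) ∧
      (∀ z, divider n R h ≤ z → z < divider n R (h + 1) →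
        extend β y + z ≤ extend β z + y) ∧
      ∀ x, x + 1 = divider n R h → extend β x ≤ extend β y := by
  have hd := divider_le hn hR (h + 1)
  have hlt := divider_lt_succ hn hR hh
  obtain ⟨y, h1, h2, h3, h4⟩ := exists_last_argmin (extend β) hlt
  have hyn : y < n := by omega
  refine ⟨y, h1, h2, h3, fun x hx => ?_⟩
  have hh0 : h ≠ 0 := by rintro rfl; rw [divider_zero] at hx; omega
  obtain ⟨k, rfl⟩ : ∃ k, h = k + 1 := ⟨h - 1, by omega⟩
  have := ((mem_gaplessCoreTuples_iff hn hR).1 hβ).2 k hh ⟨x, by omega⟩ ⟨y, hyn⟩ hx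
    ((isCriticalIndex_iff hd _).2 ⟨⟨h1, h2⟩, fun z hz hyz => ?_⟩)
  · rw [Fin.le_def] at this
    rw [extend_of_lt β hyn, extend_of_lt β (show x < n by omega)]
    exact this
  · have := h4 z hyz hz.2
    rwa [extend_coe, extend_of_lt β hyn] at this

/-- The largest columns below a gapless core tuple form a chain, and there are no gaps between the
new elements and the largest of the old ones. -/
theorem colMax_chain (hn : 1 ≤ n) (hR : R ⊆ Finset.Icc 1 (n - 1)) {β : Fin n → Fin n}
    (hβ : β ∈ gaplessCoreTuples n R) {h : ℕ} (hh : h ≤ R.card) {i j w : ℕ}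
    (hi : i < divider n R h) (hj : j < divider n R (h + 1))
    (hnew : j < divider n R h → colMax (extend β) (divider n R (h + 1)) j ≠
      colMax (extend β) (divider n R h) j)
    (hw : colMax (extend β) (divider n R (h + 1)) j ≤ w)
    (hw' : w ≤ colMax (extend β) (divider n R h) i) :
    ∃ k, k < divider n R (h + 1) ∧ colMax (extend β) (divider n R (h + 1)) k = w := by
  have hb := le_extend hβ.1
  have hlt := divider_lt_succ hn hR hh
  obtain ⟨y, h1, h2, h3, h4⟩ := carrel_attained hn hR hβ hh
  have h5 := h4 (divider n R h - 1) (by omega)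
  have h6 : colMax (extend β) (divider n R h) i ≤
      colMax (extend β) (divider n R h) (divider n R h - 1) := by
    have := colMax_add_sub_le hb (show i ≤ divider n R h - 1 by omega)
      (show divider n R h - 1 < divider n R h by omega)
    omega
  rw [colMax_last (show divider n R h - 1 + 1 = divider n R h by omega)] at h6
  -- If the minimum for row `j` is attained at `y`, the new column climbs by ones from row `j` to
  -- the value `β_y`. The flag condition puts `β_y` at or above the last, hence largest, entry of
  -- the old column.
  have key : ∀ (hjy : j ≤ y)
      (hatt : colMax (extend β) (divider n R (h + 1)) j + y = extend β y + j),
      ∃ k, k < divider n R (h + 1) ∧ colMax (extend β) (divider n R (h + 1)) k = w := by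
    intro hjy hatt
    obtain ⟨k, -, h7, h8⟩ := exists_colMax_eq_of_attained hb h2 hatt hw (by omega)
    exact ⟨k, by omega, h8⟩
  obtain ⟨k, h7, h8, h9⟩ := exists_colMax (extend β) hj
  by_cases hjy : j ≤ y
  · refine key hjy ?_
    have h10 := colMax_add_le hb hjy h2
    by_cases hk : divider n R h ≤ k
    · have := h3 k hk h8
      omega
    -- A minimum attained at an index before the divider is available to the old column too, so the
    -- entry in row `j` would not have changed.
    · exfalso
      refine hnew (by omega) (le_antisymm (colMax_anti hb (by omega) hlt.le) ?_)
      have := colMax_add_le hb h7 (show k < divider n R h by omega)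
      omega
  · have h10 := h3 k (by omega) h8
    omega

/-- An old value either stays in its row or is reached by the gapless run starting from the new,
smaller entry of that row; so the column sets are nested. In a 312 pattern, `π_c` would fill a gap
between the new value `π_b` and the old value `π_a`. -/
theorem exists_matches_of_gaplessCore (hn : 1 ≤ n) (hR : R ⊆ Finset.Icc 1 (n - 1))
    {β : Fin n → Fin n} (hβ : β ∈ gaplessCoreTuples n R) :
    ∃ π ∈ avoidingPermutations n R, Matches n R β π := by
  classical
  have hb := le_extend hβ.1
  let A : ℕ → Finset (Fin n) := fun h => Finset.univ.filter fun v =>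
    ∃ i, i < divider n R h ∧ colMax (extend β) (divider n R h) i = (v : ℕ)
  have memA : ∀ h v, v ∈ A h ↔
      ∃ i, i < divider n R h ∧ colMax (extend β) (divider n R h) i = (v : ℕ) := by
    intro h v; simp [A]
  have hchain : ∀ h, A h ⊆ A (h + 1) := by
    intro h v hv
    by_cases hh : h ≤ R.card
    · rw [memA] at hv ⊢
      obtain ⟨i, hi, hv⟩ := hv
      have hlt := divider_lt_succ hn hR hh
      by_cases he : colMax (extend β) (divider n R (h + 1)) i = colMax (extend β) (divider n R h) i
      · exact ⟨i, by omega, he.trans hv⟩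
      · exact colMax_chain hn hR hβ hh hi (hi.trans hlt) (fun _ => he)
          (hv ▸ colMax_anti hb hi hlt.le) hv.ge
    · rw [memA, divider_of_card_lt (by omega)] at hv ⊢
      exact hv
  have hcard : ∀ h, (A h).card = divider n R h := by
    intro h
    have hd := divider_le hn hR h
    have : A h = (Finset.univ : Finset (Fin (divider n R h))).image fun i =>
        ⟨colMax (extend β) (divider n R h) i, colMax_lt hβ.1 hd i.2⟩ := by
      ext v
      rw [memA]
      simp only [Finset.mem_image, Finset.mem_univ, true_and]
      exact ⟨fun ⟨i, hi, e⟩ => ⟨⟨i, hi⟩, Fin.ext e⟩, fun ⟨i, e⟩ => ⟨i, i.2, congrArg Fin.val e⟩⟩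
    rw [this, Finset.card_image_of_injective, Finset.card_univ, Fintype.card_fin]
    refine StrictMono.injective fun i j hij => ?_
    rw [Fin.lt_def]
    exact colMax_strictMono hb hij j.2
  obtain ⟨π, hπ, hmem⟩ := exists_rPermutation_of_chain A (monotone_nat_of_le_succ hchain) hcard
  refine ⟨π, ⟨hπ, ?_⟩, fun h i hi => ?_⟩
  · rintro ⟨h, h1, h2, a, b, c, ha, hb1, hb2, hc, hba, hbc, hca⟩
    have ha' := (hmem h a).2 ha
    have hb' := (hmem (h + 1) b).2 hb2
    have hb'' : π b ∉ A h := fun hcon => by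
      have := (hmem h b).1 hcon; omega
    have hc' : π c ∉ A (h + 1) := fun hcon => by
      have := (hmem (h + 1) c).1 hcon; omega
    rw [memA] at ha' hb' hb'' hc'
    obtain ⟨i, hi, ei⟩ := ha'
    obtain ⟨j, hj, ej⟩ := hb'
    rw [Fin.lt_def] at hba hbc hca
    refine hc' (colMax_chain hn hR hβ (by omega) hi hj (fun hj' he => ?_) (by omega) (by omega))
    exact hb'' ⟨j, hj', by rw [← he, ej]⟩
  · have hd := divider_le hn hR h
    refine eq_sortedPrefix π hd (fun i j hij hj => colMax_strictMono hb hij hj) (fun i hi => ?_) hi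
    have h1 : (⟨colMax (extend β) (divider n R h) i, colMax_lt hβ.1 hd hi⟩ : Fin n) ∈ A h :=
      (memA _ _).2 ⟨i, hi, rfl⟩
    refine ⟨π.symm ⟨_, colMax_lt hβ.1 hd hi⟩, ?_, by simp⟩
    rw [← hmem h]
    simpa using h1

end Matching

/-! ### From avoiding permutations to gapless core tuples -/

section FromPermutations

variable {n : ℕ} {R : Finset ℕ}

/-- Avoidance as a closure property: a value between a value of the carrel and an earlier value has
occurred by the end of that carrel. The boundary indices need no exception, since nothing precedes
`q_0 = 0` and everything precedes `q_{r+1} = n`. -/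
theorem lt_divider_of_avoiding (hn : 1 ≤ n) (hR : R ⊆ Finset.Icc 1 (n - 1)) {π : Equiv.Perm (Fin n)}
    (hπ : ¬ Contains312 n R π) {h : ℕ} {a b c : Fin n} (ha : (a : ℕ) < divider n R h)
    (hb : (b : ℕ) < divider n R (h + 1)) (hb' : divider n R h ≤ b)
    (hbc : π b ≤ π c) (hca : π c ≤ π a) : (c : ℕ) < divider n R (h + 1) := by
  by_contra hc
  have hlt := divider_mono hn hR (show h ≤ h + 1 by omega)
  refine hπ ⟨h, ?_, ?_, a, b, c, ha, hb', hb, by omega, ?_, ?_, ?_⟩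
  · by_contra h0
    obtain rfl : h = 0 := by omega
    rw [divider_zero] at ha
    omega
  · by_contra h1
    rw [divider_of_card_lt (h := h + 1) (by omega)] at hc
    exact hc c.2
  · refine lt_of_le_of_ne (hbc.trans hca) fun he => ?_
    have := congrArg Fin.val (π.injective he)
    omega
  · refine lt_of_le_of_ne hbc fun he => ?_
    have := congrArg Fin.val (π.injective he)
    omega
  · refine lt_of_le_of_ne hca fun he => ?_
    have := congrArg Fin.val (π.injective he)
    omega

/-- Above the smallest new value of a prefix of an avoiding permutation there are no gaps up to the
largest old value. -/
theorem exists_sortedPrefix_of_avoiding (hn : 1 ≤ n) (hR : R ⊆ Finset.Icc 1 (n - 1))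
    {π : Equiv.Perm (Fin n)} (hπ : ¬ Contains312 n R π) {h i j w : ℕ}
    (hi : i < divider n R h) (hj : j < divider n R (h + 1))
    (hnew : ∃ b : Fin n, divider n R h ≤ b ∧ (b : ℕ) < divider n R (h + 1) ∧
      (π b : ℕ) ≤ sortedPrefix π (divider n R (h + 1)) j)
    (hw : sortedPrefix π (divider n R (h + 1)) j ≤ w)
    (hw' : w ≤ sortedPrefix π (divider n R h) i) :
    j + (w - sortedPrefix π (divider n R (h + 1)) j) < divider n R (h + 1) ∧
      sortedPrefix π (divider n R (h + 1)) (j + (w - sortedPrefix π (divider n R (h + 1)) j)) = w := by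
  have hd := divider_le hn hR h
  have hd' := divider_le hn hR (h + 1)
  obtain ⟨t, rfl⟩ := Nat.exists_eq_add_of_le hw
  clear hw
  rw [Nat.add_sub_cancel_left]
  induction t with
  | zero => exact ⟨hj, rfl⟩
  | succ t ih =>
    obtain ⟨h1, h2⟩ := ih (by omega)
    obtain ⟨a, ha, ea⟩ := exists_eq_sortedPrefix π hd hi
    obtain ⟨b, hb, hb', eb⟩ := hnew
    have hlt := sortedPrefix_lt π hd hi
    obtain ⟨c, hc⟩ : ∃ c, π c = ⟨sortedPrefix π (divider n R (h + 1)) j + (t + 1), by omega⟩ :=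
      π.surjective _
    have hc' := congrArg Fin.val hc
    simp only at hc'
    have h3 := lt_divider_of_avoiding hn hR hπ ha hb' hb (c := c)
      (by rw [Fin.le_def]; omega) (by rw [Fin.le_def]; omega)
    obtain ⟨k, hk, ek⟩ := exists_sortedPrefix_eq π hd' h3
    -- The next value lies in the prefix by avoidance. It sits beyond row `j + t`, and strict
    -- increase leaves no room between, so its row is `j + (t + 1)`.
    have hlt' : j + t < k := by
      by_contra hle
      rcases (not_lt.1 hle).eq_or_lt with h | h
      · rw [h] at ek; omega
      · have := sortedPrefix_strictMono π hd' h h1; omega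
    have h4 := sortedPrefix_strictMono π hd' (show j + t < j + (t + 1) by omega) (by omega)
    refine ⟨by omega, ?_⟩
    rcases (show j + (t + 1) ≤ k by omega).eq_or_lt with h | h
    · rw [h]; omega
    · have := sortedPrefix_strictMono π hd' h hk; omega

/-- The longer prefix has `j + 1` values up to its entry in row `j`. Were they all old, the entry of
the shorter prefix in row `j` would exist and be no larger. -/
theorem exists_new_le (hn : 1 ≤ n) (hR : R ⊆ Finset.Icc 1 (n - 1)) (π : Equiv.Perm (Fin n))
    {h j : ℕ} (hj : j < divider n R (h + 1))
    (hlt : j < divider n R h → sortedPrefix π (divider n R (h + 1)) j <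
      sortedPrefix π (divider n R h) j) :
    ∃ b : Fin n, divider n R h ≤ b ∧ (b : ℕ) < divider n R (h + 1) ∧
      (π b : ℕ) ≤ sortedPrefix π (divider n R (h + 1)) j := by
  have hd := divider_le hn hR h
  have hd' := divider_le hn hR (h + 1)
  by_contra! hcon
  have h1 := card_filter_lt_of_strictMono (fun i j => sortedPrefix_strictMono π hd') hj
  rw [card_filter_sortedPrefix π hd' (· ≤ sortedPrefix π (divider n R (h + 1)) j)] at h1
  have h2 : (Finset.univ.filter fun a : Fin n => (a : ℕ) < divider n R (h + 1) ∧
      (π a : ℕ) ≤ sortedPrefix π (divider n R (h + 1)) j).card ≤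
      (Finset.univ.filter fun a : Fin n => (a : ℕ) < divider n R h ∧
      (π a : ℕ) ≤ sortedPrefix π (divider n R (h + 1)) j).card := by
    refine Finset.card_le_card fun a => ?_
    simp only [Finset.mem_filter, Finset.mem_univ, true_and]
    rintro ⟨h3, h4⟩
    refine ⟨?_, h4⟩
    by_contra h5
    have := hcon a (by omega) h3
    omega
  rw [← card_filter_sortedPrefix π hd (· ≤ sortedPrefix π (divider n R (h + 1)) j)] at h2
  have h3 : ((Finset.range (divider n R h)).filter fun k => sortedPrefix π (divider n R h) k ≤
      sortedPrefix π (divider n R (h + 1)) j) ⊆ Finset.range j := by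
    intro k
    simp only [Finset.mem_filter, Finset.mem_range]
    rintro ⟨h3, h4⟩
    by_contra h5
    have h6 := hlt (by omega)
    rcases (show j ≤ k by omega).eq_or_lt with h | h
    · subst h; omega
    · have := sortedPrefix_strictMono π hd h h3; omega
  have := Finset.card_le_card h3
  rw [Finset.card_range] at this
  omega

/-- Every avoiding permutation comes from a gapless core tuple that is `R`-increasing. -/
theorem exists_gaplessCore_of_avoiding (hn : 1 ≤ n) (hR : R ⊆ Finset.Icc 1 (n - 1))
    {π : Equiv.Perm (Fin n)} (hπ : π ∈ avoidingPermutations n R) :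
    ∃ γ ∈ gaplessCoreTuples n R, IsRIncreasing n R γ ∧ Matches n R γ π := by
  have hav := hπ.2
  have hd := divider_le hn hR
  choose c hc hc' using exists_inCarrel (n := n) (R := R)
  obtain ⟨γ, hγ⟩ : ∃ γ : Fin n → Fin n, ∀ h i, InCarrel n R h i →
      (γ i : ℕ) = sortedPrefix π (divider n R (h + 1)) i :=
    ⟨fun i => ⟨sortedPrefix π (divider n R (c i + 1)) i, sortedPrefix_lt π (hd _) (hc' i).2⟩,
      fun h i hi => by rw [hi.unique hn hR (hc' i)]⟩
  have hγe : ∀ h k, divider n R h ≤ k → k < divider n R (h + 1) →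
      extend γ k = sortedPrefix π (divider n R (h + 1)) k := by
    intro h k h1 h2
    have hk : k < n := h2.trans_le (hd _)
    rw [extend_of_lt γ hk, hγ h ⟨k, hk⟩ ⟨h1, h2⟩]
  have hstep : ∀ h i k, i ≤ k → k < divider n R h →
      sortedPrefix π (divider n R h) i + k ≤ sortedPrefix π (divider n R h) k + i := by
    intro h i k hik hk
    exact strict_add_sub_le (q := divider n R h)
      (fun i hi => sortedPrefix_strictMono π (hd h) (Nat.lt_succ_self i) hi) hik hk
  have hup : γ ∈ upperTuples n := by
    intro i
    have h1 := hstep (c i + 1) 0 i (by omega) (hc' i).2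
    rw [Fin.le_def, hγ _ i (hc' i)]
    omega
  have hb := le_extend hup
  have hinc : IsRIncreasing n R γ := by
    intro h i j hi hj hij
    rw [Fin.lt_def, hγ h i hi, hγ h j hj]
    exact sortedPrefix_strictMono π (hd _) hij hj.2
  -- Every sorted prefix entry is forced by some `γ_k`, by induction over the dividers: either the
  -- entry is inherited from the shorter prefix, or a gapless run leads from it to the first row of
  -- the new carrel.
  have hatt : ∀ h i, i < divider n R h → ∃ k, i ≤ k ∧ k < divider n R h ∧
      sortedPrefix π (divider n R h) i + k = extend γ k + i := by
    intro h
    induction h with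
    | zero => intro i hi; rw [divider_zero] at hi; omega
    | succ h ih =>
      intro i hi
      by_cases h1 : divider n R h ≤ i
      · exact ⟨i, le_rfl, hi, by rw [hγe h i h1 hi]⟩
      · push Not at h1
        have hmono := divider_mono hn hR (show h ≤ h + 1 by omega)
        by_cases h2 : sortedPrefix π (divider n R (h + 1)) i = sortedPrefix π (divider n R h) i
        · obtain ⟨k, h3, h4, h5⟩ := ih i h1
          exact ⟨k, h3, by omega, by rw [h2, h5]⟩
        · have h3 := sortedPrefix_anti π (hd (h + 1)) hmono h1
          have h4 := hstep h i (divider n R h - 1) (by omega) (by omega)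
          -- The chosen `w` is where a run of unit steps from row `i` arrives in row `q_h`. It does
          -- not exceed the old maximum: the old entry in row `i` is larger by at least one, which
          -- pays for the one step beyond the old last row.
          obtain ⟨h5, h6⟩ := exists_sortedPrefix_of_avoiding hn hR hav
            (i := divider n R h - 1) (j := i)
            (w := sortedPrefix π (divider n R (h + 1)) i + (divider n R h - i))
            (by omega) hi (exists_new_le hn hR π hi fun _ => by omega) (by omega) (by omega)
          rw [Nat.add_sub_cancel_left, show i + (divider n R h - i) = divider n R h by omega] at h5 h6
          exact ⟨divider n R h, h1.le, h5, by rw [hγe h _ le_rfl h5, h6]; omega⟩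
  have hmatch : Matches n R γ π := by
    intro h i hi
    apply le_antisymm
    · obtain ⟨k, h1, h2, h3⟩ := hatt h i hi
      have := colMax_add_le hb h1 h2
      omega
    · obtain ⟨k, h1, h2, h3⟩ := exists_colMax (extend γ) hi
      have hk : k < n := h2.trans_le (hd _)
      obtain ⟨h', -, hk'⟩ := exists_inCarrel (R := R) ⟨k, hk⟩
      have h4 := hγe h' k hk'.1 hk'.2
      have h5 := sortedPrefix_anti π (hd h) (divider_mono hn hR (carrel_le_of_lt hn hR hk'.1 h2))
        hk'.2
      have h6 := hstep h i k h1 h2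
      simp only [Nat.succ_eq_add_one] at *
      omega
  refine ⟨γ, (mem_gaplessCoreTuples_iff hn hR).2 ⟨hup, fun h hh x y hx hy => ?_⟩, hinc, hmatch⟩
  obtain ⟨hyc, hmin⟩ := (isCriticalIndex_iff (hd _) _).1 hy
  by_contra hlt
  rw [not_le, Fin.lt_def] at hlt
  have hle := divider_lt_succ hn hR (show h ≤ R.card by omega)
  have ex := hγ h x ⟨by omega, by omega⟩
  have ey := hγ (h + 1) y hyc
  have hy1 := hyc.1
  -- If the flag condition failed, `γ_y + 1` would be at most an old value and so occupy row `y + 1`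
  -- of the same carrel. Then `γ_k - k` would be equal at `y` and `y + 1`, against the strict
  -- minimality at a critical index.
  obtain ⟨h5, h6⟩ := exists_sortedPrefix_of_avoiding hn hR hav (i := x) (j := y)
    (w := sortedPrefix π (divider n R (h + 1 + 1)) y + 1) (by omega) hyc.2
    (exists_new_le hn hR π hyc.2 fun _ => by omega) (by omega) (by omega)
  rw [Nat.add_sub_cancel_left] at h5 h6
  have hyn : (y : ℕ) + 1 < n := h5.trans_le (hd _)
  have hz : InCarrel n R (h + 1) ⟨y + 1, hyn⟩ := ⟨by simp only; omega, h5⟩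
  have h7 := hmin ⟨y + 1, hyn⟩ hz (by rw [Fin.lt_def]; simp only; omega)
  have h8 := hγ (h + 1) ⟨y + 1, hyn⟩ hz
  simp only at h7 h8
  omega

end FromPermutations

/-! ### Representatives of the classes, and the counting principle -/

section Representatives

variable {n : ℕ} {R : Finset ℕ}

theorem isCriticalIndex_last {η : Fin n → Fin n} (hn : 1 ≤ n) (hR : R ⊆ Finset.Icc 1 (n - 1)) {h : ℕ} (hh : h ≤ R.card) {x : Fin n}
    (hx : (x : ℕ) + 1 = divider n R (h + 1)) : IsCriticalIndex n R η h x := by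
  have := divider_lt_succ hn hR hh
  exact .rightmost x ⟨by omega, by omega⟩ hx

/-- Inside a carrel this is the increase of `γ`; from one carrel to the next it is the flag
condition at the right end. -/
theorem le_of_le_critical (hn : 1 ≤ n) (hR : R ⊆ Finset.Icc 1 (n - 1)) {γ : Fin n → Fin n}
    (hγ : γ ∈ gaplessCoreTuples n R) (hinc : IsRIncreasing n R γ) {h : ℕ} {x j : Fin n}
    (hx : IsCriticalIndex n R γ h x) (hj : j ≤ x) : γ j ≤ γ x := by
  induction h generalizing x with
  | zero =>
    rcases hj.eq_or_lt with rfl | hj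
    · exact le_rfl
    · refine (hinc 0 j x ⟨by rw [divider_zero]; omega, ?_⟩ hx.inCarrel hj).le
      have := hx.inCarrel.2
      rw [Fin.lt_def] at hj
      omega
  | succ h ih =>
    have hc := hx.inCarrel
    have hcard := hc.le_card
    by_cases h1 : divider n R (h + 1) ≤ j
    · rcases hj.eq_or_lt with rfl | hj
      · exact le_rfl
      · refine (hinc _ j x ⟨h1, ?_⟩ hc hj).le
        have := hc.2
        rw [Fin.lt_def] at hj
        omega
    · have hd := divider_le hn hR (h + 1)
      have he : ((⟨divider n R (h + 1) - 1, by omega⟩ : Fin n) : ℕ) + 1 = divider n R (h + 1) := by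
        simp only; omega
      refine (ih (isCriticalIndex_last hn hR (by omega) he) ?_).trans
        (((mem_gaplessCoreTuples_iff hn hR).1 hγ).2 h hcard _ x he hx)
      rw [Fin.le_def]
      simp only
      omega

/-- The suffix minima of `γ_i - i` occur at critical indices, so raising the other entries leaves
them intact. Canopy tuples, ceiling flags and floor flags are all produced from `γ` in this way. -/
theorem isCore_of_critical (hn : 1 ≤ n) (hR : R ⊆ Finset.Icc 1 (n - 1)) {γ τ : Fin n → Fin n}
    (hτ : τ ∈ upperTuples n) (hinc : IsRIncreasing n R γ)
    (hle : γ ≤ τ) (hcrit : ∀ h x, IsCriticalIndex n R γ h x → τ x = γ x) : IsCore n R τ γ := by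
  intro h i hi
  apply le_antisymm
  · obtain ⟨δ, hδ⟩ := exists_isCore hn hR hτ
    rw [← hδ h i hi]
    exact hδ.le_of_isRIncreasing hn hR hinc hle i
  · obtain ⟨x, h1, h2, h3⟩ := exists_critical_ge hn hR (υ := γ) hi
    have h4 := colMax_add_le (le_extend hτ) (show (i : ℕ) ≤ x from h1) h2.inCarrel.2
    rw [extend_coe, hcrit h x h2] at h4
    have := h3 i le_rfl hi
    omega

theorem exists_next_critical (hn : 1 ≤ n) (hR : R ⊆ Finset.Icc 1 (n - 1)) (η : Fin n → Fin n)
    (i : Fin n) : ∃ x, i ≤ x ∧ IsCritical n R η x ∧ ∀ k, i ≤ k → k < x → ¬ IsCritical n R η k := by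
  classical
  obtain ⟨h, hh, hi⟩ := exists_inCarrel (R := R) i
  obtain ⟨x, h1, h2, -⟩ := exists_critical_ge hn hR (υ := η) hi
  obtain ⟨w, hw, hwmin⟩ := Finset.exists_min_image
    (Finset.univ.filter fun w => i ≤ w ∧ IsCritical n R η w) id
    ⟨x, by simpa using ⟨h1, ⟨h, by omega⟩, h2⟩⟩
  simp only [Finset.mem_filter, Finset.mem_univ, true_and, id] at hw hwmin
  exact ⟨w, hw.1, hw.2, fun k hk hkw hcr => absurd (hwmin k ⟨hk, hcr⟩) (not_le.2 hkw)⟩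

theorem SameColumns.isCritical_iff (hn : 1 ≤ n) (hR : R ⊆ Finset.Icc 1 (n - 1))
    {a b : Fin n → Fin n} (ha : a ∈ upperTuples n) (hb : b ∈ upperTuples n)
    (H : SameColumns n R a b) {x : Fin n} : IsCritical n R a x ↔ IsCritical n R b x :=
  exists_congr fun _ => H.isCriticalIndex_iff hn hR ha hb

theorem exists_canopy (hn : 1 ≤ n) (hR : R ⊆ Finset.Icc 1 (n - 1)) {γ : Fin n → Fin n}
    (hγ : γ ∈ gaplessCoreTuples n R) (hinc : IsRIncreasing n R γ) :
    ∃ κ ∈ canopyTuples n R, SameColumns n R κ γ := by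
  classical
  let κ : Fin n → Fin n := fun i => if IsCritical n R γ i then γ i else ⟨n - 1, by omega⟩
  have hle : γ ≤ κ := by
    intro i
    simp only [κ]
    split_ifs
    · exact le_rfl
    · rw [Fin.le_def]; simp only; omega
  have hκ : κ ∈ upperTuples n := fun i => (hγ.1 i).trans (hle i)
  have hcore := isCore_of_critical hn hR hκ hinc hle (fun h x hx => by
    have : IsCritical n R γ x := ⟨⟨h, by have := hx.inCarrel.le_card; omega⟩, hx⟩
    simp [κ, this])
  have hsame := hcore.sameColumns hn hR hκ
  refine ⟨κ, ⟨hsame.symm.mem_gaplessCoreTuples hn hR hγ hκ, fun i hi => ?_⟩, hsame⟩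
  rw [hsame.isCritical_iff hn hR hκ hγ.1] at hi
  simp only [κ, if_neg hi]
  omega

theorem canopy_ext (hn : 1 ≤ n) (hR : R ⊆ Finset.Icc 1 (n - 1)) {a b : Fin n → Fin n}
    (ha : a ∈ canopyTuples n R) (hb : b ∈ canopyTuples n R) (H : SameColumns n R a b) : a = b := by
  funext i
  by_cases hi : IsCritical n R a i
  · obtain ⟨h, hi⟩ := hi
    exact H.eq_of_critical hn hR ha.1.1 hb.1.1 hi
  · have h1 := ha.2 i hi
    rw [H.isCritical_iff hn hR ha.1.1 hb.1.1] at hi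
    have h2 := hb.2 i hi
    exact Fin.ext (by omega)

/-- Each entry is replaced by the entry at the next critical index at or to its right. Monotonicity
is `le_of_le_critical`. -/
theorem exists_ceiling (hn : 1 ≤ n) (hR : R ⊆ Finset.Icc 1 (n - 1)) {γ : Fin n → Fin n}
    (hγ : γ ∈ gaplessCoreTuples n R) (hinc : IsRIncreasing n R γ) :
    ∃ ξ ∈ ceilingFlags n R, SameColumns n R ξ γ := by
  choose next h1 h2 h3 using exists_next_critical hn hR γ
  have hnext : ∀ i x, i ≤ x → IsCritical n R γ x → next i ≤ x := by
    intro i x hi hx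
    by_contra hlt
    exact h3 i x hi (not_le.1 hlt) hx
  have hle : ∀ i x, i ≤ x → IsCritical n R γ x → γ i ≤ γ x := fun i x hi ⟨h, hx⟩ =>
    le_of_le_critical hn hR hγ hinc hx hi
  have hle' : γ ≤ fun i => γ (next i) := fun i => hle i _ (h1 i) (h2 i)
  have hup : (fun i => γ (next i)) ∈ upperTuples n := fun i => (hγ.1 i).trans (hle' i)
  have hcrit : ∀ x, IsCritical n R γ x → next x = x := fun x hx =>
    le_antisymm (hnext x x le_rfl hx) (h1 x)
  have hcore := isCore_of_critical hn hR hup hinc hle' (fun h x hx => by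
    rw [hcrit x ⟨⟨h, by have := hx.inCarrel.le_card; omega⟩, hx⟩])
  have hsame := hcore.sameColumns hn hR hup
  refine ⟨fun i => γ (next i), ⟨⟨hup, fun i j hij => ?_⟩, fun i x hi hx hno => ?_⟩, hsame⟩
  · exact hle _ _ (hnext i _ (hij.trans (h1 j)) (h2 j)) (h2 j)
  · rw [hsame.isCritical_iff hn hR hup hγ.1] at hx
    have : next i = x := by
      refine le_antisymm (hnext i x hi hx) (not_lt.1 fun hlt => hno _ (h1 i) hlt ?_)
      rw [hsame.isCritical_iff hn hR hup hγ.1]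
      exact h2 i
    simp only [this, hcrit x hx]

theorem ceiling_ext (hn : 1 ≤ n) (hR : R ⊆ Finset.Icc 1 (n - 1)) {a b : Fin n → Fin n}
    (ha : a ∈ ceilingFlags n R) (hb : b ∈ ceilingFlags n R) (H : SameColumns n R a b) : a = b := by
  funext i
  obtain ⟨x, h1, h2, h3⟩ := exists_next_critical hn hR a i
  have hiff := fun x => H.isCritical_iff hn hR ha.1.1 hb.1.1 (x := x)
  rw [ha.2 i x h1 h2 h3, hb.2 i x h1 ((hiff x).1 h2) fun k hk hkx hc => h3 k hk hkx ((hiff k).2 hc)]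
  obtain ⟨h, hx⟩ := h2
  exact H.eq_of_critical hn hR ha.1.1 hb.1.1 hx

/-- The flag is the running maximum of `γ`. If a plateau of length at least two started at an index
that is not the end of a carrel, then `γ` would rise there, so the constant maximum would come from
an earlier index and the plateau would extend to the left. -/
theorem exists_floor (hn : 1 ≤ n) (hR : R ⊆ Finset.Icc 1 (n - 1)) {γ : Fin n → Fin n}
    (hγ : γ ∈ gaplessCoreTuples n R) (hinc : IsRIncreasing n R γ) :
    ∃ τ ∈ floorFlags n R, SameColumns n R τ γ := by
  have hne : ∀ i : Fin n, (Finset.Iic i).Nonempty := fun i => ⟨i, by simp⟩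
  let τ : Fin n → Fin n := fun i => (Finset.Iic i).sup' (hne i) γ
  have hle : ∀ i j, j ≤ i → γ j ≤ τ i := fun i j hij =>
    Finset.le_sup' γ (Finset.mem_Iic.2 hij)
  have hex : ∀ i, ∃ j ≤ i, τ i = γ j := fun i => by
    obtain ⟨j, hj, e⟩ := Finset.exists_mem_eq_sup' (hne i) γ
    exact ⟨j, Finset.mem_Iic.1 hj, e⟩
  have hle' : γ ≤ τ := fun i => hle i i le_rfl
  have hup : τ ∈ upperTuples n := fun i => (hγ.1 i).trans (hle' i)
  have hmono : Monotone τ := by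
    intro i j hij
    obtain ⟨k, hk, e⟩ := hex i
    exact e ▸ hle j k (hk.trans hij)
  have hcore := isCore_of_critical hn hR hup hinc hle' (fun h x hx => by
    obtain ⟨k, hk, e⟩ := hex x
    exact le_antisymm (e ▸ le_of_le_critical hn hR hγ hinc hx hk) (hle' x))
  refine ⟨τ, ⟨⟨hup, hmono⟩, fun a b hab hlt => ?_⟩, hcore.sameColumns hn hR hup⟩
  obtain ⟨-, hconst, hmax, -⟩ := hab
  obtain ⟨h, hh, ha⟩ := exists_inCarrel (R := R) a
  rw [Fin.lt_def] at hlt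
  by_cases hend : (a : ℕ) + 1 = divider n R (h + 1)
  · rw [hend]
    refine divider_mem (by omega) ?_
    by_contra hcard
    rw [divider_of_card_lt (by omega)] at hend
    omega
  · exfalso
    have hsn : (a : ℕ) + 1 < n := by omega
    have ha1 := ha.1
    have ha2 := ha.2
    have hs : InCarrel n R h ⟨a + 1, hsn⟩ := ⟨by simp only; omega, by simp only; omega⟩
    have h1 := hconst ⟨a + 1, hsn⟩ (by rw [Fin.le_def]; simp only; omega)
      (by rw [Fin.le_def]; simp only; omega)
    have h2 := hinc h a ⟨a + 1, hsn⟩ ha hs (by rw [Fin.lt_def]; simp only; omega)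
    have h3 := h2.trans_le ((hle' _).trans_eq h1)
    obtain ⟨j, hj, e⟩ := hex a
    have hja : j < a := by
      rcases hj.eq_or_lt with rfl | hj
      · rw [e] at h3; exact absurd h3 (lt_irrefl _)
      · exact hj
    rw [Fin.lt_def] at hja
    have h4 : a.1 - 1 < n := by omega
    refine hmax ⟨a - 1, h4⟩ (by simp only; omega) (le_antisymm (hmono ?_) ?_)
    · rw [Fin.le_def]; simp only; omega
    · rw [e]
      exact hle _ j (by rw [Fin.le_def]; simp only; omega)

/-- A floor flag that is strict from `i` to the end of the carrel equals its core at `i`. Otherwise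
some plateau meets the rest of the carrel in two indices; it starts at a divider before `i`, where
tuple and core agree. With monotonicity, the flag is thus the running maximum of its core. -/
theorem floor_eq_core (hn : 1 ≤ n) (hR : R ⊆ Finset.Icc 1 (n - 1)) {τ γ : Fin n → Fin n}
    (hτ : τ ∈ floorFlags n R) (hγ : IsCore n R τ γ) (i : Fin n) : ∃ j ≤ i, τ i = γ j := by
  classical
  obtain ⟨h, hh, hi⟩ := exists_inCarrel (R := R) i
  have hd := divider_le hn hR (h + 1)
  by_cases hstrict : ∀ k, (i : ℕ) ≤ k → k + 1 < divider n R (h + 1) →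
      extend τ k < extend τ (k + 1)
  · refine ⟨i, le_rfl, Fin.ext ?_⟩
    obtain ⟨k, h1, h2, h3⟩ := exists_colMax (extend τ) hi.2
    have h4 : extend τ i + k ≤ extend τ k + i := by
      clear h3
      induction k, h1 using Nat.le_induction with
      | base => exact le_rfl
      | succ k hk ih =>
        have := hstrict k hk h2
        have := ih (by omega)
        omega
    rw [← hγ h i hi] at h3
    rw [extend_coe] at h4
    have := hγ.le hτ.1.1 i
    rw [Fin.le_def] at this
    omega
  · push Not at hstrict
    obtain ⟨k, hik, hk, hle⟩ := hstrict
    have hk1 : k < n := by omega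
    have hk2 : k + 1 < n := by omega
    rw [extend_of_lt τ hk1, extend_of_lt τ hk2] at hle
    have heq : τ ⟨k + 1, hk2⟩ = τ ⟨k, hk1⟩ :=
      le_antisymm hle (hτ.1.2 (by rw [Fin.le_def]; simp only; omega))
    let S := Finset.univ.filter fun x => τ x = τ ⟨k, hk1⟩
    have hS : S.Nonempty := ⟨⟨k, hk1⟩, by simp [S]⟩
    obtain ⟨a, ha, hamin⟩ := S.exists_min_image id hS
    obtain ⟨b, hb, hbmax⟩ := S.exists_max_image id hS
    simp only [S, Finset.mem_filter, Finset.mem_univ, true_and, id] at ha hb hamin hbmax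
    have h1 := hamin _ (rfl : τ ⟨k, hk1⟩ = _)
    have h2 := hbmax _ heq
    rw [Fin.le_def] at h1 h2
    simp only at h1 h2
    have hplat : IsPlateau n τ a b := by
      refine ⟨by rw [Fin.le_def]; omega, fun x hx hx' => ?_, fun x hx he => ?_, fun x hx he => ?_⟩
      · exact le_antisymm ((hτ.1.2 hx').trans_eq (hb.trans ha.symm)) (hτ.1.2 hx)
      · have := hamin x (he.trans ha)
        rw [Fin.le_def] at this
        omega
      · have := hbmax x (he.trans hb)
        rw [Fin.le_def] at this
        omega
    obtain ⟨h', h3, h4, h5⟩ := exists_divider_eq (n := n)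
      (hτ.2 a b hplat (by rw [Fin.lt_def]; omega))
    have h6 : h' < h + 1 := by
      by_contra hlt
      have := divider_mono hn hR (not_lt.1 hlt)
      omega
    have h7 := divider_mono hn hR (show h' ≤ h by omega)
    have h8 := hi.1
    refine ⟨a, by rw [Fin.le_def]; omega, ?_⟩
    obtain ⟨g, rfl⟩ : ∃ g, h' = g + 1 := ⟨h' - 1, by omega⟩
    have h9 := divider_lt_succ hn hR (show g ≤ R.card by omega)
    have h10 := hγ g a ⟨by omega, by omega⟩
    rw [colMax_last h5.symm, extend_coe] at h10
    rw [Fin.ext h10]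
    exact le_antisymm ((hτ.1.2 (by rw [Fin.le_def]; simpa using hik)).trans_eq ha.symm)
      (hτ.1.2 (by rw [Fin.le_def]; omega))

theorem floor_ext (hn : 1 ≤ n) (hR : R ⊆ Finset.Icc 1 (n - 1)) {a b : Fin n → Fin n}
    (ha : a ∈ floorFlags n R) (hb : b ∈ floorFlags n R) (H : SameColumns n R a b) : a = b := by
  obtain ⟨γ, hγ⟩ := exists_isCore hn hR ha.1.1
  have hγ' := H.isCore hγ
  funext i
  apply le_antisymm
  · obtain ⟨j, hj, e⟩ := floor_eq_core hn hR ha hγ i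
    rw [e]
    exact (hγ'.le hb.1.1 j).trans (hb.1.2 hj)
  · obtain ⟨j, hj, e⟩ := floor_eq_core hn hR hb hγ' i
    rw [e]
    exact (hγ.le ha.1.1 j).trans (ha.1.2 hj)

/-- A list is realised by putting the largest value at all unlisted indices. Such an entry is never
a strict right-to-left minimum, because the right end of the carrel is listed, and it never spoils
the minimality of a listed one. -/
theorem flagCriticalLists_eq_image (hn : 1 ≤ n) (hR : R ⊆ Finset.Icc 1 (n - 1)) :
    flagCriticalLists n R = criticalList n R '' gaplessCoreTuples n R := by
  classical
  refine Set.Subset.antisymm (fun C hC => ?_) ?_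
  · have hd := divider_le hn hR
    have hlist := hC.1
    have hex : ∀ i : Fin n, ∃ v : Fin n, (∀ h, ∀ p ∈ C h, p.1 = i → v = p.2) ∧
        ((¬ ∃ h, ∃ p ∈ C h, p.1 = i) → (v : ℕ) = n - 1) := by
      intro i
      by_cases H : ∃ h, ∃ p ∈ C h, p.1 = i
      · obtain ⟨h, p, hp, rfl⟩ := H
        refine ⟨p.2, fun h' p' hp' he => ?_, fun hno => absurd ⟨h, p, hp, rfl⟩ hno⟩
        have h3 := ((hlist h').1 p' hp').1
        rw [he] at h3
        obtain rfl : h' = h := Fin.ext (h3.unique hn hR ((hlist h).1 p hp).1)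
        rw [(hlist h').2.2.1 p' hp' p hp he]
      · exact ⟨⟨n - 1, by omega⟩, fun h p hp he => absurd ⟨h, p, hp, he⟩ H, fun _ => rfl⟩
    choose κ hκ0 hκ' using hex
    have hκ : ∀ h, ∀ p ∈ C h, κ p.1 = p.2 := fun h p hp => hκ0 p.1 h p hp rfl
    have hup : κ ∈ upperTuples n := by
      intro i
      by_cases H : ∃ h, ∃ p ∈ C h, p.1 = i
      · obtain ⟨h, p, hp, rfl⟩ := H
        rw [hκ h p hp]
        exact ((hlist h).1 p hp).2
      · rw [Fin.le_def, hκ' i H]; omega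
    have hcrit : ∀ (h : Fin (R.card + 1)) x, IsCriticalIndex n R κ h x ↔ ∃ p ∈ C h, p.1 = x := by
      intro h x
      rw [isCriticalIndex_iff (hd _)]
      obtain ⟨e, he, he'⟩ := (hlist h).2.1
      constructor
      · rintro ⟨hx, hmin⟩
        by_contra hno
        have hno' : ¬ ∃ h, ∃ p ∈ C h, p.1 = x := by
          rintro ⟨h', p, hp, rfl⟩
          have := ((hlist h').1 p hp).1.unique hn hR hx
          exact hno ⟨p, Fin.ext this ▸ hp, rfl⟩
        have hlt : x < e.1 := by
          refine lt_of_le_of_ne ?_ fun h => hno ⟨e, he, h.symm⟩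
          have := hx.2
          rw [Fin.le_def]
          omega
        have h1 := hmin e.1 ((hlist h).1 e he).1 hlt
        rw [hκ' x hno'] at h1
        rw [Fin.lt_def] at hlt
        omega
      · rintro ⟨p, hp, rfl⟩
        refine ⟨((hlist h).1 p hp).1, fun z hz hpz => ?_⟩
        rw [hκ h p hp]
        by_cases H : ∃ h, ∃ p ∈ C h, p.1 = z
        · obtain ⟨h', p', hp', rfl⟩ := H
          obtain rfl : h' = h := Fin.ext (((hlist h').1 p' hp').1.unique hn hR hz)
          rw [hκ h' p' hp']
          exact (hlist h').2.2.2 p hp p' hp' hpz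
        · rw [hκ' z H]
          have hz2 := hz.2
          rw [Fin.lt_def] at hpz
          have := (hlist h).2.2.2 p hp e he (by rw [Fin.lt_def]; omega)
          omega
    have heq : criticalList n R κ = C := by
      funext h
      ext p
      rw [mem_criticalList, hcrit]
      constructor
      · rintro ⟨⟨p', hp', h1⟩, h2⟩
        rw [← h1, hκ h p' hp'] at h2
        rwa [Prod.ext h1.symm h2]
      · exact fun hp => ⟨⟨p, hp, rfl⟩, (hκ h p hp).symm⟩
    exact ⟨κ, ⟨hup, heq ▸ hC⟩, heq⟩
  · rintro _ ⟨η, hη, rfl⟩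
    exact hη.2

/-- The counting principle: a family of gapless core tuples that represents all avoiding
permutations, together with an invariant that determines exactly the columns. -/
theorem ncard_image_eq_parabolicCatalan (hn : 1 ≤ n) (hR : R ⊆ Finset.Icc 1 (n - 1))
    {φ : Type*} (A : Set (Fin n → Fin n)) (F : (Fin n → Fin n) → φ)
    (hA : A ⊆ gaplessCoreTuples n R)
    (hex : ∀ γ ∈ gaplessCoreTuples n R, IsRIncreasing n R γ → ∃ a ∈ A, SameColumns n R a γ)
    (hF : ∀ a ∈ A, ∀ b ∈ A, F a = F b ↔ SameColumns n R a b) :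
    (F '' A).ncard = parabolicCatalan n R := by
  have hrep : ∀ π ∈ avoidingPermutations n R, ∃ a ∈ A, Matches n R a π := by
    intro π hπ
    obtain ⟨γ, h1, h2, h3⟩ := exists_gaplessCore_of_avoiding hn hR hπ
    obtain ⟨a, ha, h4⟩ := hex γ h1 h2
    exact ⟨a, ha, fun h i hi => (h4 h i hi).trans (h3 h i hi)⟩
  have : Nonempty (Fin n → Fin n) := ⟨id⟩
  choose! a ha hm using hrep
  symm
  refine Set.ncard_congr (fun π _ => F (a π)) (fun π hπ => ⟨_, ha π hπ, rfl⟩)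
    (fun π σ hπ hσ h => ?_) ?_
  · rw [hF _ (ha π hπ) _ (ha σ hσ)] at h
    exact ((hm π hπ).sameColumns_iff hn hR (hm σ hσ) hπ.1 hσ.1).1 h
  · rintro _ ⟨b, hb, rfl⟩
    obtain ⟨π, hπ, h1⟩ := exists_matches_of_gaplessCore hn hR (hA hb)
    refine ⟨π, hπ, ?_⟩
    rw [hF _ (ha π hπ) _ hb]
    exact ((hm π hπ).sameColumns_iff hn hR h1 hπ.1 hπ.1).2 rfl

theorem card_quotient_ker {α φ : Type*} (A : Set α) (F : α → φ) :
    Nat.card (Quotient (Setoid.ker fun a : A => F a)) = (F '' A).ncard := by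
  rw [Nat.card_congr (Setoid.quotientKerEquivRange _), ← Set.image_eq_range]
  rfl

theorem gaplessCoreTuples_represents (γ : Fin n → Fin n) (hγ : γ ∈ gaplessCoreTuples n R)
    (_ : IsRIncreasing n R γ) : ∃ a ∈ gaplessCoreTuples n R, SameColumns n R a γ :=
  ⟨γ, hγ, fun _ _ _ => rfl⟩

theorem upperFlags_represents (hn : 1 ≤ n) (hR : R ⊆ Finset.Icc 1 (n - 1)) (γ : Fin n → Fin n)
    (hγ : γ ∈ gaplessCoreTuples n R) (hinc : IsRIncreasing n R γ) :
    ∃ a ∈ upperFlags n, SameColumns n R a γ := by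
  obtain ⟨τ, h1, h2⟩ := exists_floor hn hR hγ hinc
  exact ⟨τ, h1.1, h2⟩

theorem sameColumns_of_eq {a b : Fin n → Fin n} (h : a = b) : SameColumns n R a b :=
  fun _ _ _ => by rw [h]

theorem ncard_flagCriticalLists (hn : 1 ≤ n) (hR : R ⊆ Finset.Icc 1 (n - 1)) :
    (flagCriticalLists n R).ncard = parabolicCatalan n R := by
  rw [flagCriticalLists_eq_image hn hR]
  exact ncard_image_eq_parabolicCatalan hn hR _ _ subset_rfl gaplessCoreTuples_represents
    fun a ha b hb => criticalList_eq_iff hn hR ha.1 hb.1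

theorem ncard_canopyTuples (hn : 1 ≤ n) (hR : R ⊆ Finset.Icc 1 (n - 1)) :
    (canopyTuples n R).ncard = parabolicCatalan n R := by
  rw [← Set.image_id (canopyTuples n R)]
  exact ncard_image_eq_parabolicCatalan hn hR _ _ (fun _ h => h.1)
    (fun _ h1 h2 => exists_canopy hn hR h1 h2)
    fun _ ha _ hb => ⟨sameColumns_of_eq, canopy_ext hn hR ha hb⟩

theorem ncard_floorFlags (hn : 1 ≤ n) (hR : R ⊆ Finset.Icc 1 (n - 1)) :
    (floorFlags n R).ncard = parabolicCatalan n R := by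
  rw [← Set.image_id (floorFlags n R)]
  exact ncard_image_eq_parabolicCatalan hn hR _ _
    (fun _ h => upperFlags_subset_gaplessCoreTuples hn hR h.1)
    (fun _ h1 h2 => exists_floor hn hR h1 h2)
    fun _ ha _ hb => ⟨sameColumns_of_eq, floor_ext hn hR ha hb⟩

theorem ncard_ceilingFlags (hn : 1 ≤ n) (hR : R ⊆ Finset.Icc 1 (n - 1)) :
    (ceilingFlags n R).ncard = parabolicCatalan n R := by
  rw [← Set.image_id (ceilingFlags n R)]
  exact ncard_image_eq_parabolicCatalan hn hR _ _
    (fun _ h => upperFlags_subset_gaplessCoreTuples hn hR h.1)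
    (fun _ h1 h2 => exists_ceiling hn hR h1 h2)
    fun _ ha _ hb => ⟨sameColumns_of_eq, ceiling_ext hn hR ha hb⟩

theorem card_simEquiv_gaplessCoreTuples (hn : 1 ≤ n) (hR : R ⊆ Finset.Icc 1 (n - 1)) :
    Nat.card (Quotient (simEquiv n R (gaplessCoreTuples n R))) = parabolicCatalan n R := by
  refine (card_quotient_ker _ (increasingBelow n R)).trans ?_
  exact ncard_image_eq_parabolicCatalan hn hR _ _ subset_rfl gaplessCoreTuples_represents
    fun a ha b hb => increasingBelow_eq_iff hn hR ha.1 hb.1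

theorem card_simEquiv_upperFlags (hn : 1 ≤ n) (hR : R ⊆ Finset.Icc 1 (n - 1)) :
    Nat.card (Quotient (simEquiv n R (upperFlags n))) = parabolicCatalan n R := by
  refine (card_quotient_ker _ (increasingBelow n R)).trans ?_
  exact ncard_image_eq_parabolicCatalan hn hR _ _ (upperFlags_subset_gaplessCoreTuples hn hR)
    (upperFlags_represents hn hR) fun a ha b hb => increasingBelow_eq_iff hn hR ha.1 hb.1

end Representatives

/-! ### Matching a decreasing sequence with a column -/

section Bump

variable (V D : ℕ → ℕ) (l : ℕ)

/-- The number of entries of the column `D` of length `l` that are still unmatched after the first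
`k` elements of the decreasing sequence `V` were offered to it: each of them is matched with the
lowest unmatched entry of `D` if that is at least as large. -/
def bumpPtr : ℕ → ℕ
  | 0 => l
  | k + 1 => if 0 < bumpPtr k ∧ V k ≤ D (bumpPtr k - 1) then bumpPtr k - 1 else bumpPtr k

/-- The sequence `V` with the matched elements replaced by their partners in the column `D`. -/
def bump (k : ℕ) : ℕ :=
  if 0 < bumpPtr V D l k ∧ V k ≤ D (bumpPtr V D l k - 1) then D (bumpPtr V D l k - 1) else V k

variable {V D l}

theorem bumpPtr_succ_of_pos {k : ℕ} (h : 0 < bumpPtr V D l k ∧ V k ≤ D (bumpPtr V D l k - 1)) :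
    bumpPtr V D l (k + 1) = bumpPtr V D l k - 1 := by rw [bumpPtr, if_pos h]

theorem bumpPtr_succ_of_neg {k : ℕ} (h : ¬ (0 < bumpPtr V D l k ∧ V k ≤ D (bumpPtr V D l k - 1))) :
    bumpPtr V D l (k + 1) = bumpPtr V D l k := by rw [bumpPtr, if_neg h]

theorem bump_of_pos {k : ℕ} (h : 0 < bumpPtr V D l k ∧ V k ≤ D (bumpPtr V D l k - 1)) :
    bump V D l k = D (bumpPtr V D l k - 1) := by rw [bump, if_pos h]

theorem bump_of_neg {k : ℕ} (h : ¬ (0 < bumpPtr V D l k ∧ V k ≤ D (bumpPtr V D l k - 1))) :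
    bump V D l k = V k := by rw [bump, if_neg h]

theorem le_bump (k : ℕ) : V k ≤ bump V D l k := by
  by_cases h : 0 < bumpPtr V D l k ∧ V k ≤ D (bumpPtr V D l k - 1)
  · rw [bump_of_pos h]; exact h.2
  · rw [bump_of_neg h]

theorem bumpPtr_le (k : ℕ) : bumpPtr V D l k ≤ l := by
  induction k with
  | zero => exact le_rfl
  | succ k ih =>
    rw [bumpPtr]
    split_ifs <;> omega

/-- Two successive matches use successive entries of `D`. If a match follows a failure, the same
entry of `D` was refused because it was less than `V k`. -/
theorem bump_succ_lt {q : ℕ} (hV : ∀ k, k + 1 < q → V (k + 1) < V k)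
    (hD : ∀ i, i + 1 < l → D i < D (i + 1)) {k : ℕ} (hk : k + 1 < q) :
    bump V D l (k + 1) < bump V D l k := by
  have h0 := hV k hk
  have hl := bumpPtr_le (V := V) (D := D) (l := l) k
  by_cases h : 0 < bumpPtr V D l k ∧ V k ≤ D (bumpPtr V D l k - 1)
  · rw [bump_of_pos h]
    by_cases h' : 0 < bumpPtr V D l (k + 1) ∧ V (k + 1) ≤ D (bumpPtr V D l (k + 1) - 1)
    · rw [bump_of_pos h']
      rw [bumpPtr_succ_of_pos h] at h' ⊢
      have := hD (bumpPtr V D l k - 1 - 1) (by omega)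
      rwa [show bumpPtr V D l k - 1 - 1 + 1 = bumpPtr V D l k - 1 by omega] at this
    · rw [bump_of_neg h']
      omega
  · rw [bump_of_neg h]
    by_cases h' : 0 < bumpPtr V D l (k + 1) ∧ V (k + 1) ≤ D (bumpPtr V D l (k + 1) - 1)
    · rw [bump_of_pos h']
      rw [bumpPtr_succ_of_neg h] at h' ⊢
      push Not at h
      exact h h'.1
    · rw [bump_of_neg h']
      exact h0

/-- There are never more unmatched column entries than offers left. When the numbers are equal, the
row inequality at the lowest unmatched entry forces the next match. -/
theorem bumpPtr_add_le {q : ℕ} (hl : l ≤ q) (hrow : ∀ i, i < l → V (q - 1 - i) ≤ D i) {k : ℕ}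
    (hk : k ≤ q) : bumpPtr V D l k + k ≤ q := by
  induction k with
  | zero => exact hl
  | succ k ih =>
    have h1 := ih (by omega)
    have h2 := bumpPtr_le (V := V) (D := D) (l := l) k
    by_cases h : 0 < bumpPtr V D l k ∧ V k ≤ D (bumpPtr V D l k - 1)
    · rw [bumpPtr_succ_of_pos h]; omega
    · rw [bumpPtr_succ_of_neg h]
      by_contra hlt
      apply h
      refine ⟨by omega, ?_⟩
      have := hrow (bumpPtr V D l k - 1) (by omega)
      rwa [show q - 1 - (bumpPtr V D l k - 1) = k by omega] at this

theorem exists_bump_eq_of_le {m : ℕ} (hm : m < l) {k : ℕ} (hk : bumpPtr V D l k ≤ m) :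
    ∃ k' < k, bump V D l k' = D m ∧ bumpPtr V D l k' = m + 1 := by
  induction k with
  | zero => rw [bumpPtr] at hk; omega
  | succ k ih =>
    by_cases h1 : bumpPtr V D l k ≤ m
    · obtain ⟨k', h2, h3⟩ := ih h1
      exact ⟨k', by omega, h3⟩
    · by_cases h : 0 < bumpPtr V D l k ∧ V k ≤ D (bumpPtr V D l k - 1)
      · rw [bumpPtr_succ_of_pos h] at hk
        have h2 : bumpPtr V D l k = m + 1 := by omega
        refine ⟨k, by omega, ?_, h2⟩
        rw [bump_of_pos h, h2, Nat.add_sub_cancel]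
      · rw [bumpPtr_succ_of_neg h] at hk
        omega

/-- All entries of the column get matched. -/
theorem exists_bump_eq {q : ℕ} (hl : l ≤ q) (hrow : ∀ i, i < l → V (q - 1 - i) ≤ D i) {m : ℕ}
    (hm : m < l) : ∃ k, k + m < q ∧ bump V D l k = D m := by
  have h1 := bumpPtr_add_le hl hrow le_rfl
  obtain ⟨k, h2, h3, h4⟩ := exists_bump_eq_of_le (V := V) (D := D) hm (k := q) (by omega)
  have h5 := bumpPtr_add_le hl hrow h2.le
  exact ⟨k, by omega, h3⟩

/-- The maximal run of consecutive matches that ends at step `k`. -/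
theorem exists_bump_run {k : ℕ} (h : 0 < bumpPtr V D l k ∧ V k ≤ D (bumpPtr V D l k - 1)) :
    ∃ p ≤ k, bumpPtr V D l k + p ≤ l ∧ (p = k → bumpPtr V D l k + p = l) ∧
      (p < k → D (bumpPtr V D l k - 1 + p) < V (k - p - 1)) := by
  induction k with
  | zero => exact ⟨0, le_rfl, le_rfl, fun _ => rfl, fun h => absurd h (lt_irrefl _)⟩
  | succ k ih =>
    by_cases h' : 0 < bumpPtr V D l k ∧ V k ≤ D (bumpPtr V D l k - 1)
    · obtain ⟨p, h1, h2, h3, h4⟩ := ih h'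
      rw [bumpPtr_succ_of_pos h'] at h ⊢
      refine ⟨p + 1, by omega, by omega, fun _ => ?_, fun _ => ?_⟩
      · have := h3 (by omega); omega
      · have := h4 (by omega)
        rwa [show bumpPtr V D l k - 1 - 1 + (p + 1) = bumpPtr V D l k - 1 + p by omega,
          show k + 1 - (p + 1) - 1 = k - p - 1 by omega]
    · rw [bumpPtr_succ_of_neg h'] at h ⊢
      refine ⟨0, by omega, bumpPtr_le _, fun h => by omega, fun _ => ?_⟩
      push Not at h'
      simpa using h' h.1

/-- Bumping with a column whose entries all occur has no effect. -/
theorem bump_eq_of_subset {q : ℕ} (hV : ∀ k, k + 1 < q → V (k + 1) < V k)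
    (hD : ∀ i, i + 1 < l → D i < D (i + 1)) (hsub : ∀ m, m < l → ∃ k, k < q ∧ V k = D m) {k : ℕ}
    (hk : k < q) : bump V D l k = V k := by
  have hDl : ∀ i j, i ≤ j → j < l → D i + j ≤ D j + i := fun i j => strict_add_sub_le hD
  have hVl : ∀ i j, i ≤ j → j < q → V j ≤ V i := by
    intro i j hij hj
    induction j, hij using Nat.le_induction with
    | base => exact le_rfl
    | succ j hij ih => exact (hV j hj).le.trans (ih (by omega))
  -- Invariant: the entries of `D` still unmatched all occur among the offers still to come. An
  -- accepted offer must therefore equal its partner.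
  have key : ∀ k, k ≤ q → ∀ m, m < bumpPtr V D l k → ∃ k', k ≤ k' ∧ k' < q ∧ V k' = D m := by
    intro k
    induction k with
    | zero =>
      intro _ m hm
      obtain ⟨k', h1, h2⟩ := hsub m hm
      exact ⟨k', Nat.zero_le _, h1, h2⟩
    | succ k ih =>
      intro hk m hm
      have hl := bumpPtr_le (V := V) (D := D) (l := l) k
      by_cases h : 0 < bumpPtr V D l k ∧ V k ≤ D (bumpPtr V D l k - 1)
      · rw [bumpPtr_succ_of_pos h] at hm
        obtain ⟨k', h1, h2, h3⟩ := ih (by omega) m (by omega)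
        have h4 := hDl m (bumpPtr V D l k - 1) (by omega) (by omega)
        refine ⟨k', ?_, h2, h3⟩
        rcases h1.eq_or_lt with rfl | h1
        · obtain ⟨k'', h5, h6, h7⟩ := ih (by omega) (bumpPtr V D l k - 1) (by omega)
          have := hVl k k'' h5 h6
          omega
        · exact h1
      · rw [bumpPtr_succ_of_neg h] at hm
        obtain ⟨k', h1, h2, h3⟩ := ih (by omega) m hm
        have h4 := hDl m (bumpPtr V D l k - 1) (by omega) (by omega)
        refine ⟨k', ?_, h2, h3⟩
        rcases h1.eq_or_lt with rfl | h1
        · push Not at h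
          have := h (by omega)
          omega
        · exact h1
  by_cases h : 0 < bumpPtr V D l k ∧ V k ≤ D (bumpPtr V D l k - 1)
  · rw [bump_of_pos h]
    obtain ⟨k', h1, h2, h3⟩ := key k hk.le (bumpPtr V D l k - 1) (by omega)
    have := hVl k k' h1 h2
    omega
  · exact bump_of_neg h

end Bump

/-! ### The right key, computed column by column -/

section Scan

variable {lam : YoungDiagram} (T : SemistandardYoungTableau lam) (j : ℕ)

/-- The values of all scans that start in column `j`, after `m` columns. -/
def scanVal : ℕ → ℕ → ℕ
  | 0 => fun _ => 0
  | m + 1 => bump (scanVal m) (fun i => T i (j + m)) (lam.colLen (j + m))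

/-- Exchange of loops: a scan runs through all columns, whereas `scanVal` treats all scans at one
column. The boxes of a column left unmarked by `k` scans are those left unmatched after `k` offers,
so both orders agree. -/
theorem foldl_scanStep (k m : ℕ) (h : ℕ → ℕ)
    (hh : ∀ c, c < m → h (j + c) =
      bumpPtr (scanVal T j c) (fun i => T i (j + c)) (lam.colLen (j + c)) k) :
    ((List.range' j m).foldl (scanStep T) (0, h)).1 = scanVal T j m k ∧
    (∀ c, c < m → ((List.range' j m).foldl (scanStep T) (0, h)).2 (j + c) =
      bumpPtr (scanVal T j c) (fun i => T i (j + c)) (lam.colLen (j + c)) (k + 1)) ∧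
    ∀ c, m ≤ c → ((List.range' j m).foldl (scanStep T) (0, h)).2 (j + c) = h (j + c) := by
  induction m with
  | zero => simp [scanVal]
  | succ m ih =>
    obtain ⟨h1, h2, h3⟩ := ih fun c hc => hh c (by omega)
    rw [List.range'_concat, List.foldl_append]
    simp only [one_mul, List.foldl_cons, List.foldl_nil]
    generalize (List.range' j m).foldl (scanStep T) (0, h) = s at h1 h2 h3
    have h4 := h3 m le_rfl
    rw [hh m (by omega)] at h4
    by_cases hc : 0 < bumpPtr (scanVal T j m) (fun i => T i (j + m)) (lam.colLen (j + m)) k ∧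
      scanVal T j m k ≤
        T (bumpPtr (scanVal T j m) (fun i => T i (j + m)) (lam.colLen (j + m)) k - 1) (j + m)
    · have hs : scanStep T s (j + m) =
          (T (s.2 (j + m) - 1) (j + m), Function.update s.2 (j + m) (s.2 (j + m) - 1)) := by
        rw [scanStep, if_pos (by rw [h4, h1]; exact hc)]
      rw [hs]
      refine ⟨?_, fun c hcm => ?_, fun c hcm => ?_⟩
      · simp only [h4]
        exact (bump_of_pos (D := fun i => T i (j + m)) hc).symm
      · rcases (show c ≤ m by omega).eq_or_lt with rfl | hlt
        · simp only [Function.update_self, h4]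
          exact (bumpPtr_succ_of_pos (D := fun i => T i (j + c)) hc).symm
        · simp only
          rw [Function.update_of_ne (by omega)]
          exact h2 c hlt
      · simp only
        rw [Function.update_of_ne (by omega)]
        exact h3 c (by omega)
    · have hs : scanStep T s (j + m) = s := by
        rw [scanStep, if_neg (by rw [h4, h1]; exact hc)]
      rw [hs]
      refine ⟨?_, fun c hcm => ?_, fun c hcm => h3 c (by omega)⟩
      · rw [h1]
        exact (bump_of_neg (D := fun i => T i (j + m)) hc).symm
      · rcases (show c ≤ m by omega).eq_or_lt with rfl | hlt
        · rw [h4]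
          exact (bumpPtr_succ_of_neg (D := fun i => T i (j + c)) hc).symm
        · exact h2 c hlt

theorem unmarked_eq (k : ℕ) (c : ℕ) (hc : c < lam.rowLen 0 - j) : unmarked T j k (j + c) =
    bumpPtr (scanVal T j c) (fun i => T i (j + c)) (lam.colLen (j + c)) k := by
  induction k generalizing c with
  | zero => rfl
  | succ k ih =>
    rw [unmarked, Function.iterate_succ_apply']
    exact (foldl_scanStep T j k _ _ fun c hc => ih c hc).2.1 c hc

theorem scanEntry_eq (i : ℕ) :
    scanEntry T i j = scanVal T j (lam.rowLen 0 - j) (lam.colLen j - 1 - i) :=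
  (foldl_scanStep T j _ _ _ fun c hc => unmarked_eq T j _ c hc).1

variable {T j}

theorem col_succ_lt {c i : ℕ} (hi : i + 1 < lam.colLen c) : T i c < T (i + 1) c :=
  T.col_strict (Nat.lt_succ_self i) (YoungDiagram.mem_iff_lt_colLen.2 hi)

/-- Each scan begins with the value `0`, which every box accepts, so the first column is read from
bottom to top. -/
theorem scanVal_one {k : ℕ} (hk : k < lam.colLen j) :
    scanVal T j 1 k = T (lam.colLen j - 1 - k) j := by
  have hptr : ∀ k, k ≤ lam.colLen j →
      bumpPtr (fun _ => 0) (fun i => T i j) (lam.colLen j) k = lam.colLen j - k := by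
    intro k hk
    induction k with
    | zero => rfl
    | succ k ih =>
      have h1 := ih (by omega)
      rw [bumpPtr_succ_of_pos ⟨by omega, Nat.zero_le _⟩, h1]
      omega
  have h1 := hptr k hk.le
  change bump (fun _ => 0) (fun i => T i j) (lam.colLen j) k = _
  rw [bump_of_pos ⟨by omega, Nat.zero_le _⟩, h1]
  exact congrArg (fun x => T x j) (by omega)

/-- The invariants of the scanning process. -/
theorem scanVal_invariant (m : ℕ) :
    (∀ k, k + 1 < lam.colLen j → scanVal T j (m + 1) (k + 1) < scanVal T j (m + 1) k) ∧
    (∀ i, i < lam.colLen (j + (m + 1)) →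
      scanVal T j (m + 1) (lam.colLen j - 1 - i) ≤ T i (j + (m + 1))) ∧
    (∀ k, k < lam.colLen j → T (lam.colLen j - 1 - k) j ≤ scanVal T j (m + 1) k) := by
  induction m with
  | zero =>
    refine ⟨fun k hk => ?_, fun i hi => ?_, fun k hk => (scanVal_one hk).ge⟩
    · rw [scanVal_one hk, scanVal_one (by omega)]
      have := col_succ_lt (T := T) (c := j) (i := lam.colLen j - 1 - (k + 1)) (by omega)
      rwa [show lam.colLen j - 1 - (k + 1) + 1 = lam.colLen j - 1 - k by omega] at this
    · have := lam.colLen_anti j (j + (0 + 1)) (by omega)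
      rw [scanVal_one (by omega), show lam.colLen j - 1 - (lam.colLen j - 1 - i) = i by omega]
      exact T.row_weak (by omega) (YoungDiagram.mem_iff_lt_colLen.2 hi)
  | succ m ih =>
    obtain ⟨h1, h2, h3⟩ := ih
    have hl := lam.colLen_anti j (j + (m + 1)) (by omega)
    have hanti : ∀ k, k + 1 < lam.colLen j →
        scanVal T j (m + 1 + 1) (k + 1) < scanVal T j (m + 1 + 1) k := fun k hk =>
      bump_succ_lt (D := fun i => T i (j + (m + 1))) h1 (fun i hi => col_succ_lt hi) hk
    refine ⟨hanti, fun i hi => ?_, fun k hk => (h3 k hk).trans (le_bump k)⟩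
    have hi' := lam.colLen_anti (j + (m + 1)) (j + (m + 1 + 1)) (by omega)
    -- The entry in row `i` is matched by an offer with `k + i < q`, hence no later than position `q
    -- - 1 - i`. Decrease bounds the value at that position by this entry, and the row condition of
    -- `T` passes the bound on to the next column.
    obtain ⟨k, h4, h5⟩ := exists_bump_eq hl h2 (show i < lam.colLen (j + (m + 1)) by omega)
    have h6 : ∀ a b, a ≤ b → b < lam.colLen j →
        scanVal T j (m + 1 + 1) b ≤ scanVal T j (m + 1 + 1) a := by
      intro a b hab hb
      induction b, hab using Nat.le_induction with
      | base => exact le_rfl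
      | succ b hab ih => exact (hanti b hb).le.trans (ih (by omega))
    refine (h6 k _ (by omega) (by omega)).trans ?_
    change bump _ _ _ k ≤ _
    rw [h5]
    exact T.row_weak (by omega) (YoungDiagram.mem_iff_lt_colLen.2 hi)

theorem le_scanEntry {i : ℕ} (hij : (i, j) ∈ lam) : T i j ≤ scanEntry T i j := by
  have hi := YoungDiagram.mem_iff_lt_colLen.1 hij
  have hj := YoungDiagram.mem_iff_lt_rowLen.1 hij
  have := lam.rowLen_anti 0 i (Nat.zero_le _)
  rw [scanEntry_eq, show lam.rowLen 0 - j = lam.rowLen 0 - j - 1 + 1 by omega]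
  have := (scanVal_invariant (T := T) (j := j) (lam.rowLen 0 - j - 1)).2.2
    (lam.colLen j - 1 - i) (by omega)
  rwa [show lam.colLen j - 1 - (lam.colLen j - 1 - i) = i by omega] at this

/-- If all columns after a column are contained in it, its entries survive the scans. -/
theorem exists_scanVal_eq_of_nested {d : ℕ}
    (hnest : ∀ c, j + d < c → ∀ i, i < lam.colLen c → ∃ i', i' < lam.colLen (j + d) ∧
      T i' (j + d) = T i c) (m : ℕ) (hm : d ≤ m) {i : ℕ} (hi : i < lam.colLen (j + d)) :
    ∃ k, k < lam.colLen j ∧ scanVal T j (m + 1) k = T i (j + d) := by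
  have hlen := lam.colLen_anti j (j + d) (by omega)
  induction m, hm using Nat.le_induction generalizing i with
  | base =>
    cases d with
    | zero =>
      simp only [add_zero] at hi ⊢
      refine ⟨lam.colLen j - 1 - i, by omega, ?_⟩
      rw [zero_add, scanVal_one (by omega)]
      exact congrArg (fun x => T x j) (by omega)
    | succ d =>
      obtain ⟨k, h4, h5⟩ := exists_bump_eq hlen (scanVal_invariant (T := T) (j := j) d).2.1 hi
      exact ⟨k, by omega, h5⟩
  | succ m hm ih =>
    obtain ⟨k, h1, h2⟩ := ih hi
    refine ⟨k, h1, Eq.trans ?_ h2⟩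
    refine bump_eq_of_subset (D := fun i => T i (j + (m + 1))) (scanVal_invariant m).1 (fun i hi => col_succ_lt hi)
      (fun i' hi' => ?_) h1
    obtain ⟨i'', h3, h4⟩ := hnest (j + (m + 1)) (by omega) i' hi'
    obtain ⟨k', h5, h6⟩ := ih h3
    exact ⟨k', h5, h6.trans h4⟩

theorem scanVal_eq_of_nested
    (hnest : ∀ c, j < c → ∀ i, i < lam.colLen c → ∃ i', i' < lam.colLen j ∧ T i' j = T i c)
    (m : ℕ) {k : ℕ} (hk : k < lam.colLen j) :
    scanVal T j (m + 1) k = T (lam.colLen j - 1 - k) j := by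
  induction m generalizing k with
  | zero => exact scanVal_one hk
  | succ m ih =>
    refine (bump_eq_of_subset (D := fun i => T i (j + (m + 1))) (scanVal_invariant m).1 (fun i hi => col_succ_lt hi)
      (fun i' hi' => ?_) hk).trans (ih hk)
    obtain ⟨i'', h3, h4⟩ := hnest (j + (m + 1)) (by omega) i' hi'
    refine ⟨lam.colLen j - 1 - i'', by omega, ?_⟩
    rw [ih (by omega), ← h4]
    exact congrArg (fun x => T x j) (by omega)

theorem scanEntry_eq_of_nested
    (hnest : ∀ c, j < c → ∀ i, i < lam.colLen c → ∃ i', i' < lam.colLen j ∧ T i' j = T i c)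
    {i : ℕ} (hij : (i, j) ∈ lam) : scanEntry T i j = T i j := by
  have hi := YoungDiagram.mem_iff_lt_colLen.1 hij
  have hj := YoungDiagram.mem_iff_lt_rowLen.1 hij
  have := lam.rowLen_anti 0 i (Nat.zero_le _)
  rw [scanEntry_eq, show lam.rowLen 0 - j = lam.rowLen 0 - j - 1 + 1 by omega,
    scanVal_eq_of_nested hnest _ (by omega)]
  exact congrArg (fun x => T x j) (by omega)

end Scan

/-! ### Bumping respects the key of an avoiding permutation -/

section Avoiding

variable {n : ℕ} {R : Finset ℕ}

/-- The number of the first `q` values of `π` that are at least `t`. -/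
def prefixCount (π : Equiv.Perm (Fin n)) (q t : ℕ) : ℕ :=
  (Finset.univ.filter fun a : Fin n => (a : ℕ) < q ∧ t ≤ (π a : ℕ)).card

/-- With `le_sortedPrefix_of_prefixCount`, this trades an entrywise bound by a sorted prefix for a
lower bound on a count, which can be followed through bumping. -/
theorem sub_le_prefixCount (π : Equiv.Perm (Fin n)) {q t i : ℕ} (hq : q ≤ n)
    (ht : t ≤ sortedPrefix π q i) : q - i ≤ prefixCount π q t := by
  rw [prefixCount, ← card_filter_sortedPrefix π hq (t ≤ ·), ← Nat.card_Ico i q]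
  refine Finset.card_le_card fun k hk => ?_
  rw [Finset.mem_Ico] at hk
  rw [Finset.mem_filter, Finset.mem_range]
  refine ⟨hk.2, ht.trans ?_⟩
  rcases hk.1.eq_or_lt with rfl | h
  · exact le_rfl
  · exact (sortedPrefix_strictMono π hq h hk.2).le

theorem le_sortedPrefix_of_prefixCount (π : Equiv.Perm (Fin n)) {q t i : ℕ} (hq : q ≤ n)
    (hi : i < q) (ht : q - i ≤ prefixCount π q t) : t ≤ sortedPrefix π q i := by
  rw [prefixCount, ← card_filter_sortedPrefix π hq (t ≤ ·)] at ht
  by_contra hlt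
  have : ((Finset.range q).filter fun k => t ≤ sortedPrefix π q k) ⊆ Finset.Ioo i q := by
    intro k hk
    rw [Finset.mem_filter, Finset.mem_range] at hk
    rw [Finset.mem_Ioo]
    refine ⟨?_, hk.1⟩
    by_contra hle
    rcases (not_lt.1 hle).eq_or_lt with rfl | h
    · exact hlt hk.2
    · have := sortedPrefix_strictMono π hq h hi
      omega
  have := Finset.card_le_card this
  rw [Nat.card_Ioo] at this
  omega

theorem prefixCount_mono (π : Equiv.Perm (Fin n)) {q q' t : ℕ} (hq : q ≤ q') :
    prefixCount π q t ≤ prefixCount π q' t := by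
  refine Finset.card_le_card fun a => ?_
  simp only [Finset.mem_filter, Finset.mem_univ, true_and]
  exact fun h => ⟨h.1.trans_le hq, h.2⟩

/-- If an interval of values belongs to the prefix, it contributes its length. -/
theorem prefixCount_interval (π : Equiv.Perm (Fin n)) {q t s : ℕ} (hts : t ≤ s)
    (H : ∀ w, t ≤ w → w ≤ s → ∃ a : Fin n, (a : ℕ) < q ∧ (π a : ℕ) = w) :
    prefixCount π q (s + 1) + (s + 1 - t) ≤ prefixCount π q t := by
  have h1 : (Finset.Icc t s) ⊆
      (Finset.univ.filter fun a : Fin n => (a : ℕ) < q ∧ t ≤ (π a : ℕ) ∧ (π a : ℕ) ≤ s).image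
        fun a => (π a : ℕ) := by
    intro w hw
    rw [Finset.mem_Icc] at hw
    obtain ⟨a, h1, h2⟩ := H w hw.1 hw.2
    rw [Finset.mem_image]
    exact ⟨a, by simp [h1, h2, hw.1, hw.2], h2⟩
  have h2 := (Finset.card_le_card h1).trans Finset.card_image_le
  rw [Nat.card_Icc] at h2
  have h3 : Disjoint (Finset.univ.filter fun a : Fin n => (a : ℕ) < q ∧ s + 1 ≤ (π a : ℕ))
      (Finset.univ.filter fun a : Fin n => (a : ℕ) < q ∧ t ≤ (π a : ℕ) ∧ (π a : ℕ) ≤ s) := by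
    rw [Finset.disjoint_left]
    intro a
    simp only [Finset.mem_filter, Finset.mem_univ, true_and]
    omega
  have h4 : (Finset.univ.filter fun a : Fin n => (a : ℕ) < q ∧ s + 1 ≤ (π a : ℕ)) ∪
      (Finset.univ.filter fun a : Fin n => (a : ℕ) < q ∧ t ≤ (π a : ℕ) ∧ (π a : ℕ) ≤ s) ⊆
      Finset.univ.filter fun a : Fin n => (a : ℕ) < q ∧ t ≤ (π a : ℕ) := by
    intro a
    simp only [Finset.mem_filter, Finset.mem_univ, true_and, Finset.mem_union]
    omega
  have h5 := Finset.card_le_card h4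
  rw [Finset.card_union_of_disjoint h3] at h5
  rw [prefixCount, prefixCount]
  omega

/-- Bumping with a column bounded by a shorter prefix of an avoiding permutation respects the bound
by the longer prefix. -/
theorem lt_prefixCount_bump (hn : 1 ≤ n) (hR : R ⊆ Finset.Icc 1 (n - 1)) {π : Equiv.Perm (Fin n)}
    (hπ : ¬ Contains312 n R π) {h h' : ℕ} (hh : h' ≤ h) {V D : ℕ → ℕ}
    (hD : ∀ i, i + 1 < divider n R h' → D i < D (i + 1))
    (hrow : ∀ i, i < divider n R h' → V (divider n R h - 1 - i) ≤ D i)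
    (hDle : ∀ i, i < divider n R h' → D i ≤ sortedPrefix π (divider n R h') i)
    (hV : ∀ k, k < divider n R h → k < prefixCount π (divider n R h) (V k)) {k : ℕ}
    (hk : k < divider n R h) :
    k < prefixCount π (divider n R h) (bump V D (divider n R h') k) := by
  have hlq := divider_mono hn hR hh
  have hqn := divider_le hn hR h
  have hln := divider_le hn hR h'
  by_cases hc : 0 < bumpPtr V D (divider n R h') k ∧
      V k ≤ D (bumpPtr V D (divider n R h') k - 1)
  · rw [bump_of_pos hc]
    -- The run of matches ending at `k` uses `D m, ..., D (m + p)`. If it began with the first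
    -- offer, the bound on `D m` already suffices. Otherwise the offer before the run exceeded `D (m
    -- + p)`, which supplies `k - p` values of the longer prefix above `D (m + p)`.
    obtain ⟨p, h1, h2, h3, h4⟩ := exists_bump_run hc
    have h5 := bumpPtr_add_le hlq hrow hk.le
    obtain ⟨m, hm⟩ : ∃ m, bumpPtr V D (divider n R h') k = m + 1 :=
      ⟨bumpPtr V D (divider n R h') k - 1, by omega⟩
    simp only [hm, Nat.add_sub_cancel] at hc h2 h3 h4 h5 ⊢
    have h6 := sub_le_prefixCount π hln (hDle m (by omega))
    have h7 := prefixCount_mono π (t := D m) hlq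
    rcases h1.eq_or_lt with rfl | hpk
    · have := h3 rfl
      omega
    by_contra hle
    have h8 := h4 hpk
    have h9 := hV (k - p - 1) (by omega)
    have h10 : prefixCount π (divider n R h) (V (k - p - 1)) ≤
        prefixCount π (divider n R h) (D (m + p) + 1) := by
      refine Finset.card_le_card fun a => ?_
      simp only [Finset.mem_filter, Finset.mem_univ, true_and]
      omega
    have h11 := strict_add_sub_le hD (show m ≤ m + p by omega) (by omega)
    -- If the whole interval from `D m` to `D (m + p)` lay in the longer prefix, it would contribute
    -- the missing `p + 1` values. So some `w` of it is absent.
    obtain ⟨w, hw1, hw2, hw3⟩ : ∃ w, D m ≤ w ∧ w ≤ D (m + p) ∧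
        ∀ a : Fin n, (a : ℕ) < divider n R h → (π a : ℕ) ≠ w := by
      by_contra! hcon
      have := prefixCount_interval π (show D m ≤ D (m + p) by omega) hcon
      omega
    obtain ⟨a, ha1, ha2⟩ := exists_eq_sortedPrefix π hln (show m + p < divider n R h' by omega)
    have h12 := hDle (m + p) (by omega)
    have hwn : w < n := by have := (π a).2; omega
    -- The shorter prefix contains a value at least `w`. If a later value of the longer prefix were
    -- at most `w`, avoidance would bring `w` into the longer prefix.
    have hnew : ∀ b : Fin n, divider n R h' ≤ b → (b : ℕ) < divider n R h → w < π b := by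
      intro b hb1 hb2
      by_contra hle
      obtain ⟨g, -, hg⟩ := exists_inCarrel (R := R) b
      have hg1 := carrel_le_of_lt hn hR hb1 hg.2
      have hg2 := carrel_le_of_lt hn hR hg.1 hb2
      have hg3 := divider_mono hn hR (show h' ≤ g by omega)
      have hg4 := divider_mono hn hR (show g + 1 ≤ h by omega)
      obtain ⟨c, hc⟩ := π.surjective ⟨w, hwn⟩
      have hc' : (π c : ℕ) = w := by rw [hc]
      refine hw3 c ?_ hc'
      have := lt_divider_of_avoiding hn hR hπ (h := g) (a := a) (b := b) (c := c) (by omega) hg.2 hg.1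
        (by rw [Fin.le_def]; omega) (by rw [Fin.le_def]; omega)
      omega
    -- Values of the longer prefix below `D m` are consequently old, and at most `m` old values are
    -- that small. At least `q - m > k` values of the longer prefix remain, contradicting the
    -- assumption.
    have h13 : (Finset.univ.filter fun b : Fin n => (b : ℕ) < divider n R h).card ≤
        (Finset.univ.filter fun b : Fin n => (b : ℕ) < divider n R h' ∧ ¬ D m ≤ (π b : ℕ)).card +
        prefixCount π (divider n R h) (D m) := by
      refine (Finset.card_le_card fun b => ?_).trans (Finset.card_union_le _ _)
      simp only [Finset.mem_filter, Finset.mem_univ, true_and, Finset.mem_union]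
      intro hb
      by_cases hb' : D m ≤ (π b : ℕ)
      · exact Or.inr ⟨hb, hb'⟩
      · refine Or.inl ⟨?_, hb'⟩
        by_contra hb''
        have := hnew b (by omega) hb
        omega
    have h14 : (Finset.univ.filter fun b : Fin n =>
          (b : ℕ) < divider n R h' ∧ ¬ D m ≤ (π b : ℕ)).card +
        prefixCount π (divider n R h') (D m) ≤ divider n R h' := by
      rw [prefixCount, ← Finset.card_union_of_disjoint]
      · refine (Finset.card_le_card fun b => ?_).trans (card_filter_coe_lt hln).le
        simp only [Finset.mem_filter, Finset.mem_univ, true_and, Finset.mem_union]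
        omega
      · rw [Finset.disjoint_left]
        intro b
        simp only [Finset.mem_filter, Finset.mem_univ, true_and]
        omega
    rw [card_filter_coe_lt hqn] at h13
    omega
  · rw [bump_of_neg hc]
    exact hV k hk

end Avoiding

/-! ### Row bound sets, Demazure sets and keys -/

section Shapes

variable {n : ℕ} {R : Finset ℕ} {lam : YoungDiagram}

theorem colLen_le (hlen : lam.colLen 0 ≤ n) (j : ℕ) : lam.colLen j ≤ n :=
  (lam.colLen_anti 0 j (Nat.zero_le _)).trans hlen

theorem exists_divider_eq_colLen (hlen : lam.colLen 0 ≤ n) (hcol : columnLengths n lam = R) (j : ℕ) :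
    ∃ h, divider n R h = lam.colLen j := by
  have hj := colLen_le hlen j
  rcases Nat.eq_zero_or_pos (lam.colLen j) with h0 | h0
  · exact ⟨0, by rw [divider_zero, h0]⟩
  rcases hj.eq_or_lt with h1 | h1
  · exact ⟨R.card + 1, by rw [divider_of_card_lt (by omega), h1]⟩
  · have : lam.colLen j ∈ R := by
      rw [← hcol, columnLengths, Finset.mem_filter, Finset.mem_image]
      exact ⟨⟨(0, j), (YoungDiagram.mem_cells _).2 (YoungDiagram.mem_iff_lt_colLen.2 h0), rfl⟩, h1⟩
    obtain ⟨h, -, -, e⟩ := exists_divider_eq (n := n) this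
    exact ⟨h, e⟩

theorem exists_colLen_eq (hcol : columnLengths n lam = R) {q : ℕ} (hq : q ∈ R) :
    ∃ j, lam.colLen j = q := by
  rw [← hcol, columnLengths, Finset.mem_filter, Finset.mem_image] at hq
  obtain ⟨⟨c, -, e⟩, -⟩ := hq
  exact ⟨c.2, e⟩

theorem exists_tableau (f : ℕ → ℕ → ℕ)
    (hrow : ∀ i j1 j2, j1 < j2 → i < lam.colLen j2 → f i j1 ≤ f i j2)
    (hstrict : ∀ i1 i2 j, i1 < i2 → i2 < lam.colLen j → f i1 j < f i2 j) :
    ∃ T : SemistandardYoungTableau lam, ∀ i j, (i, j) ∈ lam → T i j = f i j := by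
  classical
  refine ⟨⟨fun i j => if (i, j) ∈ lam then f i j else 0, fun {i j1 j2} hj hmem => ?_,
    fun {i1 i2 j} hi hmem => ?_, fun {i j} h => if_neg h⟩, fun i j h => if_pos h⟩
  · rw [if_pos hmem, if_pos (lam.up_left_mem le_rfl hj.le hmem)]
    exact hrow i j1 j2 hj (YoungDiagram.mem_iff_lt_colLen.1 hmem)
  · rw [if_pos hmem, if_pos (lam.up_left_mem hi.le le_rfl hmem)]
    exact hstrict i1 i2 j hi (YoungDiagram.mem_iff_lt_colLen.1 hmem)

theorem exists_keyTableau (hlen : lam.colLen 0 ≤ n) (π : Equiv.Perm (Fin n)) :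
    ∃ Y ∈ tableaux n lam, ∀ i j, (i, j) ∈ lam → Y i j = keyEntry n lam π i j := by
  obtain ⟨Y, hY⟩ := exists_tableau (lam := lam) (fun i j => sortedPrefix π (lam.colLen j) i)
    (fun i j1 j2 hj hi => sortedPrefix_anti π (colLen_le hlen _) (lam.colLen_anti _ _ hj.le) hi)
    (fun i1 i2 j hi hj => sortedPrefix_strictMono π (colLen_le hlen _) hi hj)
  refine ⟨Y, fun i j hij => ?_, hY⟩
  rw [hY i j hij]
  exact sortedPrefix_lt π (colLen_le hlen _) (YoungDiagram.mem_iff_lt_colLen.1 hij)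

/-- The tableaux that are entrywise at most the key of `π`. -/
def belowKey (n : ℕ) (lam : YoungDiagram) (π : Equiv.Perm (Fin n)) :
    Set (SemistandardYoungTableau lam) :=
  {T | T ∈ tableaux n lam ∧ ∀ i j, (i, j) ∈ lam → T i j ≤ keyEntry n lam π i j}

/-- The columns of a tableau increase strictly, so respecting the row bounds means lying below the
largest column that respects them. -/
theorem mem_rowBoundSet_iff (hlen : lam.colLen 0 ≤ n) {β : Fin n → Fin n} (hβ : β ∈ upperTuples n)
    {T : SemistandardYoungTableau lam} : T ∈ rowBoundSet n lam β ↔ T ∈ tableaux n lam ∧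
      ∀ i j, (i, j) ∈ lam → T i j ≤ colMax (extend β) (lam.colLen j) i := by
  refine and_congr_right fun _ => ⟨fun H i j hij => ?_, fun H i j hij => ?_⟩
  · refine le_colMax (c := fun i => T i j) (fun i hi => col_succ_lt hi) (fun i hi => ?_)
      (YoungDiagram.mem_iff_lt_colLen.1 hij)
    have hin : i < n := hi.trans_le (colLen_le hlen j)
    rw [extend_of_lt β hin]
    exact H ⟨i, hin⟩ j (YoungDiagram.mem_iff_lt_colLen.2 hi)
  · have := colMax_le (le_extend hβ) (YoungDiagram.mem_iff_lt_colLen.1 hij)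
    rw [extend_coe] at this
    exact (H i j hij).trans this

theorem rowBoundSet_eq_belowKey (hlen : lam.colLen 0 ≤ n) (hcol : columnLengths n lam = R)
    {β : Fin n → Fin n} (hβ : β ∈ upperTuples n) {π : Equiv.Perm (Fin n)} (hm : Matches n R β π) :
    rowBoundSet n lam β = belowKey n lam π := by
  ext T
  rw [mem_rowBoundSet_iff hlen hβ]
  refine and_congr_right fun _ => forall₂_congr fun i j => forall_congr' fun hij => ?_
  obtain ⟨h, e⟩ := exists_divider_eq_colLen hlen hcol j
  have := hm h i (by rw [e]; exact YoungDiagram.mem_iff_lt_colLen.1 hij)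
  rw [e] at this
  rw [this]
  rfl

theorem demazureSet_subset_belowKey (π : Equiv.Perm (Fin n)) :
    demazureSet n lam π ⊆ belowKey n lam π :=
  fun _ hT => ⟨hT.1, fun i j hij => (le_scanEntry hij).trans (hT.2 i j hij)⟩

/-- The count form of the bound by the key holds in the first column and survives each further
column by `lt_prefixCount_bump`. After the last column it is the required bound on the right key. -/
theorem demazureSet_eq_belowKey (hn : 1 ≤ n) (hR : R ⊆ Finset.Icc 1 (n - 1))
    (hlen : lam.colLen 0 ≤ n) (hcol : columnLengths n lam = R)
    {π : Equiv.Perm (Fin n)} (hπ : ¬ Contains312 n R π) :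
    demazureSet n lam π = belowKey n lam π := by
  refine (demazureSet_subset_belowKey π).antisymm fun T hT => ⟨hT.1, fun i j hij => ?_⟩
  have hi := YoungDiagram.mem_iff_lt_colLen.1 hij
  have hj := YoungDiagram.mem_iff_lt_rowLen.1 hij
  have := lam.rowLen_anti 0 i (Nat.zero_le _)
  obtain ⟨h, e⟩ := exists_divider_eq_colLen hlen hcol j
  have hle : ∀ j i, i < lam.colLen j → T i j ≤ sortedPrefix π (lam.colLen j) i := fun j i hi =>
    hT.2 i j (YoungDiagram.mem_iff_lt_colLen.2 hi)
  have key : ∀ m k, k < lam.colLen j →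
      k < prefixCount π (lam.colLen j) (scanVal T j (m + 1) k) := by
    intro m
    induction m with
    | zero =>
      intro k hk
      rw [scanVal_one hk]
      have := sub_le_prefixCount π (colLen_le hlen j) (hle j (lam.colLen j - 1 - k) (by omega))
      omega
    | succ m ih =>
      intro k hk
      obtain ⟨h', e'⟩ := exists_divider_eq_colLen hlen hcol (j + (m + 1))
      by_cases hh : h' ≤ h
      · have := lt_prefixCount_bump hn hR hπ hh (V := scanVal T j (m + 1))
          (D := fun i => T i (j + (m + 1)))
        rw [e, e'] at this
        exact this (fun i hi => col_succ_lt hi) (scanVal_invariant m).2.1 (hle _) ih hk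
      -- Divider indices can be out of order for a column farther right only when the two lengths
      -- agree; the index of column `j` then serves for both.
      · have h1 := divider_mono hn hR (not_le.1 hh).le
        have h2 := lam.colLen_anti j (j + (m + 1)) (by omega)
        have h3 : divider n R h' = divider n R h := by omega
        have := lt_prefixCount_bump hn hR hπ le_rfl (h := h) (V := scanVal T j (m + 1))
          (D := fun i => T i (j + (m + 1)))
        rw [← h3, e', show lam.colLen (j + (m + 1)) = lam.colLen j by omega] at this
        change k < prefixCount π _ (bump _ _ (lam.colLen (j + (m + 1))) k)
        rw [show lam.colLen (j + (m + 1)) = lam.colLen j by omega]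
        refine this (fun i hi => col_succ_lt (by omega)) (fun i hi =>
          (scanVal_invariant m).2.1 i (by omega)) (fun i hi => ?_) ih hk
        have := hle (j + (m + 1)) i (by omega)
        rwa [show lam.colLen (j + (m + 1)) = lam.colLen j by omega] at this
  rw [scanEntry_eq, show lam.rowLen 0 - j = lam.rowLen 0 - j - 1 + 1 by omega]
  refine le_sortedPrefix_of_prefixCount π (colLen_le hlen j) hi ?_
  have := key (lam.rowLen 0 - j - 1) (lam.colLen j - 1 - i) (by omega)
  omega

/-- The columns of a key are nested, so bumping with later columns changes nothing: a key is its own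
right key. -/
theorem scanEntry_keyTableau (hlen : lam.colLen 0 ≤ n) {π : Equiv.Perm (Fin n)}
    {Y : SemistandardYoungTableau lam} (hY : ∀ i j, (i, j) ∈ lam → Y i j = keyEntry n lam π i j)
    {i j : ℕ} (hij : (i, j) ∈ lam) : scanEntry Y i j = keyEntry n lam π i j := by
  rw [← hY i j hij]
  refine scanEntry_eq_of_nested (fun c hc i hi => ?_) hij
  rw [hY i c (YoungDiagram.mem_iff_lt_colLen.2 hi)]
  obtain ⟨a, h1, h2⟩ := exists_eq_sortedPrefix π (colLen_le hlen c) hi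
  obtain ⟨i', h3, h4⟩ := exists_sortedPrefix_eq π (colLen_le hlen j)
    (h1.trans_le (lam.colLen_anti j c hc.le))
  refine ⟨i', h3, ?_⟩
  rw [hY i' j (YoungDiagram.mem_iff_lt_colLen.2 h3)]
  exact h4.trans h2

/-- The keys in a set of Demazure tableaux. -/
theorem keyTableau_mem_demazureSet_iff (hlen : lam.colLen 0 ≤ n) {π σ : Equiv.Perm (Fin n)}
    {Y : SemistandardYoungTableau lam} (hYt : Y ∈ tableaux n lam)
    (hY : ∀ i j, (i, j) ∈ lam → Y i j = keyEntry n lam π i j) :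
    Y ∈ demazureSet n lam σ ↔
      ∀ i j, (i, j) ∈ lam → keyEntry n lam π i j ≤ keyEntry n lam σ i j := by
  constructor
  · exact fun H i j hij => scanEntry_keyTableau hlen hY hij ▸ H.2 i j hij
  · exact fun H => ⟨hYt, fun i j hij => (scanEntry_keyTableau hlen hY hij).trans_le (H i j hij)⟩

theorem rPermutation_eq_of_keyEntry_eq (hn : 1 ≤ n) (hR : R ⊆ Finset.Icc 1 (n - 1))
    (hcol : columnLengths n lam = R) {π σ : Equiv.Perm (Fin n)}
    (hπ : π ∈ rPermutations n R) (hσ : σ ∈ rPermutations n R)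
    (H : ∀ i j, (i, j) ∈ lam → keyEntry n lam π i j = keyEntry n lam σ i j) : π = σ := by
  refine rPermutation_ext hn hR hπ hσ fun q hq i hi => ?_
  obtain ⟨j, rfl⟩ := exists_colLen_eq hcol hq
  exact H i j (YoungDiagram.mem_iff_lt_colLen.2 hi)

/-- Each Demazure set contains the key of its permutation, and containing a key is a comparison of
keys. Equal sets thus give equal keys. -/
theorem demazureSet_injOn (hn : 1 ≤ n) (hR : R ⊆ Finset.Icc 1 (n - 1))
    (hlen : lam.colLen 0 ≤ n) (hcol : columnLengths n lam = R) :
    Set.InjOn (demazureSet n lam) (rPermutations n R) := by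
  intro π hπ σ hσ H
  obtain ⟨Y, hYt, hY⟩ := exists_keyTableau hlen π
  obtain ⟨Z, hZt, hZ⟩ := exists_keyTableau hlen σ
  refine rPermutation_eq_of_keyEntry_eq hn hR hcol hπ hσ fun i j hij => le_antisymm ?_ ?_
  · refine (keyTableau_mem_demazureSet_iff hlen hYt hY).1 ?_ i j hij
    rw [← H, keyTableau_mem_demazureSet_iff hlen hYt hY]
    exact fun _ _ _ => le_rfl
  · refine (keyTableau_mem_demazureSet_iff hlen hZt hZ).1 ?_ i j hij
    rw [H, keyTableau_mem_demazureSet_iff hlen hZt hZ]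
    exact fun _ _ _ => le_rfl

/-- For a permutation that is not avoiding, some tableau below its key has a right key that is
not. -/
theorem demazureSet_ne_belowKey (hn : 1 ≤ n) (hR : R ⊆ Finset.Icc 1 (n - 1))
    (hlen : lam.colLen 0 ≤ n) (hcol : columnLengths n lam = R)
    {π : Equiv.Perm (Fin n)} (hπ : Contains312 n R π) :
    demazureSet n lam π ≠ belowKey n lam π := by
  obtain ⟨h, h1, h2, a, b, c, ha, hb1, hb2, hc, hba, hbc, hca⟩ := hπ
  obtain ⟨j0, hj0⟩ := exists_colLen_eq hcol (divider_mem (n := n) (R := R) (h := h + 1) (by omega) h2)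
  obtain ⟨j1, hj1⟩ := exists_colLen_eq hcol (divider_mem (n := n) (R := R) (h := h) h1 (by omega))
  have hlt := divider_lt_succ hn hR (show h ≤ R.card by omega)
  have hj : j0 < j1 := by
    by_contra hle
    have := lam.colLen_anti j1 j0 (not_lt.1 hle)
    omega
  rw [Fin.lt_def] at hba hbc hca
  -- The test tableau takes columns of length at least `q_{h+1}` from the key of `π` and the shorter
  -- ones from the key of `π'`, where `π_a` is replaced by the smaller value `π_c`.
  let π' : Equiv.Perm (Fin n) := (Equiv.swap a c).trans π
  have hπ'a : π' a = π c := by simp [π']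
  have hπ' : ∀ x : Fin n, x ≠ a → x ≠ c → π' x = π x := fun x hxa hxc => by
    simp [π', Equiv.swap_apply_of_ne_of_ne hxa hxc]
  have hsmall : ∀ j, ¬ divider n R (h + 1) ≤ lam.colLen j → lam.colLen j ≤ divider n R h := by
    intro j hj
    obtain ⟨g, e⟩ := exists_divider_eq_colLen hlen hcol j
    rw [← e] at hj ⊢
    refine divider_mono hn hR ?_
    by_contra hg
    exact hj (divider_mono hn hR (show h + 1 ≤ g by omega))
  let f : ℕ → ℕ → ℕ := fun i j => if divider n R (h + 1) ≤ lam.colLen j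
    then sortedPrefix π (lam.colLen j) i else sortedPrefix π' (lam.colLen j) i
  obtain ⟨T, hT⟩ := exists_tableau (lam := lam) f (fun i j j' hjj hi => by
    have hq := colLen_le hlen (lam := lam) j
    have hqq := lam.colLen_anti j j' hjj.le
    simp only [f]
    by_cases c2 : divider n R (h + 1) ≤ lam.colLen j'
    · rw [if_pos c2, if_pos (c2.trans hqq)]
      exact sortedPrefix_anti π hq hqq hi
    · rw [if_neg c2]
      have h3 := hsmall j' c2
      split_ifs with c1
      -- Rows stay weakly increasing where the two kinds of columns meet: the new value `π_c` at
      -- position `a` is compensated by `π_b < π_c`, and position `b` belongs only to the longer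
      -- prefix.
      · refine sortedPrefix_le_sortedPrefix π hq (hqq.trans hq) (fun v => ?_) hi
        refine Finset.card_le_card_of_injOn (fun x => if x = a then b else x) (fun x hx => ?_)
          (fun x hx y hy hxy => ?_)
        · simp only [Finset.coe_filter, Finset.mem_univ, true_and, Set.mem_ofPred_eq] at hx ⊢
          split_ifs with hxa
          · subst hxa
            rw [hπ'a] at hx
            exact ⟨by omega, by omega⟩
          · rw [hπ' x hxa (fun hxc => by subst hxc; omega)] at hx
            exact ⟨by omega, hx.2⟩
        · simp only [Finset.coe_filter, Finset.mem_univ, true_and, Set.mem_ofPred_eq] at hx hy hxy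
          split_ifs at hxy with e1 e2 e2
          · rw [e1, e2]
          · subst hxy; omega
          · subst hxy; omega
          · exact hxy
      · exact sortedPrefix_anti π' hq hqq hi)
    (fun i1 i2 j hi hj => by
      simp only [f]
      split_ifs
      · exact sortedPrefix_strictMono π (colLen_le hlen _) hi hj
      · exact sortedPrefix_strictMono π' (colLen_le hlen _) hi hj)
  have hTb : T ∈ belowKey n lam π := by
    have hle : ∀ i j, (i, j) ∈ lam → T i j ≤ keyEntry n lam π i j := by
      intro i j hij
      have hi := YoungDiagram.mem_iff_lt_colLen.1 hij
      rw [hT i j hij]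
      simp only [f]
      split_ifs with c1
      · exact le_rfl
      · have h3 := hsmall j c1
        refine sortedPrefix_le_sortedPrefix π' (colLen_le hlen j) (colLen_le hlen j)
          (fun v => Finset.card_le_card fun x => ?_) hi
        simp only [Finset.mem_filter, Finset.mem_univ, true_and]
        rintro ⟨hx1, hx2⟩
        refine ⟨hx1, ?_⟩
        by_cases hxa : x = a
        · subst hxa; rw [hπ'a]; omega
        · rwa [hπ' x hxa (fun hxc => by subst hxc; omega)]
    refine ⟨fun i j hij => (hle i j hij).trans_lt ?_, hle⟩
    exact sortedPrefix_lt π (colLen_le hlen _) (YoungDiagram.mem_iff_lt_colLen.1 hij)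
  intro heq
  rw [← heq] at hTb
  have hj1row : j1 < lam.rowLen 0 := by
    rw [← YoungDiagram.mem_iff_lt_rowLen, YoungDiagram.mem_iff_lt_colLen]
    omega
  obtain ⟨d, rfl⟩ := Nat.exists_eq_add_of_lt hj
  have hT1 : ∀ c, j0 + (d + 1) ≤ c → ∀ i, i < lam.colLen c →
      T i c = sortedPrefix π' (lam.colLen c) i := by
    intro c hc i hi
    have := lam.colLen_anti _ _ hc
    rw [add_assoc] at hj1
    rw [hT i c (YoungDiagram.mem_iff_lt_colLen.2 hi)]
    simp only [f]
    rw [if_neg (by omega)]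
  rw [add_assoc] at hj1 hj1row
  obtain ⟨i, hi, ei⟩ := exists_sortedPrefix_eq π' (colLen_le hlen (j0 + (d + 1))) (a := a) (by omega)
  rw [hπ'a] at ei
  -- All columns after the first of the nested ones are contained in it, so its value `π_c` persists
  -- as a final scan value for the column of length `q_{h+1}`.
  obtain ⟨k, hk, ek⟩ := exists_scanVal_eq_of_nested (T := T) (j := j0) (d := d + 1)
    (fun c hc i hi => by
      have hcc := lam.colLen_anti _ _ hc.le
      rw [hT1 c hc.le i hi]
      obtain ⟨x, h3, h4⟩ := exists_eq_sortedPrefix π' (colLen_le hlen c) hi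
      obtain ⟨i', h5, h6⟩ := exists_sortedPrefix_eq π' (colLen_le hlen (j0 + (d + 1)))
        (h3.trans_le hcc)
      exact ⟨i', h5, by rw [hT1 _ le_rfl i' h5, h6, h4]⟩)
    (lam.rowLen 0 - j0 - 1) (by omega) hi
  rw [hT1 _ le_rfl i hi, ei] at ek
  have h5 := (scanVal_invariant (T := T) (j := j0) (lam.rowLen 0 - j0 - 1)).2.2 k hk
  have hmem : (lam.colLen j0 - 1 - k, j0) ∈ lam := YoungDiagram.mem_iff_lt_colLen.2 (by omega)
  have h6 := hTb.2 _ _ hmem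
  rw [scanEntry_eq, show lam.rowLen 0 - j0 = lam.rowLen 0 - j0 - 1 + 1 by omega,
    show lam.colLen j0 - 1 - (lam.colLen j0 - 1 - k) = k by omega, ek] at h6
  rw [hT _ _ hmem, ek] at h5
  simp only [f] at h5
  rw [if_pos hj0.ge] at h5
  -- This final value lies between the key entry, as an entry of `T`, and the key entry, as the
  -- bound on the right key. Then `π_c` would be among the first `q_{h+1}` values of `π`.
  obtain ⟨x, h7, h8⟩ := exists_eq_sortedPrefix π (colLen_le hlen j0)
    (show lam.colLen j0 - 1 - k < lam.colLen j0 by omega)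
  have h9 : π x = π c := Fin.ext (h8.trans (le_antisymm h5 h6))
  have := congrArg Fin.val (π.injective h9)
  omega

/-- A set of Demazure tableaux that is a row bound set comes from an avoiding permutation. -/
theorem avoiding_of_rowBoundSet_eq (hn : 1 ≤ n) (hR : R ⊆ Finset.Icc 1 (n - 1))
    (hlen : lam.colLen 0 ≤ n) (hcol : columnLengths n lam = R) {β : Fin n → Fin n}
    {π : Equiv.Perm (Fin n)} (hπ : π ∈ rPermutations n R)
    (H : rowBoundSet n lam β = demazureSet n lam π) : π ∈ avoidingPermutations n R := by
  refine ⟨hπ, fun hcon => demazureSet_ne_belowKey hn hR hlen hcol hcon ?_⟩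
  refine (demazureSet_subset_belowKey π).antisymm fun T hT => ?_
  -- A row bound set is closed under entrywise decrease. Containing the key, it contains everything
  -- below the key.
  obtain ⟨Y, hYt, hY⟩ := exists_keyTableau hlen π
  have hYD : Y ∈ demazureSet n lam π :=
    (keyTableau_mem_demazureSet_iff hlen hYt hY).2 fun _ _ _ => le_rfl
  rw [← H] at hYD ⊢
  refine ⟨hT.1, fun i j hij => ((hT.2 i j hij).trans_eq (hY i j hij).symm).trans (hYD.2 i j hij)⟩

end Shapes

/-! ### Contents, and recovering keys from polynomials -/

section Weights

variable {n : ℕ} {R : Finset ℕ} {lam : YoungDiagram}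

theorem coeff_sum_monomial {ι σ : Type*} [DecidableEq σ] (s : Finset ι) (f : ι → σ →₀ ℕ)
    (m : σ →₀ ℕ) : MvPolynomial.coeff m (∑ i ∈ s, MvPolynomial.monomial (f i) (1 : ℤ)) =
      (s.filter fun i => f i = m).card := by
  rw [MvPolynomial.coeff_sum]
  simp [MvPolynomial.coeff_monomial, Finset.sum_boole]

/-- The content of a tableau: how often each value occurs. -/
noncomputable def content (n : ℕ) (T : SemistandardYoungTableau lam) : Fin n →₀ ℕ :=
  Finsupp.equivFunOnFinite.symm fun k => (lam.cells.filter fun c => T c.1 c.2 = k).card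

theorem content_apply (T : SemistandardYoungTableau lam) (k : Fin n) :
    content n T k = (lam.cells.filter fun c => T c.1 c.2 = k).card := rfl

theorem weight_eq (T : SemistandardYoungTableau lam) :
    weight n lam T = MvPolynomial.monomial (content n T) 1 := by
  rw [MvPolynomial.monomial_eq, Finsupp.prod_fintype _ _ fun _ => pow_zero _]
  simp [weight, content_apply]

theorem card_cells_filter (P : ℕ → Prop) [DecidablePred P] (T : SemistandardYoungTableau lam) :
    (lam.cells.filter fun c => P (T c.1 c.2)).card =
      ∑ j ∈ Finset.range (lam.rowLen 0),
        ((Finset.range (lam.colLen j)).filter fun i => P (T i j)).card := by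
  rw [Finset.card_eq_sum_card_fiberwise (f := Prod.snd) (t := Finset.range (lam.rowLen 0))]
  · refine Finset.sum_congr rfl fun j _ => ?_
    symm
    refine Finset.card_bij (fun i _ => (i, j)) (fun i hi => ?_) (fun i _ i' _ h => ?_)
      (fun c hc => ?_)
    · rw [Finset.mem_filter, Finset.mem_range] at hi
      simp only [Finset.mem_filter, YoungDiagram.mem_cells, YoungDiagram.mem_iff_lt_colLen,
        and_true]
      exact hi
    · exact (Prod.mk.inj h).1
    · obtain ⟨i, j'⟩ := c
      simp only [Finset.mem_filter, YoungDiagram.mem_cells, YoungDiagram.mem_iff_lt_colLen] at hc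
      obtain ⟨hc, rfl⟩ := hc
      exact ⟨i, by simpa using hc, rfl⟩
  · intro c hc
    simp only [Finset.coe_filter, YoungDiagram.mem_cells, Set.mem_ofPred_eq] at hc
    have h1 := YoungDiagram.mem_iff_lt_rowLen.1 (show (c.1, c.2) ∈ lam from hc.1)
    have := lam.rowLen_anti 0 c.1 (Nat.zero_le _)
    simp only [Finset.coe_range, Set.mem_Iio]
    omega

theorem card_cells_filter_mem (T : SemistandardYoungTableau lam) (S : Finset (Fin n)) :
    (lam.cells.filter fun c => ∃ v ∈ S, (v : ℕ) = T c.1 c.2).card = ∑ v ∈ S, content n T v := by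
  have : (lam.cells.filter fun c => ∃ v ∈ S, (v : ℕ) = T c.1 c.2) =
      S.biUnion fun v => lam.cells.filter fun c => T c.1 c.2 = v := by
    ext c
    simp only [Finset.mem_filter, Finset.mem_biUnion]
    constructor
    · rintro ⟨h1, v, h2, h3⟩
      exact ⟨v, h2, h1, h3.symm⟩
    · rintro ⟨v, h2, h1, h3⟩
      exact ⟨h1, v, h2, h3.symm⟩
  rw [this, Finset.card_biUnion]
  · rfl
  · intro v _ w _ hvw
    rw [Function.onFun, Finset.disjoint_left]
    intro c
    simp only [Finset.mem_filter]
    rintro ⟨-, h1⟩ ⟨-, h2⟩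
    exact hvw (Fin.ext (h1.symm.trans h2))

/-- The key of a permutation is the only tableau with its content. -/
theorem eq_keyTableau_of_content (hlen : lam.colLen 0 ≤ n) {π : Equiv.Perm (Fin n)}
    {T Y : SemistandardYoungTableau lam}
    (hY : ∀ i j, (i, j) ∈ lam → Y i j = keyEntry n lam π i j)
    (H : content n T = content n Y) : T = Y := by
  classical
  refine SemistandardYoungTableau.ext fun i j => ?_
  by_cases hij : (i, j) ∈ lam
  swap
  · rw [T.zeros hij, Y.zeros hij]
  have hj := colLen_le hlen j
  -- Column `c` of any tableau has at most `min (colLen c) (colLen j)` values in this set, and the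
  -- key attains every one of these bounds. Equal contents force equality column by column; in
  -- column `j` it says that all entries belong to `S`.
  let S : Finset (Fin n) := (Finset.univ.filter fun a : Fin n => (a : ℕ) < lam.colLen j).map
    π.toEmbedding
  have hS : S.card = lam.colLen j := by rw [Finset.card_map, card_filter_coe_lt hj]
  have hmemS : ∀ a, π a ∈ S ↔ (a : ℕ) < lam.colLen j := fun a => by simp [S]
  have h1 := card_cells_filter_mem T S
  rw [H, ← card_cells_filter_mem Y S, card_cells_filter (fun x => ∃ v ∈ S, (v : ℕ) = x),
    card_cells_filter (fun x => ∃ v ∈ S, (v : ℕ) = x)] at h1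
  have hTc : ∀ c, ((Finset.range (lam.colLen c)).filter fun i => ∃ v ∈ S, (v : ℕ) = T i c).card ≤
      min (lam.colLen c) (lam.colLen j) := by
    intro c
    refine le_min ((Finset.card_filter_le _ _).trans_eq (Finset.card_range _)) ?_
    rw [← hS, ← Finset.card_map (s := S) Fin.valEmbedding]
    refine Finset.card_le_card_of_injOn (fun i => T i c) (fun i hi => ?_) (fun x hx y hy hxy => ?_)
    · simp only [Finset.coe_filter, Set.mem_ofPred_eq] at hi
      simp only [Finset.coe_map, Set.mem_image, Finset.mem_coe, Fin.valEmbedding_apply]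
      exact hi.2
    · simp only [Finset.coe_filter, Set.mem_ofPred_eq, Finset.mem_range] at hx hy hxy
      rcases lt_trichotomy x y with h | h | h
      · have := T.col_strict h (YoungDiagram.mem_iff_lt_colLen.2 hy.1); omega
      · exact h
      · have := T.col_strict h (YoungDiagram.mem_iff_lt_colLen.2 hx.1); omega
  have hYc : ∀ c, min (lam.colLen c) (lam.colLen j) ≤
      ((Finset.range (lam.colLen c)).filter fun i => ∃ v ∈ S, (v : ℕ) = Y i c).card := by
    intro c
    have hc := colLen_le hlen c
    have e1 : ((Finset.range (lam.colLen c)).filter fun i => ∃ v ∈ S, (v : ℕ) = Y i c) =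
        (Finset.range (lam.colLen c)).filter fun i => ∃ v ∈ S, (v : ℕ) =
          sortedPrefix π (lam.colLen c) i := by
      refine Finset.filter_congr fun i hi => ?_
      rw [hY i c (YoungDiagram.mem_iff_lt_colLen.2 (Finset.mem_range.1 hi))]
      rfl
    rw [e1, card_filter_sortedPrefix π hc (fun x => ∃ v ∈ S, (v : ℕ) = x),
      ← card_filter_coe_lt (show min (lam.colLen c) (lam.colLen j) ≤ n by omega)]
    refine Finset.card_le_card fun a => ?_
    simp only [Finset.mem_filter, Finset.mem_univ, true_and]
    exact fun ha => ⟨by omega, π a, (hmemS a).2 (by omega), rfl⟩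
  have hall := (Finset.sum_eq_sum_iff_of_le fun c _ => (hTc c).trans (hYc c)).1 h1
  have hjr : j ∈ Finset.range (lam.rowLen 0) := by
    rw [Finset.mem_range]
    exact (YoungDiagram.mem_iff_lt_rowLen.1 hij).trans_le (lam.rowLen_anti 0 i (Nat.zero_le _))
  have h2 := hall j hjr
  have h3 : ((Finset.range (lam.colLen j)).filter fun i => ∃ v ∈ S, (v : ℕ) = T i j) =
      Finset.range (lam.colLen j) := by
    refine Finset.eq_of_subset_of_card_le (Finset.filter_subset _ _) ?_
    rw [h2, Finset.card_range]
    have := hYc j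
    omega
  rw [hY i j hij]
  refine eq_sortedPrefix (f := fun i => T i j) π hj
    (fun i1 i2 hi hj => T.col_strict hi (YoungDiagram.mem_iff_lt_colLen.2 hj)) (fun i hi => ?_)
    (YoungDiagram.mem_iff_lt_colLen.1 hij)
  have h4 : i ∈ Finset.range (lam.colLen j) := Finset.mem_range.2 hi
  rw [← h3, Finset.mem_filter] at h4
  obtain ⟨v, hv, e⟩ := h4.2
  refine ⟨π.symm v, ?_, by simpa using e⟩
  rw [← hmemS]
  simpa using hv

/-- A coefficient is the number of tableaux in the set with a given content, so nothing cancels. -/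
theorem exists_of_generatingPolynomial_eq {P Q : Set (SemistandardYoungTableau lam)}
    (H : generatingPolynomial n lam P = generatingPolynomial n lam Q)
    {T : SemistandardYoungTableau lam} (hT : T ∈ tableaux n lam) (hTP : T ∈ P) :
    ∃ T' ∈ Q, content n T' = content n T := by
  classical
  have h1 := congrArg (MvPolynomial.coeff (content n T)) H
  simp only [generatingPolynomial, weight_eq] at h1
  rw [coeff_sum_monomial, coeff_sum_monomial] at h1
  have h2 : 0 < ((((tableaux_finite n lam).toFinset.filter (· ∈ P)).filter
      fun i => content n i = content n T).card) :=
    Finset.card_pos.2 ⟨T, by simp [hT, hTP]⟩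
  norm_cast at h1
  rw [h1, Finset.card_pos] at h2
  obtain ⟨T', hT'⟩ := h2
  simp only [Finset.mem_filter] at hT'
  exact ⟨T', hT'.1.2, hT'.2⟩

theorem eval_one_generatingPolynomial (P : Set (SemistandardYoungTableau lam))
    (hP : P ⊆ tableaux n lam) :
    MvPolynomial.eval (fun _ => 1) (generatingPolynomial n lam P) = (P.ncard : ℤ) := by
  classical
  rw [generatingPolynomial, map_sum]
  have h1 : ∀ T : SemistandardYoungTableau lam,
      MvPolynomial.eval (fun _ => (1 : ℤ)) (weight n lam T) = 1 := by
    intro T; simp [weight]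
  rw [Finset.sum_congr rfl fun T _ => h1 T, Finset.sum_const, nsmul_eq_mul, mul_one,
    ← Set.ncard_coe_finset]
  congr 2
  ext T
  simp only [Finset.coe_filter, Set.Finite.mem_toFinset, Set.mem_ofPred_eq]
  exact ⟨fun h => h.2, fun h => ⟨hP h, h⟩⟩

/-- The monomial of the key of `π` must occur in the other polynomial. Only the key has this
content, so it lies in the other Demazure set, and the keys compare in both directions. -/
theorem demazurePolynomial_injOn (hn : 1 ≤ n) (hR : R ⊆ Finset.Icc 1 (n - 1))
    (hlen : lam.colLen 0 ≤ n) (hcol : columnLengths n lam = R) :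
    Set.InjOn (demazurePolynomial n lam) (rPermutations n R) := by
  have key : ∀ π σ, demazurePolynomial n lam π = demazurePolynomial n lam σ →
      ∀ i j, (i, j) ∈ lam → keyEntry n lam π i j ≤ keyEntry n lam σ i j := by
    intro π σ H
    obtain ⟨Y, hYt, hY⟩ := exists_keyTableau hlen π
    obtain ⟨T, hT, e⟩ := exists_of_generatingPolynomial_eq H hYt
      ((keyTableau_mem_demazureSet_iff hlen hYt hY).2 fun _ _ _ => le_rfl)
    rw [eq_keyTableau_of_content hlen hY e] at hT
    exact (keyTableau_mem_demazureSet_iff hlen hYt hY).1 hT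
  intro π hπ σ hσ H
  exact rPermutation_eq_of_keyEntry_eq hn hR hcol hπ hσ fun i j hij =>
    le_antisymm (key π σ H i j hij) (key σ π H.symm i j hij)

/-- Coincidences of row bound sums and Demazure polynomials come from coincidences of sets. -/
theorem rowBoundSet_eq_of_rowBoundSum_eq (hlen : lam.colLen 0 ≤ n) {β : Fin n → Fin n}
    {π : Equiv.Perm (Fin n)}
    (H : rowBoundSum n lam β = demazurePolynomial n lam π) :
    rowBoundSet n lam β = demazureSet n lam π := by
  obtain ⟨Y, hYt, hY⟩ := exists_keyTableau hlen π
  obtain ⟨T, hT, e⟩ := exists_of_generatingPolynomial_eq H.symm hYt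
    ((keyTableau_mem_demazureSet_iff hlen hYt hY).2 fun _ _ _ => le_rfl)
  rw [eq_keyTableau_of_content hlen hY e] at hT
  have hsub : demazureSet n lam π ⊆ rowBoundSet n lam β := by
    intro T hT'
    have h1 := demazureSet_subset_belowKey π hT'
    exact ⟨h1.1, fun i j hij => ((h1.2 i j hij).trans_eq (hY i j hij).symm).trans (hT.2 i j hij)⟩
  have hfin : (rowBoundSet n lam β).Finite := (tableaux_finite n lam).subset fun _ h => h.1
  symm
  -- One inclusion follows from the key; evaluating the polynomials at ones shows that the sets have
  -- the same number of elements.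
  refine Set.eq_of_subset_of_ncard_le hsub ?_ hfin
  have h1 := congrArg (MvPolynomial.eval fun _ => (1 : ℤ)) H
  rw [rowBoundSum, demazurePolynomial, eval_one_generatingPolynomial _ fun _ h => h.1,
    eval_one_generatingPolynomial _ fun _ h => h.1] at h1
  exact_mod_cast h1.le

end Weights

/-! ### The counts that involve tableaux -/

section Counts

variable {n : ℕ} {R : Finset ℕ} {lam : YoungDiagram}

theorem rowBoundSet_eq_demazureSet (hn : 1 ≤ n) (hR : R ⊆ Finset.Icc 1 (n - 1))
    (hlen : lam.colLen 0 ≤ n) (hcol : columnLengths n lam = R) {β : Fin n → Fin n}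
    (hβ : β ∈ upperTuples n) {π : Equiv.Perm (Fin n)} (hπ : π ∈ avoidingPermutations n R)
    (hm : Matches n R β π) : rowBoundSet n lam β = demazureSet n lam π := by
  rw [rowBoundSet_eq_belowKey hlen hcol hβ hm, demazureSet_eq_belowKey hn hR hlen hcol hπ.2]

theorem rowBoundSum_eq_demazurePolynomial (hn : 1 ≤ n) (hR : R ⊆ Finset.Icc 1 (n - 1))
    (hlen : lam.colLen 0 ≤ n) (hcol : columnLengths n lam = R) {β : Fin n → Fin n}
    (hβ : β ∈ upperTuples n) {π : Equiv.Perm (Fin n)} (hπ : π ∈ avoidingPermutations n R)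
    (hm : Matches n R β π) : rowBoundSum n lam β = demazurePolynomial n lam π := by
  rw [rowBoundSum, rowBoundSet_eq_demazureSet hn hR hlen hcol hβ hπ hm, demazurePolynomial]

/-- Both row bound sets are Demazure sets of the matching avoiding permutations, and a Demazure set
determines its `R`-permutation. -/
theorem rowBoundSet_eq_iff (hn : 1 ≤ n) (hR : R ⊆ Finset.Icc 1 (n - 1))
    (hlen : lam.colLen 0 ≤ n) (hcol : columnLengths n lam = R) {a b : Fin n → Fin n}
    (ha : a ∈ gaplessCoreTuples n R) (hb : b ∈ gaplessCoreTuples n R) :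
    rowBoundSet n lam a = rowBoundSet n lam b ↔ SameColumns n R a b := by
  obtain ⟨π, hπ, h1⟩ := exists_matches_of_gaplessCore hn hR ha
  obtain ⟨σ, hσ, h2⟩ := exists_matches_of_gaplessCore hn hR hb
  rw [h1.sameColumns_iff hn hR h2 hπ.1 hσ.1, rowBoundSet_eq_demazureSet hn hR hlen hcol ha.1 hπ h1,
    rowBoundSet_eq_demazureSet hn hR hlen hcol hb.1 hσ h2]
  exact (demazureSet_injOn hn hR hlen hcol).eq_iff hπ.1 hσ.1

theorem rowBoundSum_eq_iff (hn : 1 ≤ n) (hR : R ⊆ Finset.Icc 1 (n - 1))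
    (hlen : lam.colLen 0 ≤ n) (hcol : columnLengths n lam = R) {a b : Fin n → Fin n}
    (ha : a ∈ gaplessCoreTuples n R) (hb : b ∈ gaplessCoreTuples n R) :
    rowBoundSum n lam a = rowBoundSum n lam b ↔ SameColumns n R a b := by
  obtain ⟨π, hπ, h1⟩ := exists_matches_of_gaplessCore hn hR ha
  obtain ⟨σ, hσ, h2⟩ := exists_matches_of_gaplessCore hn hR hb
  rw [h1.sameColumns_iff hn hR h2 hπ.1 hσ.1,
    rowBoundSum_eq_demazurePolynomial hn hR hlen hcol ha.1 hπ h1,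
    rowBoundSum_eq_demazurePolynomial hn hR hlen hcol hb.1 hσ h2]
  exact (demazurePolynomial_injOn hn hR hlen hcol).eq_iff hπ.1 hσ.1

theorem exists_matches_of_avoiding (hn : 1 ≤ n) (hR : R ⊆ Finset.Icc 1 (n - 1))
    {π : Equiv.Perm (Fin n)} (hπ : π ∈ avoidingPermutations n R) :
    ∃ β ∈ upperTuples n, Matches n R β π := by
  obtain ⟨γ, h1, -, h3⟩ := exists_gaplessCore_of_avoiding hn hR hπ
  exact ⟨γ, h1.1, h3⟩

/-- A coincidence forces the permutation to avoid, and every avoiding permutation has a matching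
tuple. The pairs are the diagonal pairs of Demazure sets of avoiding permutations. -/
theorem ncard_setPairs (hn : 1 ≤ n) (hR : R ⊆ Finset.Icc 1 (n - 1))
    (hlen : lam.colLen 0 ≤ n) (hcol : columnLengths n lam = R) :
    {p : Set (SemistandardYoungTableau lam) × Set (SemistandardYoungTableau lam) |
        ∃ β ∈ upperTuples n, ∃ π ∈ rPermutations n R,
          p = (rowBoundSet n lam β, demazureSet n lam π) ∧ p.1 = p.2}.ncard =
      parabolicCatalan n R := by
  have : {p : Set (SemistandardYoungTableau lam) × Set (SemistandardYoungTableau lam) |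
        ∃ β ∈ upperTuples n, ∃ π ∈ rPermutations n R,
          p = (rowBoundSet n lam β, demazureSet n lam π) ∧ p.1 = p.2} =
      (fun π => (demazureSet n lam π, demazureSet n lam π)) '' avoidingPermutations n R := by
    refine Set.Subset.antisymm ?_ ?_
    · rintro _ ⟨β, -, π, hπ, rfl, h⟩
      simp only at h
      exact ⟨π, avoiding_of_rowBoundSet_eq hn hR hlen hcol hπ h, by rw [h]⟩
    · rintro _ ⟨π, hπ, rfl⟩
      obtain ⟨β, hβ, hm⟩ := exists_matches_of_avoiding hn hR hπ
      exact ⟨β, hβ, π, hπ.1, by rw [rowBoundSet_eq_demazureSet hn hR hlen hcol hβ hπ hm], rfl⟩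
  rw [this, Set.InjOn.ncard_image]
  · rfl
  · intro π hπ σ hσ h
    exact demazureSet_injOn hn hR hlen hcol hπ.1 hσ.1 (Prod.mk.inj h).1

theorem ncard_polynomialPairs (hn : 1 ≤ n) (hR : R ⊆ Finset.Icc 1 (n - 1))
    (hlen : lam.colLen 0 ≤ n) (hcol : columnLengths n lam = R) :
    {p : MvPolynomial (Fin n) ℤ × MvPolynomial (Fin n) ℤ |
        ∃ β ∈ upperTuples n, ∃ π ∈ rPermutations n R,
          p = (rowBoundSum n lam β, demazurePolynomial n lam π) ∧ p.1 = p.2}.ncard =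
      parabolicCatalan n R := by
  have : {p : MvPolynomial (Fin n) ℤ × MvPolynomial (Fin n) ℤ |
        ∃ β ∈ upperTuples n, ∃ π ∈ rPermutations n R,
          p = (rowBoundSum n lam β, demazurePolynomial n lam π) ∧ p.1 = p.2} =
      (fun π => (demazurePolynomial n lam π, demazurePolynomial n lam π)) ''
        avoidingPermutations n R := by
    refine Set.Subset.antisymm ?_ ?_
    · rintro _ ⟨β, -, π, hπ, rfl, h⟩
      simp only at h
      exact ⟨π, avoiding_of_rowBoundSet_eq hn hR hlen hcol hπ
        (rowBoundSet_eq_of_rowBoundSum_eq hlen h), by rw [h]⟩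
    · rintro _ ⟨π, hπ, rfl⟩
      obtain ⟨β, hβ, hm⟩ := exists_matches_of_avoiding hn hR hπ
      exact ⟨β, hβ, π, hπ.1, by rw [rowBoundSum_eq_demazurePolynomial hn hR hlen hcol hβ hπ hm], rfl⟩
  rw [this, Set.InjOn.ncard_image]
  · rfl
  · intro π hπ σ hσ h
    exact demazurePolynomial_injOn hn hR hlen hcol hπ.1 hσ.1 (Prod.mk.inj h).1

theorem ncard_demazurePolynomials (hn : 1 ≤ n) (hR : R ⊆ Finset.Icc 1 (n - 1))
    (hlen : lam.colLen 0 ≤ n) (hcol : columnLengths n lam = R) :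
    (demazurePolynomial n lam '' avoidingPermutations n R).ncard = parabolicCatalan n R :=
  Set.InjOn.ncard_image ((demazurePolynomial_injOn hn hR hlen hcol).mono fun _ h => h.1)

theorem card_approxEquiv_gaplessCoreTuples (hn : 1 ≤ n) (hR : R ⊆ Finset.Icc 1 (n - 1))
    (hlen : lam.colLen 0 ≤ n) (hcol : columnLengths n lam = R) :
    Nat.card (Quotient (approxEquiv n lam (gaplessCoreTuples n R))) = parabolicCatalan n R := by
  refine (card_quotient_ker _ (rowBoundSet n lam)).trans ?_
  exact ncard_image_eq_parabolicCatalan hn hR _ _ subset_rfl gaplessCoreTuples_represents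
    fun _ ha _ hb => rowBoundSet_eq_iff hn hR hlen hcol ha hb

theorem card_approxEquiv_upperFlags (hn : 1 ≤ n) (hR : R ⊆ Finset.Icc 1 (n - 1))
    (hlen : lam.colLen 0 ≤ n) (hcol : columnLengths n lam = R) :
    Nat.card (Quotient (approxEquiv n lam (upperFlags n))) = parabolicCatalan n R := by
  have hsub := upperFlags_subset_gaplessCoreTuples hn hR
  refine (card_quotient_ker _ (rowBoundSet n lam)).trans ?_
  exact ncard_image_eq_parabolicCatalan hn hR _ _ hsub (upperFlags_represents hn hR)
    fun _ ha _ hb => rowBoundSet_eq_iff hn hR hlen hcol (hsub ha) (hsub hb)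

theorem ncard_gaplessCoreSchur (hn : 1 ≤ n) (hR : R ⊆ Finset.Icc 1 (n - 1))
    (hlen : lam.colLen 0 ≤ n) (hcol : columnLengths n lam = R) :
    (rowBoundSum n lam '' gaplessCoreTuples n R).ncard = parabolicCatalan n R :=
  ncard_image_eq_parabolicCatalan hn hR _ _ subset_rfl gaplessCoreTuples_represents
    fun _ ha _ hb => rowBoundSum_eq_iff hn hR hlen hcol ha hb

theorem ncard_flagSchur (hn : 1 ≤ n) (hR : R ⊆ Finset.Icc 1 (n - 1))
    (hlen : lam.colLen 0 ≤ n) (hcol : columnLengths n lam = R) :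
    (rowBoundSum n lam '' upperFlags n).ncard = parabolicCatalan n R :=
  ncard_image_eq_parabolicCatalan hn hR _ _ (upperFlags_subset_gaplessCoreTuples hn hR)
    (upperFlags_represents hn hR) fun _ ha _ hb => rowBoundSum_eq_iff hn hR hlen hcol
      (upperFlags_subset_gaplessCoreTuples hn hR ha) (upperFlags_subset_gaplessCoreTuples hn hR hb)

end Counts

/-! ### Nonpermutability of disjoint lattice paths -/

section Paths

variable {n : ℕ} {R : Finset ℕ} {lam : YoungDiagram}

/-- The heights of a lattice path on the antidiagonals. -/
theorem IsLatticePath.exists_height {P Q : ℕ × ℕ} {L : List (ℕ × ℕ)} (hL : IsLatticePath P Q L) :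
    P.1 + P.2 ≤ Q.1 + Q.2 ∧ ∃ Y : ℕ → ℕ, Y (P.1 + P.2) = P.2 ∧ Y (Q.1 + Q.2) = Q.2 ∧
      (∀ s, P.1 + P.2 ≤ s → s ≤ Q.1 + Q.2 → (s - Y s, Y s) ∈ L) ∧
      ∀ s s', P.1 + P.2 ≤ s → s ≤ s' → s' ≤ Q.1 + Q.2 → Y s ≤ Y s' ∧ Y s' ≤ Y s + (s' - s) := by
  induction L generalizing P with
  | nil => exact absurd hL.2.1 (by simp)
  | cons a L ih =>
    obtain ⟨h1, h2, h3⟩ := hL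
    simp only [List.head?_cons, Option.some.injEq] at h2
    subst h2
    cases L with
    | nil =>
      simp only [List.getLast?_singleton, Option.some.injEq] at h3
      subst h3
      refine ⟨le_rfl, fun _ => a.2, rfl, rfl, fun s hs hs' => ?_,
        fun s s' _ _ _ => ⟨le_rfl, Nat.le_add_right _ _⟩⟩
      rw [show s - a.2 = a.1 by omega]
      exact List.mem_singleton.2 rfl
    | cons b L =>
      rw [List.isChain_cons_cons] at h1
      obtain ⟨hle, Y, hY0, hY1, hmem, hstep⟩ := ih (P := b)
        ⟨h1.2, rfl, by rwa [List.getLast?_cons_cons] at h3⟩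
      have hb : b.1 + b.2 = a.1 + a.2 + 1 ∧ a.2 ≤ b.2 ∧ b.2 ≤ a.2 + 1 := by
        rcases h1.1 with h | h <;> rw [h] <;> simp only <;> omega
      refine ⟨by omega, fun s => if s ≤ a.1 + a.2 then a.2 else Y s, if_pos le_rfl, ?_, ?_, ?_⟩
      · simp only
        rw [if_neg (by omega), hY1]
      · intro s hs hs'
        simp only
        split_ifs with h
        · rw [show s - a.2 = a.1 by omega]
          exact List.mem_cons_self
        · exact List.mem_cons_of_mem _ (hmem s (by omega) hs')
      · intro s s' hs hss hs'
        simp only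
        split_ifs with e1 e2 e2
        · omega
        · have := hstep (b.1 + b.2) s' le_rfl (by omega) hs'
          omega
        · omega
        · exact hstep s s' (by omega) hss hs'

theorem IsLatticePath.target_mem {P Q : ℕ × ℕ} {L : List (ℕ × ℕ)} (hL : IsLatticePath P Q L) :
    Q ∈ L := List.mem_of_getLast? hL.2.2

theorem perm_eq_one_of_strictMono {w : Equiv.Perm (Fin n)} (hw : StrictMono w) : w = 1 := by
  have h1 : Set.range w = Set.range (id : Fin n → Fin n) := by
    rw [w.surjective.range_eq, Set.range_id]
  have h2 := (StrictMono.range_inj hw strictMono_id).1 h1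
  ext a
  rw [h2]
  rfl

/-- If heights between the terminals of two paths are blocked by terminals of rows of the same
length, then disjoint paths cannot be permuted. -/
theorem isNonpermutable_of_blocked {γ : Fin n → Fin n}
    (H : ∀ i j : Fin n, i < j → ∀ v : ℕ, (γ j : ℕ) < v → v ≤ γ i →
      ∃ k : Fin n, k ≠ i ∧ lam.rowLen k = lam.rowLen j ∧ (k : ℕ) + γ j = j + v ∧ (γ k : ℕ) = v) :
    IsNonpermutable n lam γ := by
  intro w L hL hdis
  by_contra hw
  obtain ⟨i, j, hij, hwij⟩ : ∃ i j, i < j ∧ w j < w i := by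
    by_contra! hcon
    refine hw (perm_eq_one_of_strictMono fun i j hij => ?_)
    exact lt_of_le_of_ne (hcon i j hij) fun h => hij.ne (w.injective h)
  obtain ⟨hi0, Yi, hi1, hi2, hi3, hi4⟩ := (hL i).exists_height
  obtain ⟨hj0, Yj, hj1, hj2, hj3, hj4⟩ := (hL j).exists_height
  simp only [pathSource, pathTerminal, add_zero] at hi0 hi1 hi2 hi3 hi4 hj0 hj1 hj2 hj3 hj4
  have hlam := lam.rowLen_anti i j hij.le
  rw [Fin.lt_def] at hij hwij
  have hwi := (w i).2
  have hne : ∀ s, n - 1 - (w i : ℕ) ≤ s → s ≤ lam.rowLen i + (n - 1 - i) + (γ i : ℕ) →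
      n - 1 - (w j : ℕ) ≤ s → s ≤ lam.rowLen j + (n - 1 - j) + (γ j : ℕ) → Yi s ≠ Yj s := by
    intro s h1 h2 h3 h4 he
    have h5 := hi3 s h1 h2
    rw [he] at h5
    exact hdis i j (fun h => by subst h; omega) h5 (hj3 s h3 h4)
  -- For an inversion of `w`, path `i` starts on an earlier antidiagonal than path `j`, and
  -- disjointness puts it strictly above the source of path `j`. Heights change by at most one per
  -- step, so the order cannot reverse without a common vertex.
  have habove : ∀ s, n - 1 - (w j : ℕ) ≤ s → s ≤ lam.rowLen i + (n - 1 - i) + (γ i : ℕ) →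
      s ≤ lam.rowLen j + (n - 1 - j) + (γ j : ℕ) → Yj s < Yi s := by
    intro s hs
    induction s, hs using Nat.le_induction with
    | base =>
      intro h1 h2
      have := hne _ (by omega) h1 le_rfl h2
      omega
    | succ s hs ih =>
      intro h1 h2
      have := ih (by omega) (by omega)
      have := hne (s + 1) (by omega) h1 (by omega) h2
      have := hi4 s (s + 1) (by omega) (by omega) h1
      have := hj4 s (s + 1) hs (by omega) h2
      omega
  have hend := hj4 _ _ le_rfl hj0 le_rfl
  by_cases hcase : lam.rowLen j + (n - 1 - j) + (γ j : ℕ) ≤ lam.rowLen i + (n - 1 - i) + (γ i : ℕ)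
  · have h1 := habove _ hj0 hcase le_rfl
    have h2 := hi4 _ _ (by omega) hcase le_rfl
    -- On the antidiagonal where path `j` ends, path `i` passes through a vertex that is the
    -- terminal of another row of the same length as row `j`.
    obtain ⟨k, hki, hk1, hk2, hk3⟩ := H i j hij
      (Yi (lam.rowLen j + (n - 1 - j) + (γ j : ℕ))) (by omega) (by omega)
    have h3 := (hL k).target_mem
    have h4 := hi3 (lam.rowLen j + (n - 1 - j) + (γ j : ℕ)) (by omega) hcase
    simp only [pathTerminal] at h3
    rw [← hk3] at h4
    have hkn := k.2
    rw [show lam.rowLen j + (n - 1 - j) + (γ j : ℕ) - (γ k : ℕ) = lam.rowLen k + (n - 1 - k) by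
      omega] at h4
    exact hdis i k hki.symm h4 h3
  -- If path `i` ends first, path `j` is below it on that antidiagonal and hence already east of its
  -- own terminal.
  · have h1 := habove (lam.rowLen i + (n - 1 - i) + (γ i : ℕ)) (by omega) le_rfl (by omega)
    have h2 := hj4 (lam.rowLen i + (n - 1 - i) + (γ i : ℕ)) _ (by omega) (by omega) le_rfl
    omega

theorem rowLen_eq_of_inCarrel (hn : 1 ≤ n) (hR : R ⊆ Finset.Icc 1 (n - 1))
    (hlen : lam.colLen 0 ≤ n) (hcol : columnLengths n lam = R) {h : ℕ} {i j : Fin n}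
    (hi : InCarrel n R h i) (hj : InCarrel n R h j) : lam.rowLen i = lam.rowLen j := by
  have key : ∀ i j : Fin n, InCarrel n R h i → InCarrel n R h j → ∀ c, c < lam.rowLen i →
      c < lam.rowLen j := by
    intro i j hi hj c hc
    rw [← YoungDiagram.mem_iff_lt_rowLen, YoungDiagram.mem_iff_lt_colLen] at hc ⊢
    obtain ⟨g, e⟩ := exists_divider_eq_colLen hlen hcol c
    rw [← e] at hc ⊢
    have := divider_mono hn hR (show h + 1 ≤ g from carrel_le_of_lt hn hR hi.1 hc)
    have := hj.2
    omega
  by_contra hne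
  rcases Nat.lt_or_gt_of_ne hne with h1 | h1
  · exact absurd (key j i hj hi _ h1) (lt_irrefl _)
  · exact absurd (key i j hi hj _ h1) (lt_irrefl _)

/-- From `j` to the critical index where `γ_z - z` is least, `γ` climbs by ones. It reaches a value
at least `γ_i` there, by `le_of_le_critical`. So each height `v` to be blocked is the entry at `k =
j + (v - γ_j)` in the carrel of `j`, whose rows all have the same length. -/
theorem isNonpermutable_of_gaplessCore (hn : 1 ≤ n) (hR : R ⊆ Finset.Icc 1 (n - 1))
    (hlen : lam.colLen 0 ≤ n) (hcol : columnLengths n lam = R) {γ : Fin n → Fin n}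
    (hγ : γ ∈ gaplessCoreTuples n R) (hinc : IsRIncreasing n R γ) : IsNonpermutable n lam γ := by
  refine isNonpermutable_of_blocked fun i j hij v hv hv' => ?_
  obtain ⟨h, hh, hj⟩ := exists_inCarrel (R := R) j
  obtain ⟨y, h1, h2, h3⟩ := exists_critical_ge hn hR (υ := γ) hj
  have h4 := le_of_le_critical hn hR hγ hinc h2 (hij.le.trans h1)
  have h5 := h3 j le_rfl hj
  rw [Fin.lt_def] at hij
  rw [Fin.le_def] at h1 h4
  have hk : (j : ℕ) + (v - γ j) < n := by have := y.2; omega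
  have hj1 := hj.1
  have hy2 := h2.inCarrel.2
  have hkc : InCarrel n R h ⟨j + (v - γ j), hk⟩ := ⟨by simp only; omega, by simp only; omega⟩
  have h7 := le_extend_step hinc hn hR hkc.1 (show j + (v - γ j) ≤ (y : ℕ) by omega) hy2
  rw [extend_of_lt γ hk, extend_coe] at h7
  have h8 := le_extend_step hinc hn hR hj1 (show (j : ℕ) ≤ j + (v - γ j) by omega) hkc.2
  rw [extend_of_lt γ hk, extend_coe] at h8
  refine ⟨⟨j + (v - γ j), hk⟩, fun he => ?_, rowLen_eq_of_inCarrel hn hR hlen hcol hkc hj, ?_, ?_⟩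
  · have := congrArg Fin.val he
    simp only at this
    omega
  · simp only; omega
  · generalize hK : (⟨j + (v - γ j), hk⟩ : Fin n) = k at *
    have hK := congrArg Fin.val hK
    simp only at hK
    omega

end Paths

/-! ### Monomials in the Gessel–Viennot determinant -/

section Monomials

variable {n : ℕ} {R : Finset ℕ} {lam : YoungDiagram}

/-- Every multiset contributes its monomial with coefficient `1`, so no cancellation occurs and the
support is the set of these exponents. -/
theorem mem_support_rename_hsymm {b d : ℕ} (hb : b + 1 ≤ n) (m : Fin n →₀ ℕ) :
    m ∈ (MvPolynomial.rename (Fin.castLE hb) (MvPolynomial.hsymm (Fin (b + 1)) ℤ d)).support ↔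
      ∃ s : Sym (Fin (b + 1)) d, Multiset.toFinsupp ((s : Multiset _).map (Fin.castLE hb)) = m := by
  have h1 : MvPolynomial.rename (Fin.castLE hb) (MvPolynomial.hsymm (Fin (b + 1)) ℤ d) =
      ∑ s : Sym (Fin (b + 1)) d, MvPolynomial.monomial
        (Multiset.toFinsupp ((s : Multiset _).map (Fin.castLE hb))) (1 : ℤ) := by
    rw [MvPolynomial.hsymm, map_sum]
    refine Finset.sum_congr rfl fun s _ => ?_
    change MvPolynomial.rename (Fin.castLE hb) ((s : Multiset _).map MvPolynomial.X).prod = _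
    generalize (s : Multiset (Fin (b + 1))) = t
    induction t using Multiset.induction_on with
    | empty => simp
    | cons a t ih =>
      rw [Multiset.map_cons, Multiset.prod_cons, map_mul, ih, MvPolynomial.rename_X,
        Multiset.map_cons, ← Multiset.singleton_add, map_add, Multiset.toFinsupp_singleton,
        MvPolynomial.X, MvPolynomial.monomial_mul, one_mul]
  rw [MvPolynomial.mem_support_iff, h1, coeff_sum_monomial, Nat.cast_ne_zero, ← Nat.pos_iff_ne_zero,
    Finset.card_pos]
  constructor
  · rintro ⟨s, hs⟩
    exact ⟨s, (Finset.mem_filter.1 hs).2⟩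
  · rintro ⟨s, hs⟩
    exact ⟨s, Finset.mem_filter.2 ⟨Finset.mem_univ _, hs⟩⟩

theorem support_rename_hsymm_subset {b b' d : ℕ} (hb : b + 1 ≤ n) (hb' : b' + 1 ≤ n)
    (hle : b ≤ b') :
    (MvPolynomial.rename (Fin.castLE hb) (MvPolynomial.hsymm (Fin (b + 1)) ℤ d)).support ⊆
      (MvPolynomial.rename (Fin.castLE hb') (MvPolynomial.hsymm (Fin (b' + 1)) ℤ d)).support := by
  intro m
  rw [mem_support_rename_hsymm, mem_support_rename_hsymm]
  rintro ⟨s, rfl⟩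
  refine ⟨s.map (Fin.castLE (by omega)), ?_⟩
  rw [Sym.coe_map, Multiset.map_map]
  rfl

theorem support_rename_hsymm_ssubset {b b' d : ℕ} (hb : b + 1 ≤ n) (hb' : b' + 1 ≤ n)
    (hlt : b < b') (hd : d ≠ 0) :
    (MvPolynomial.rename (Fin.castLE hb) (MvPolynomial.hsymm (Fin (b + 1)) ℤ d)).support ⊂
      (MvPolynomial.rename (Fin.castLE hb') (MvPolynomial.hsymm (Fin (b' + 1)) ℤ d)).support := by
  rw [Finset.ssubset_iff_of_subset (support_rename_hsymm_subset hb hb' hlt.le)]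
  -- The extra monomial is the `d`-th power of the largest variable of the bigger alphabet; it is
  -- new because `d` is not zero.
  refine ⟨Multiset.toFinsupp (((Sym.replicate d (Fin.last b') : Sym _ d) : Multiset _).map
    (Fin.castLE hb')), (mem_support_rename_hsymm hb' _).2 ⟨_, rfl⟩, ?_⟩
  rw [mem_support_rename_hsymm]
  rintro ⟨s, hs⟩
  have h1 := Multiset.toFinsupp.injective hs
  have h2 : Fin.castLE hb' (Fin.last b') ∈ (s : Multiset _).map (Fin.castLE hb) := by
    rw [h1]
    exact Multiset.mem_map_of_mem _ (by simp [hd])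
  obtain ⟨x, -, hx⟩ := Multiset.mem_map.1 h2
  have := congrArg Fin.val hx
  simp only [Fin.val_castLE, Fin.val_last] at this
  have := x.2
  omega

theorem gesselViennotMatrix_support_subset {β β' : Fin n → Fin n} (hle : β ≤ β') (i j : Fin n) :
    (gesselViennotMatrix n lam β i j).support ⊆ (gesselViennotMatrix n lam β' i j).support := by
  simp only [gesselViennotMatrix, Matrix.of_apply]
  split_ifs
  · exact support_rename_hsymm_subset _ _ (hle i)
  · exact subset_rfl

theorem monomialCount_lt {β β' : Fin n → Fin n} (hβ : β ∈ upperTuples n) (hle : β ≤ β')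
    (hne : β ≠ β') : monomialCount n lam β < monomialCount n lam β' := by
  obtain ⟨i, hi⟩ := Function.ne_iff.1 hne
  have hlt := lt_of_le_of_ne (hle i) hi
  rw [Fin.lt_def] at hlt
  have h1 := hβ i
  rw [Fin.le_def] at h1
  have h2 := (β' i).2
  have hmono := fun i j => Finset.card_le_card
    (gesselViennotMatrix_support_subset (lam := lam) hle i j)
  -- The last column is a strict witness: from `i ≤ β_i < β'_i` follows `i < n - 1`, so the degree
  -- of that entry is positive.
  refine Finset.sum_lt_sum (fun i _ => Finset.sum_le_sum fun j _ => hmono i j)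
    ⟨i, Finset.mem_univ _, Finset.sum_lt_sum (fun j _ => hmono i j)
      ⟨⟨n - 1, by omega⟩, Finset.mem_univ _, Finset.card_lt_card ?_⟩⟩
  simp only [gesselViennotMatrix, Matrix.of_apply]
  rw [if_pos (by omega), if_pos (by omega)]
  exact support_rename_hsymm_ssubset _ _ hlt (by omega)

end Monomials

/-! ### Maximally efficient inputs -/

section Efficiency

variable {n : ℕ} {R : Finset ℕ} {lam : YoungDiagram}

/-- The largest columns for `a` fit together to a tableau, which is the entrywise maximum of the row
bound set of `a`. -/
theorem colMax_le_of_rowBoundSet_eq (hlen : lam.colLen 0 ≤ n) {a b : Fin n → Fin n}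
    (ha : a ∈ upperTuples n) (hb : b ∈ upperTuples n)
    (H : rowBoundSet n lam a = rowBoundSet n lam b) {i j : ℕ} (hij : (i, j) ∈ lam) :
    colMax (extend a) (lam.colLen j) i ≤ colMax (extend b) (lam.colLen j) i := by
  obtain ⟨T, hT⟩ := exists_tableau (lam := lam) (fun i j => colMax (extend a) (lam.colLen j) i)
    (fun i j1 j2 hj hi => colMax_anti (le_extend ha) hi (lam.colLen_anti _ _ hj.le))
    (fun i1 i2 j hi hj => colMax_strictMono (le_extend ha) hi hj)
  have h1 : T ∈ rowBoundSet n lam a := by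
    rw [mem_rowBoundSet_iff hlen ha]
    refine ⟨fun i j hij => ?_, fun i j hij => (hT i j hij).le⟩
    rw [hT i j hij]
    exact colMax_lt ha (colLen_le hlen j) (YoungDiagram.mem_iff_lt_colLen.1 hij)
  rw [H, mem_rowBoundSet_iff hlen hb] at h1
  rw [← hT i j hij]
  exact h1.2 i j hij

/-- This covers arbitrary upper tuples, as competing inputs need not be gapless core tuples. Length
`n` may be missing from the shape, but the column of that length is the same for all upper tuples.
-/
theorem sameColumns_of_rowBoundSet_eq (hlen : lam.colLen 0 ≤ n) (hcol : columnLengths n lam = R)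
    {a b : Fin n → Fin n} (ha : a ∈ upperTuples n) (hb : b ∈ upperTuples n)
    (H : rowBoundSet n lam a = rowBoundSet n lam b) : SameColumns n R a b := by
  intro h i hi
  rcases Nat.eq_zero_or_pos h with rfl | h0
  · rw [divider_zero] at hi; omega
  by_cases hh : h ≤ R.card
  · obtain ⟨j, e⟩ := exists_colLen_eq hcol (divider_mem (n := n) h0 hh)
    rw [← e] at hi ⊢
    have hij := YoungDiagram.mem_iff_lt_colLen.2 hi
    exact le_antisymm (colMax_le_of_rowBoundSet_eq hlen ha hb H hij)
      (colMax_le_of_rowBoundSet_eq hlen hb ha H.symm hij)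
  · rw [divider_of_card_lt (by omega)] at hi ⊢
    rw [colMax_top ha hi, colMax_top hb hi]

theorem isCore_self (hn : 1 ≤ n) (hR : R ⊆ Finset.Icc 1 (n - 1)) {γ : Fin n → Fin n}
    (hγ : γ ∈ upperTuples n) (hinc : IsRIncreasing n R γ) : IsCore n R γ γ := by
  obtain ⟨δ, hδ⟩ := exists_isCore hn hR hγ
  exact hδ.eq_of_isRIncreasing hn hR hγ hinc ▸ hδ

/-- All upper tuples that yield the polynomial of a gapless `R`-tuple `γ` have more monomials. -/
theorem monomialCount_lt_of_rowBoundSum_eq (hn : 1 ≤ n) (hR : R ⊆ Finset.Icc 1 (n - 1))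
    (hlen : lam.colLen 0 ≤ n) (hcol : columnLengths n lam = R) {γ β : Fin n → Fin n}
    (hγ : γ ∈ gaplessCoreTuples n R) (hinc : IsRIncreasing n R γ) (hβ : β ∈ upperTuples n)
    (H : rowBoundSum n lam β = rowBoundSum n lam γ) (hne : β ≠ γ) :
    monomialCount n lam γ < monomialCount n lam β := by
  obtain ⟨π, hπ, hm⟩ := exists_matches_of_gaplessCore hn hR hγ
  rw [rowBoundSum_eq_demazurePolynomial hn hR hlen hcol hγ.1 hπ hm] at H
  -- Passing through the Demazure polynomial upgrades equality of polynomials to equality of tableau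
  -- sets, although `β` is only known to be upper.
  have h1 := rowBoundSet_eq_of_rowBoundSum_eq hlen H
  rw [← rowBoundSet_eq_demazureSet hn hR hlen hcol hγ.1 hπ hm] at h1
  have h2 := (sameColumns_of_rowBoundSet_eq hlen hcol hγ.1 hβ h1.symm).isCore
    (isCore_self hn hR hγ.1 hinc)
  exact monomialCount_lt hγ.1 (h2.le hβ) hne.symm

/-- The core of a flag is a valid input for its polynomial, and it has strictly fewer monomials than
every other upper tuple with that polynomial. Conversely, an `R`-increasing gapless core tuple is
the core of some flag. -/
theorem maximallyEfficientInputs_eq (hn : 1 ≤ n) (hR : R ⊆ Finset.Icc 1 (n - 1))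
    (hlen : lam.colLen 0 ≤ n) (hcol : columnLengths n lam = R) :
    maximallyEfficientInputs n lam = {γ | γ ∈ gaplessCoreTuples n R ∧ IsRIncreasing n R γ} := by
  have hvalid : ∀ γ ∈ gaplessCoreTuples n R, IsRIncreasing n R γ → ∀ φ ∈ upperFlags n,
      SameColumns n R φ γ → γ ∈ validInputs n lam (rowBoundSum n lam φ) := by
    intro γ hγ hinc φ hφ hsame
    refine ⟨hγ.1, isNonpermutable_of_gaplessCore hn hR hlen hcol hγ hinc, Eq.symm ?_⟩
    exact (rowBoundSum_eq_iff hn hR hlen hcol (upperFlags_subset_gaplessCoreTuples hn hR hφ) hγ).2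
      hsame
  refine Set.Subset.antisymm ?_ ?_
  · rintro β ⟨φ, hφ, hβ, hmin⟩
    obtain ⟨γ, hγ⟩ := exists_isCore hn hR hφ.1
    have hsame := hγ.sameColumns hn hR hφ.1
    have hγg := hsame.mem_gaplessCoreTuples hn hR (upperFlags_subset_gaplessCoreTuples hn hR hφ)
      (hγ.mem_upperTuples hφ.1)
    have hinc := hγ.isRIncreasing hφ.1
    have hv := hvalid γ hγg hinc φ hφ hsame
    by_cases hne : β = γ
    · exact hne ▸ ⟨hγg, hinc⟩
    · have h1 := hmin γ hv (Ne.symm hne)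
      have h2 := monomialCount_lt_of_rowBoundSum_eq hn hR hlen hcol hγg hinc hβ.1
        (hβ.2.2.trans hv.2.2.symm) hne
      omega
  · rintro γ ⟨hγ, hinc⟩
    obtain ⟨φ, hφ, hsame⟩ := upperFlags_represents hn hR γ hγ hinc
    have hv := hvalid γ hγ hinc φ hφ hsame
    exact ⟨φ, hφ, hv, fun β hβ hne => monomialCount_lt_of_rowBoundSum_eq hn hR hlen hcol hγ hinc
      hβ.1 (hβ.2.2.trans hv.2.2.symm) hne⟩

theorem ncard_maximallyEfficientInputs (hn : 1 ≤ n) (hR : R ⊆ Finset.Icc 1 (n - 1))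
    (hlen : lam.colLen 0 ≤ n) (hcol : columnLengths n lam = R) :
    (maximallyEfficientInputs n lam).ncard = parabolicCatalan n R := by
  rw [maximallyEfficientInputs_eq hn hR hlen hcol,
    ← Set.image_id {γ | γ ∈ gaplessCoreTuples n R ∧ IsRIncreasing n R γ}]
  refine ncard_image_eq_parabolicCatalan hn hR _ _ (fun _ h => h.1)
    (fun γ h1 h2 => ⟨γ, ⟨h1, h2⟩, sameColumns_of_eq rfl⟩)
    fun a ha b hb => ⟨sameColumns_of_eq, fun H => ?_⟩
  exact ((H.isCore (isCore_self hn hR ha.1.1 ha.2)).unique (isCore_self hn hR hb.1.1 hb.2))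

end Efficiency

end ParabolicCatalan

theorem theorem13p1 (n : ℕ) (hn : 1 ≤ n) (R : Finset ℕ) (hR : R ⊆ Finset.Icc 1 (n - 1)) :
    -- flag critical lists
    (flagCriticalLists n R).ncard = parabolicCatalan n R ∧
    -- canopy tuples, floor flags, ceiling flags
    (canopyTuples n R).ncard = parabolicCatalan n R ∧
    (floorFlags n R).ncard = parabolicCatalan n R ∧
    (ceilingFlags n R).ncard = parabolicCatalan n R ∧
    -- classes of the relation on tuples
    Nat.card (Quotient (simEquiv n R (gaplessCoreTuples n R))) = parabolicCatalan n R ∧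
    Nat.card (Quotient (simEquiv n R (upperFlags n))) = parabolicCatalan n R ∧
    ∀ lam : YoungDiagram, lam.colLen 0 ≤ n → columnLengths n lam = R →
      -- classes of the relation given by tableau sets
      Nat.card (Quotient (approxEquiv n lam (gaplessCoreTuples n R))) = parabolicCatalan n R ∧
      Nat.card (Quotient (approxEquiv n lam (upperFlags n))) = parabolicCatalan n R ∧
      -- Demazure, gapless core Schur and flag Schur polynomials
      (demazurePolynomial n lam '' avoidingPermutations n R).ncard = parabolicCatalan n R ∧
      (rowBoundSum n lam '' gaplessCoreTuples n R).ncard = parabolicCatalan n R ∧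
      (rowBoundSum n lam '' upperFlags n).ncard = parabolicCatalan n R ∧
      -- coincident pairs of tableau sets, coincident pairs of polynomials
      {p : Set (SemistandardYoungTableau lam) × Set (SemistandardYoungTableau lam) |
        ∃ β ∈ upperTuples n, ∃ π ∈ rPermutations n R,
          p = (rowBoundSet n lam β, demazureSet n lam π) ∧ p.1 = p.2}.ncard =
        parabolicCatalan n R ∧
      {p : MvPolynomial (Fin n) ℤ × MvPolynomial (Fin n) ℤ |
        ∃ β ∈ upperTuples n, ∃ π ∈ rPermutations n R,
          p = (rowBoundSum n lam β, demazurePolynomial n lam π) ∧ p.1 = p.2}.ncard =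
        parabolicCatalan n R ∧
      -- maximally efficient inputs
      (maximallyEfficientInputs n lam).ncard = parabolicCatalan n R := by
  exact ⟨ncard_flagCriticalLists hn hR, ncard_canopyTuples hn hR, ncard_floorFlags hn hR,
    ncard_ceilingFlags hn hR, card_simEquiv_gaplessCoreTuples hn hR,
    card_simEquiv_upperFlags hn hR, fun lam hlen hcol =>
    ⟨card_approxEquiv_gaplessCoreTuples hn hR hlen hcol,
    card_approxEquiv_upperFlags hn hR hlen hcol,
    ncard_demazurePolynomials hn hR hlen hcol,
    ncard_gaplessCoreSchur hn hR hlen hcol,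
    ncard_flagSchur hn hR hlen hcol,
    ncard_setPairs hn hR hlen hcol,
    ncard_polynomialPairs hn hR hlen hcol,
    ncard_maximallyEfficientInputs hn hR hlen hcol⟩⟩
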